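/- Knots are (tame) knots in the oriented 3-sphere $S^3$, given by planar knot diagrams up to planar isotopy and Reidemeister moves. For a knot diagram $D$, let $\sigma_-$ be the state that chooses the $B$-resolution at every crossing of $D$, and let $G_{\sigma_-}(D)$ be its state graph: its vertices are the circles obtained from $D$ by these resolutions, and every crossing of $D$ gives an edge, which joins the circles (possibly equal) of the two arcs that replace the crossing. The diagram $D$ is $B$-adequate if $G_{\sigma_-}(D)$ has no one-edged loop, and a knot is $B$-adequate if it has a $B$-adequate diagram. (The $A$-resolution joins the two regions that the overstrand sweeps when it is turned counterclockwise towards the understrand; the $B$-resolution joins the two other regions.) For a knot $K$, the untwisted negative Whitehead double $W_1^0(K)$ is the satellite of $K$ whose pattern, in a solid torus $V$, consists of two parallel copies of the core of $V$ (parallel with respect to the preferred longitude of $V$) that are joined by a clasp with two negative crossings, and for which $V$ is embedded as a neighbourhood of $K$ so that its preferred longitude is sent to the preferred longitude of $K$. In terms of diagrams: take a diagram of $K$ with writhe $0$, replace it by two parallel copies in the plane, and insert a negative clasp between the two parallel copies at some point of the diagram. **Proposition.** Let $K$ be a knot which has a $B$-adequate diagram with non-negative writhe. Then the untwisted negative Whitehead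 double $W_1^0(K)$ of $K$ is also $B$-adequate. -/

import Mathlib

/-!
Tame knots in the oriented 3-sphere, given by knot diagrams in the plane modulo planar isotopy and
Reidemeister moves.

A planar diagram is recorded in sliced form: after a planar isotopy the height function is generic,
so that the diagram is a finite stack of layers, read from bottom to top, and each layer holds a
single minimum, maximum or crossing next to some vertical strands.
-/

namespace KnotTheory

/-- The event of a layer: `cup` is a local minimum, `cap` is a local maximum, and `cross b` is a
crossing. In the crossing `cross true` the overstrand runs between the bottom left and the top right
end, in `cross false` it runs between the bottom right and the top left end. -/
inductive Event where
  | cup : Event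
  | cap : Event
  | cross (b : Bool) : Event

/-- The number of strand ends at the bottom of an event. -/
def Event.inn : Event → ℕ
  | .cup => 0
  | .cap => 2
  | .cross _ => 2

/-- The number of strand ends at the top of an event. -/
def Event.out : Event → ℕ
  | .cup => 2
  | .cap => 0
  | .cross _ => 2

/-- A layer: an event with `pos` vertical strands to its left (strands are numbered from the left,
starting with `0`), and further vertical strands to its right. -/
structure Layer where
  event : Event
  pos : ℕ

/-- The layer with a local minimum whose two ends are the strands `i`, `i + 1` above it. -/
abbrev cup (i : ℕ) : Layer := ⟨.cup, i⟩

/-- The layer with a local maximum that joins the strands `i`, `i + 1` below it. -/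
abbrev cap (i : ℕ) : Layer := ⟨.cap, i⟩

/-- The layer with a crossing of the strands `i`, `i + 1`. -/
abbrev cross (b : Bool) (i : ℕ) : Layer := ⟨.cross b, i⟩

/-- The number of strands above a layer that has `n` strands below it. -/
def Layer.above (x : Layer) (n : ℕ) : ℕ := n - x.event.inn + x.event.out

/-- The stack of layers fits together, starting with `n` strands at the bottom and ending with no
strand at the top. -/
def ClosesFrom : ℕ → List Layer → Prop
  | n, [] => n = 0
  | n, x :: w => x.pos + x.event.inn ≤ n ∧ ClosesFrom (x.above n) w

/-- A link diagram (without orientation) in the plane, in sliced form. -/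
structure LinkDiagram where
  word : List Layer
  closes : ClosesFrom 0 word

/-! ### Reidemeister moves -/

/-- The local moves: planar isotopies and the three Reidemeister moves. -/
inductive Move : List Layer → List Layer → Prop
  /-- Planar isotopy: two events that lie side by side exchange their heights. -/
  | exchange (e f : Event) (i d : ℕ) :
      Move [⟨e, i⟩, ⟨f, i + e.out + d⟩] [⟨f, i + e.inn + d⟩, ⟨e, i⟩]
  /-- Planar isotopy: straightening of a strand. -/
  | zigzag (i : ℕ) : Move [cup (i + 1), cap i] []
  /-- Planar isotopy: straightening of a strand. -/
  | zagzig (i : ℕ) : Move [cup i, cap (i + 1)] []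
  /-- Planar isotopy: a crossing moves from one leg of a local maximum to the other. -/
  | slide_cap (b : Bool) (i : ℕ) : Move [cross b i, cap (i + 1)] [cross (!b) (i + 1), cap i]
  /-- Planar isotopy: a crossing moves from one leg of a local minimum to the other. -/
  | slide_cup (b : Bool) (i : ℕ) : Move [cup (i + 1), cross b i] [cup i, cross (!b) (i + 1)]
  /-- First Reidemeister move at a local maximum. -/
  | reidemeister_one_cap (b : Bool) (i : ℕ) : Move [cross b i, cap i] [cap i]
  /-- First Reidemeister move at a local minimum. -/
  | reidemeister_one_cup (b : Bool) (i : ℕ) : Move [cup i, cross b i] [cup i]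
  /-- Second Reidemeister move. -/
  | reidemeister_two (b : Bool) (i : ℕ) : Move [cross b i, cross (!b) i] []
  /-- Third Reidemeister move; the hypothesis says that one of the three strands lies above the two
  others and one lies below the two others. -/
  | reidemeister_three (a b c : Bool) (i : ℕ) (h : b = a ∨ b = c) :
      Move [cross a i, cross b (i + 1), cross c i] [cross c (i + 1), cross b i, cross a (i + 1)]

/-- `E` arises from `D` by a local move in some place. -/
def LinkDiagram.Step (D E : LinkDiagram) : Prop :=
  ∃ u v l r : List Layer, Move l r ∧ D.word = u ++ l ++ v ∧ E.word = u ++ r ++ v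

/-- Two diagrams are equivalent (present isotopic links) if they are connected by a finite sequence
of moves and inverse moves. -/
def LinkDiagram.Equivalent : LinkDiagram → LinkDiagram → Prop := Relation.EqvGen LinkDiagram.Step

/-! ### Strands, components, states -/

/-- The number of strands at level `k`, that is, above the first `k` layers. -/
def LinkDiagram.width (D : LinkDiagram) (k : ℕ) : ℕ :=
  (D.word.take k).foldl (fun n x => x.above n) 0

/-- The points where the diagram meets the levels between the layers: `(k, j)` is the point of
level `k` on the strand number `j`. -/
def LinkDiagram.IsPoint (D : LinkDiagram) (p : ℕ × ℕ) : Prop :=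
  p.1 ≤ D.word.length ∧ p.2 < D.width p.1

/-- The points of a diagram. -/
abbrev LinkDiagram.Point (D : LinkDiagram) : Type := {p : ℕ × ℕ // D.IsPoint p}

/-- The two resolutions of a crossing. -/
inductive Resolution where
  | A : Resolution
  | B : Resolution

/-- A crossing replaced by two vertical arcs. -/
def verticalArcs : List ((ℕ × ℕ) × (ℕ × ℕ)) := [((0, 0), (1, 0)), ((0, 1), (1, 1))]

/-- A crossing replaced by a local maximum (below) and a local minimum (above). -/
def horizontalArcs : List ((ℕ × ℕ) × (ℕ × ℕ)) := [((0, 0), (0, 1)), ((1, 0), (1, 1))]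

/-- The arcs of an event, where `(0, j)` is the `j`-th end at its bottom and `(1, j)` is the `j`-th
end at its top. A crossing is left as it is (`none`), or it is replaced by its `A`-resolution or
`B`-resolution. The `A`-resolution joins the two regions that the overstrand sweeps when it is turned
counterclockwise towards the understrand: these are the regions above and below the crossing in
`cross true`, and the regions to the left and to the right of it in `cross false`. The
`B`-resolution joins the two other regions. -/
def Event.arcs : Option Resolution → Event → List ((ℕ × ℕ) × (ℕ × ℕ))
  | _, .cup => [((1, 0), (1, 1))]
  | _, .cap => [((0, 0), (0, 1))]
  | none, .cross _ => [((0, 0), (1, 1)), ((0, 1), (1, 0))]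
  | some .A, .cross true => verticalArcs
  | some .A, .cross false => horizontalArcs
  | some .B, .cross true => horizontalArcs
  | some .B, .cross false => verticalArcs

/-- The points `p` and `q` are the two ends of an arc inside one layer, after the crossing in layer
`k` has been treated as `σ k` says. The first two cases are the vertical strands to the left and to
the right of the event. -/
def LinkDiagram.Joined (D : LinkDiagram) (σ : ℕ → Option Resolution) (p q : D.Point) : Prop :=
  ∃ (k : ℕ) (x : Layer), D.word[k]? = some x ∧
    ((∃ j, j < x.pos ∧ p.1 = (k, j) ∧ q.1 = (k + 1, j)) ∨
     (∃ j, p.1 = (k, x.pos + x.event.inn + j) ∧ q.1 = (k + 1, x.pos + x.event.out + j)) ∨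
     (∃ a ∈ x.event.arcs (σ k), p.1 = (k + a.1.1, x.pos + a.1.2) ∧
        q.1 = (k + a.2.1, x.pos + a.2.2)))

/-- The circles of a diagram whose crossings have been treated as `σ` says: classes of points for
the equivalence relation generated by being joined by an arc. -/
abbrev LinkDiagram.Circle (D : LinkDiagram) (σ : ℕ → Option Resolution) : Type := Quot (D.Joined σ)

/-- The diagram presents a knot: it has exactly one component. -/
def LinkDiagram.IsKnot (D : LinkDiagram) : Prop := ∃! _c : D.Circle (fun _ => none), True

/-- The circles of the state that chooses the resolution `σ k` at the crossing in layer `k`. -/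
abbrev LinkDiagram.StateCircle (D : LinkDiagram) (σ : ℕ → Resolution) : Type :=
  D.Circle (fun k => some (σ k))

/-- The state circles `c`, `c'` are the ends of the dotted segment that records the place of the
crossing in layer `k`. Of the two arcs that replace a crossing, one contains its bottom left end and
the other contains its top right end, in each of the two resolutions. -/
def LinkDiagram.Segment (D : LinkDiagram) (σ : ℕ → Resolution) (k : ℕ)
    (c c' : D.StateCircle σ) : Prop :=
  ∃ (b : Bool) (i : ℕ) (p q : D.Point), D.word[k]? = some (cross b i) ∧
    p.1 = (k, i) ∧ q.1 = (k + 1, i + 1) ∧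
    ((c = Quot.mk _ p ∧ c' = Quot.mk _ q) ∨ (c = Quot.mk _ q ∧ c' = Quot.mk _ p))

/-- The state graph: a multigraph whose vertices are the state circles and whose edges are the
crossings (named by the number of their layer). -/
def LinkDiagram.stateGraph (D : LinkDiagram) (σ : ℕ → Resolution) :
    Graph (D.StateCircle σ) ℕ where
  vertexSet := Set.univ
  IsLink := D.Segment σ
  isLink_symm := by
    intro e _
    refine ⟨?_⟩
    rintro c c' ⟨b, i, p, q, h, hp, hq, hc⟩
    exact ⟨b, i, p, q, h, hp, hq, hc.symm.imp And.symm And.symm⟩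
  eq_or_eq_of_isLink_of_isLink := by
    rintro e x y v w ⟨b, i, p, q, h, hp, hq, hc⟩ ⟨b', i', p', q', h', hp', hq', hc'⟩
    have hi : i' = i := by
      have := h.symm.trans h'
      simp only [cross, Option.some.injEq, Layer.mk.injEq] at this
      exact this.2.symm
    subst hi
    have hpp : p' = p := Subtype.ext (hp'.trans hp.symm)
    have hqq : q' = q := Subtype.ext (hq'.trans hq.symm)
    subst hpp hqq
    rcases hc with ⟨rfl, rfl⟩ | ⟨rfl, rfl⟩ <;> rcases hc' with ⟨rfl, rfl⟩ | ⟨rfl, rfl⟩ <;>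
      first | exact Or.inl rfl | exact Or.inr rfl
  left_mem_of_isLink := fun _ _ _ _ => Set.mem_univ _

/-- A diagram is `B`-adequate if the state graph of the all-`B` state has no one-edged loop. -/
def LinkDiagram.BAdequate (D : LinkDiagram) : Prop :=
  ∀ k c, ¬ (D.stateGraph (fun _ => .B)).IsLoopAt k c

/-! ### Writhe -/

/-- `o` orients the diagram (`true` is upwards, `false` is downwards): the direction is kept along
an arc from one level to the next one, and it changes along an arc that turns back to its level. -/
def LinkDiagram.IsOrientation (D : LinkDiagram) (o : ℕ × ℕ → Bool) : Prop :=
  ∀ p q : D.Point, D.Joined (fun _ => none) p q → (o p.1 = o q.1 ↔ p.1.1 ≠ q.1.1)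

/-- The sign of a crossing whose two strands, at their bottom ends, have the directions `s`
(left) and `t` (right): `cross true` is positive if both strands run upwards. -/
def crossingSign (b s t : Bool) : ℤ := if (s = t) ↔ (b = true) then 1 else -1

/-- The contribution of a layer to the writhe. -/
def layerSign (o : ℕ × ℕ → Bool) (k : ℕ) : Layer → ℤ
  | ⟨.cross b, i⟩ => crossingSign b (o (k, i)) (o (k, i + 1))
  | _ => 0

/-- The diagram has writhe `w`: this is the sum of the signs of its crossings for an orientation of
the diagram. (A knot diagram has two orientations, and they give the same writhe.) -/
def LinkDiagram.HasWrithe (D : LinkDiagram) (w : ℤ) : Prop :=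
  ∃ o, D.IsOrientation o ∧ w = ∑ k : Fin D.word.length, layerSign o k (D.word.get k)

/-! ### Knots -/

/-- A knot diagram. -/
abbrev KnotDiagram : Type := {D : LinkDiagram // D.IsKnot}

/-- Equivalence of knot diagrams. -/
instance knotSetoid : Setoid KnotDiagram where
  r D E := D.1.Equivalent E.1
  iseqv := ⟨fun _ => .refl _, fun h => .symm _ _ h, fun h h' => .trans _ _ _ h h'⟩

/-- Knots (isotopy classes, without orientation of the knot) in the oriented 3-sphere. -/
def Knot : Type := Quotient knotSetoid

/-- The knot `K` has the diagram `D`. -/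
def Knot.HasDiagram (K : Knot) (D : LinkDiagram) : Prop :=
  ∃ h : D.IsKnot, K = Quotient.mk knotSetoid ⟨D, h⟩

/-- A knot is `B`-adequate if it has a `B`-adequate diagram. -/
def Knot.BAdequate (K : Knot) : Prop := ∃ D, K.HasDiagram D ∧ D.BAdequate

/-! ### Whitehead doubles -/

/-- The blackboard parallel of a layer: the strand `j` is replaced by the two parallel strands
`2 * j` and `2 * j + 1`, and a crossing is replaced by four crossings. -/
def Layer.double : Layer → List Layer
  | ⟨.cup, i⟩ => [cup (2 * i), cup (2 * i + 1)]
  | ⟨.cap, i⟩ => [cap (2 * i + 1), cap (2 * i)]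
  | ⟨.cross b, i⟩ =>
      [cross b (2 * i + 1), cross b (2 * i), cross b (2 * i + 2), cross b (2 * i + 1)]

/-- A clasp of the strands `i` and `i + 1`: below, these two strands are joined by a local maximum,
above, they are joined by a local minimum, and the two turning arcs are hooked into each other in
two crossings. For opposite orientations of the two strands both crossings are negative. -/
def negativeClasp (i : ℕ) : List Layer :=
  [cup (i + 1), cross false i, cross false (i + 2), cap (i + 1)]

/-- The diagram `E` is obtained from two blackboard parallel copies of the diagram `D` by a negative
clasp of the two copies at the point `p` of `D`. -/
def LinkDiagram.IsNegativeClaspedParallel (D E : LinkDiagram) (p : D.Point) : Prop :=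
  E.word = (D.word.take p.1.1).flatMap Layer.double ++ negativeClasp (2 * p.1.2) ++
    (D.word.drop p.1.1).flatMap Layer.double

/-- `W` is the untwisted negative Whitehead double of `K`: the satellite of `K` whose pattern is the
negative clasp of two parallel copies of the core of a solid torus, and whose solid torus is embedded
faithfully, that is, with the preferred longitude of the solid torus mapped to the preferred
longitude of `K`. A diagram `D` of `K` presents this embedding by its blackboard framing precisely
if the writhe of `D` is `0`. -/
def Knot.IsUntwistedNegativeWhiteheadDouble (W K : Knot) : Prop :=
  ∃ (D E : LinkDiagram) (p : D.Point), K.HasDiagram D ∧ D.HasWrithe 0 ∧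
    D.IsNegativeClaspedParallel E p ∧ W.HasDiagram E

end KnotTheory

/-! The all-`B` state graph has a loop only if some crossing touches a single state circle twice.
Take a `B`-adequate diagram of writhe `w ≥ 0`. A negative kink can be added so that its
`B`-resolution splits off a new small circle, which the new crossing joins to an old one; no loop
arises, and the writhe drops by one. After `w` kinks the writhe is `0`
(`LinkDiagram.BAdequate.exists_writhe_zero`). A positive kink would produce a loop, hence the
condition on the writhe.

Now pass to the blackboard parallel. Its all-`B` state consists of two parallel copies of every
state circle. The four crossings that come from one crossing join either the two copies of one
circle, or copies of two circles that were already adjacent. The `B`-resolved negative clasp leaves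
both strands alone and adds one circle between them, joined once to each. So there is still no loop
(`LinkDiagram.BAdequate.claspedParallel`). These checks are local, because a graph has no loop if
and only if its vertices have a labeling with different labels at the ends of every edge
(`LinkDiagram.bAdequate_iff`).

A Whitehead double `W` may be presented by any diagram of `K` of writhe `0`, clasped at any point,
so the rest of the work is well-definedness (`LinkDiagram.Equivalent.clasped`). The clasp slides
along the parallel strands past every event, so in a knot its place does not matter. All moves
except the first Reidemeister move lift to isotopies of the parallel. A kink doubles to a full twist
of the two strands, which is stored next to the clasp. The number of stored twists changes by the
difference of the writhes, and this is `0` between two diagrams of writhe `0`. The moves on concrete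
words are verified by `decide` from lists of rewriting steps.

Both the number of components and the writhe are read off from labelings of the strands, which local
moves transport (`MoveFraming.run_iff`). The clasped parallel is a knot diagram because a labeling
constant along its strands gives unordered pairs of labels along the original knot, and the clasp
forces the two members of a pair to agree (`LinkDiagram.IsNegativeClaspedParallel.isKnot`). -/

namespace KnotTheory

/-! ### Words of layers -/

/-- The word `w` is a tangle with `n` strands at the bottom and `m` strands at the top. -/
def Fits : ℕ → List Layer → ℕ → Prop
  | n, [], m => n = m
  | n, x :: w, m => x.pos + x.event.inn ≤ n ∧ Fits (x.above n) w m

instance Fits.decidable : ∀ n w m, Decidable (Fits n w m)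
  | n, [], m => inferInstanceAs (Decidable (n = m))
  | n, x :: w, m =>
    have := Fits.decidable (x.above n) w m
    inferInstanceAs (Decidable (_ ∧ _))

theorem closesFrom_iff_fits : ∀ {n : ℕ} {w : List Layer}, ClosesFrom n w ↔ Fits n w 0
  | _, [] => Iff.rfl
  | _, _ :: _ => and_congr_right fun _ => closesFrom_iff_fits

theorem fits_nil {n m : ℕ} : Fits n [] m ↔ n = m := Iff.rfl

theorem fits_cons {n m : ℕ} {x : Layer} {w : List Layer} :
    Fits n (x :: w) m ↔ x.pos + x.event.inn ≤ n ∧ Fits (x.above n) w m := Iff.rfl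

theorem Fits.refl (n : ℕ) : Fits n [] n := rfl

theorem fits_append {n m : ℕ} {u v : List Layer} :
    Fits n (u ++ v) m ↔ ∃ k, Fits n u k ∧ Fits k v m := by
  induction u generalizing n with
  | nil => simp [fits_nil]
  | cons x u ih => simp [fits_cons, ih, and_assoc]

theorem Fits.append {n k m : ℕ} {u v : List Layer} (hu : Fits n u k) (hv : Fits k v m) :
    Fits n (u ++ v) m := fits_append.2 ⟨k, hu, hv⟩

theorem Fits.unique {n m m' : ℕ} {w : List Layer} (h : Fits n w m) (h' : Fits n w m') :
    m = m' := by
  induction w generalizing n with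
  | nil => exact h.symm.trans h'
  | cons x w ih => exact ih h.2 h'.2

/-- The word moved by `s` strands to the right. -/
def shift (s : ℕ) (w : List Layer) : List Layer := w.map fun x => ⟨x.event, s + x.pos⟩

theorem shift_append (s : ℕ) (u v : List Layer) : shift s (u ++ v) = shift s u ++ shift s v :=
  List.map_append

theorem shift_shift (s t : ℕ) (w : List Layer) : shift s (shift t w) = shift (s + t) w := by
  simp [shift, Function.comp_def, add_assoc]

theorem shift_zero (w : List Layer) : shift 0 w = w := by
  simp [shift]

theorem Fits.shift {n m : ℕ} {w : List Layer} (s t : ℕ) (h : Fits n w m) :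
    Fits (s + n + t) (shift s w) (s + m + t) := by
  induction w generalizing n with
  | nil => cases h; rfl
  | cons x w ih =>
    obtain ⟨h1, h2⟩ := h
    refine ⟨by simp only; omega, ?_⟩
    have h3 := ih h2
    rwa [show s + x.above n + t = Layer.above ⟨x.event, s + x.pos⟩ (s + n + t) by
      simp only [Layer.above]; omega] at h3

theorem Move.shift {l r : List Layer} (s : ℕ) (h : Move l r) :
    Move (KnotTheory.shift s l) (KnotTheory.shift s r) := by
  cases h with
  | exchange e f i d =>
    have := Move.exchange e f (s + i) d
    simpa only [KnotTheory.shift, List.map_cons, List.map_nil, ← add_assoc] using this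
  | zigzag i => exact .zigzag (s + i)
  | zagzig i => exact .zagzig (s + i)
  | slide_cap b i => exact .slide_cap b (s + i)
  | slide_cup b i => exact .slide_cup b (s + i)
  | reidemeister_one_cap b i => exact .reidemeister_one_cap b (s + i)
  | reidemeister_one_cup b i => exact .reidemeister_one_cup b (s + i)
  | reidemeister_two b i => exact .reidemeister_two b (s + i)
  | reidemeister_three a b c i h => exact .reidemeister_three a b c (s + i) h

theorem Move.fits {l r : List Layer} {n m : ℕ} (h : Move l r) (hl : Fits n l m) : Fits n r m := by
  cases h with
  | exchange e f i d =>
    cases e <;> cases f <;>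
      simp only [Fits, Layer.above, Event.inn, Event.out] at hl ⊢ <;> omega
  | _ => simp only [Fits, Layer.above, Event.inn, Event.out] at hl ⊢; omega

/-! ### Isotopy of words -/

/-- A local move inside a tangle word. -/
inductive WordStep (n m : ℕ) : List Layer → List Layer → Prop
  | mk (u v l r : List Layer) (h : Move l r) (hl : Fits n (u ++ l ++ v) m)
      (hr : Fits n (u ++ r ++ v) m) : WordStep n m (u ++ l ++ v) (u ++ r ++ v)

/-- Two tangle words with `n` strands at the bottom and `m` strands at the top are connected by
moves. -/
def WordEquiv (n m : ℕ) : List Layer → List Layer → Prop := Relation.EqvGen (WordStep n m)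

namespace WordEquiv

variable {n m k n' m' : ℕ} {a b c a' b' u v : List Layer}

theorem refl (a : List Layer) : WordEquiv n m a a := Relation.EqvGen.refl _

theorem of_eq (h : a = b) : WordEquiv n m a b := h ▸ refl a

theorem symm (h : WordEquiv n m a b) : WordEquiv n m b a := Relation.EqvGen.symm _ _ h

theorem trans (h : WordEquiv n m a b) (h' : WordEquiv n m b c) : WordEquiv n m a c :=
  Relation.EqvGen.trans _ _ _ h h'

theorem of_move (h : Move a b) (hf : Fits n a m) : WordEquiv n m a b := by
  have := WordStep.mk (n := n) (m := m) [] [] a b h (by simpa using hf) (by simpa using h.fits hf)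
  simp only [List.nil_append, List.append_nil] at this
  exact .rel _ _ this

theorem congr (h : WordEquiv n m a b) (hu : Fits n' u n) (hv : Fits m v m') :
    WordEquiv n' m' (u ++ a ++ v) (u ++ b ++ v) := by
  induction h with
  | rel _ _ h =>
    obtain ⟨p, q, l, r, h, hl, hr⟩ := h
    have := WordStep.mk (n := n') (m := m') (u ++ p) (q ++ v) l r h
      (by simpa using (hu.append hl).append hv) (by simpa using (hu.append hr).append hv)
    simp only [List.append_assoc] at this ⊢
    exact .rel _ _ this
  | refl => exact refl _
  | symm _ _ _ ih => exact ih.symm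
  | trans _ _ _ _ _ ih ih' => exact ih.trans ih'

theorem append_left (h : WordEquiv n m a b) (hu : Fits n' u n) :
    WordEquiv n' m (u ++ a) (u ++ b) := by
  simpa using h.congr hu (Fits.refl m)

theorem append_right (h : WordEquiv n m a b) (hv : Fits m v m') :
    WordEquiv n m' (a ++ v) (b ++ v) := by
  simpa using h.congr (Fits.refl n) hv

theorem shift (s t : ℕ) (h : WordEquiv n m a b) :
    WordEquiv (s + n + t) (s + m + t) (shift s a) (KnotTheory.shift s b) := by
  induction h with
  | rel _ _ h =>
    obtain ⟨p, q, l, r, h, hl, hr⟩ := h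
    have hl := hl.shift s t
    have hr := hr.shift s t
    simp only [shift_append] at hl hr ⊢
    exact .rel _ _ (.mk _ _ _ _ (h.shift s) hl hr)
  | refl => exact refl _
  | symm _ _ _ ih => exact ih.symm
  | trans _ _ _ _ _ ih ih' => exact ih.trans ih'

theorem equivalent (h : WordEquiv 0 0 a b) (ha : ClosesFrom 0 a) (hb : ClosesFrom 0 b) :
    LinkDiagram.Equivalent ⟨a, ha⟩ ⟨b, hb⟩ := by
  -- A chain of moves runs through intermediate words, which must be diagrams as well; so the
  -- closing condition is carried along the induction.
  have key : (ClosesFrom 0 a ↔ ClosesFrom 0 b) ∧ ∀ ha hb,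
      LinkDiagram.Equivalent ⟨a, ha⟩ ⟨b, hb⟩ := by
    clear ha hb
    induction h with
    | rel _ _ h =>
      obtain ⟨p, q, l, r, h, hl, hr⟩ := h
      exact ⟨iff_of_true (closesFrom_iff_fits.2 hl) (closesFrom_iff_fits.2 hr),
        fun ha hb => .rel _ _ ⟨p, q, l, r, h, rfl, rfl⟩⟩
    | refl => exact ⟨Iff.rfl, fun _ _ => .refl _⟩
    | symm _ _ _ ih => exact ⟨ih.1.symm, fun ha hb => .symm _ _ (ih.2 hb ha)⟩
    | trans _ _ _ _ _ ih ih' =>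
      exact ⟨ih.1.trans ih'.1, fun ha hb => .trans _ _ _ (ih.2 ha (ih.1.1 ha)) (ih'.2 _ hb)⟩
  exact key.2 ha hb

end WordEquiv

/-! ### A checker for isotopies of concrete words -/

instance Event.decidableEq : DecidableEq Event
  | .cup, .cup => isTrue rfl
  | .cap, .cap => isTrue rfl
  | .cross a, .cross b => decidable_of_iff (a = b) (by simp)
  | .cup, .cap => isFalse nofun
  | .cup, .cross _ => isFalse nofun
  | .cap, .cup => isFalse nofun
  | .cap, .cross _ => isFalse nofun
  | .cross _, .cup => isFalse nofun
  | .cross _, .cap => isFalse nofun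

instance Layer.decidableEq : DecidableEq Layer := fun x y =>
  decidable_of_iff (x.event = y.event ∧ x.pos = y.pos) (by cases x; cases y; simp)

/-- The rewriting rules: the exchange of the two lowest events, in the two directions, and the
simplification of the lowest events by one of the other moves. -/
inductive Rewrite where
  | down : Rewrite
  | up : Rewrite
  | simp : Rewrite

/-- Apply a rewriting rule to the lowest layers of a word. -/
def Rewrite.apply : Rewrite → List Layer → Option (List Layer)
  | .down, x :: y :: w =>
    if x.pos + x.event.out ≤ y.pos then
      -- The difference is the gap `d` of `Move.exchange`, the number of strands between the two
      -- events.
      some (⟨y.event, x.pos + x.event.inn + (y.pos - (x.pos + x.event.out))⟩ :: x :: w)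
    else none
  | .up, x :: y :: w =>
    if y.pos + y.event.inn ≤ x.pos then
      some (y :: ⟨x.event, y.pos + y.event.out + (x.pos - (y.pos + y.event.inn))⟩ :: w)
    else none
  | .simp, ⟨.cup, i⟩ :: ⟨.cap, j⟩ :: w => if i = j + 1 ∨ j = i + 1 then some w else none
  | .simp, ⟨.cross b, i⟩ :: ⟨.cap, j⟩ :: w =>
    if i = j then some (cap i :: w)
    -- The slide and its inverse have the same form: the two positions are exchanged and the
    -- crossing is flipped.
    else if i = j + 1 ∨ j = i + 1 then some (cross (!b) j :: cap i :: w) else none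
  | .simp, ⟨.cup, i⟩ :: ⟨.cross b, j⟩ :: w =>
    if i = j then some (cup i :: w)
    else if i = j + 1 ∨ j = i + 1 then some (cup j :: cross (!b) i :: w) else none
  | .simp, ⟨.cross a, i⟩ :: ⟨.cross b, j⟩ :: w =>
    if i = j then if b = !a then some w else none
    else if i = j + 1 ∨ j = i + 1 then
      match w with
      | ⟨.cross c, k⟩ :: w =>
        if k = i ∧ (b = a ∨ b = c) then some (cross c j :: cross b i :: cross a j :: w) else none
      | _ => none
    else none
  | _, _ => none

theorem WordEquiv.of_move_append {n m : ℕ} {l r w : List Layer} (h : Move l r)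
    (hf : Fits n (l ++ w) m) : WordEquiv n m (l ++ w) (r ++ w) ∧ Fits n (r ++ w) m := by
  obtain ⟨k, hl, hw⟩ := fits_append.1 hf
  exact ⟨(WordEquiv.of_move h hl).append_right hw, (h.fits hl).append hw⟩

/-- The converse of `Move.fits` can fail: `[]` fits on any number of strands, whereas a word that a
move deletes needs enough of them. Hence the hypothesis `hf'`. -/
theorem WordEquiv.of_move_append_symm {n m : ℕ} {l r w : List Layer} (h : Move l r)
    (hf' : ∀ k, Fits n r k → Fits n l k)
    (hf : Fits n (r ++ w) m) : WordEquiv n m (r ++ w) (l ++ w) ∧ Fits n (l ++ w) m := by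
  obtain ⟨k, hl, hw⟩ := fits_append.1 hf
  exact ⟨((WordEquiv.of_move h (hf' _ hl)).append_right hw).symm, (hf' _ hl).append hw⟩

theorem Rewrite.apply_sound {n m : ℕ} {c : Rewrite} {w w' : List Layer} (h : c.apply w = some w')
    (hf : Fits n w m) : WordEquiv n m w w' ∧ Fits n w' m := by
  unfold Rewrite.apply at h
  split at h
  · rename_i x y w
    split_ifs at h with hxy
    obtain ⟨d, hd⟩ := Nat.exists_eq_add_of_le hxy
    obtain ⟨e, i⟩ := x
    obtain ⟨f, j⟩ := y
    simp only at hd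
    subst hd
    cases h
    simpa using WordEquiv.of_move_append (w := w) (Move.exchange e f i d) hf
  · rename_i x y w
    split_ifs at h with hxy
    obtain ⟨d, hd⟩ := Nat.exists_eq_add_of_le hxy
    obtain ⟨e, i⟩ := x
    obtain ⟨f, j⟩ := y
    simp only at hd
    subst hd
    cases h
    have := WordEquiv.of_move_append_symm (w := w) (Move.exchange f e j d) (n := n) (m := m) (by
      intro k hl
      cases e <;> cases f <;>
      simp only [Fits, Layer.above, Event.inn, Event.out] at hl ⊢ <;> omega) hf
    simpa using this
  · split_ifs at h with hij
    cases h
    rcases hij with rfl | rfl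
    · exact WordEquiv.of_move_append (.zigzag _) hf
    · exact WordEquiv.of_move_append (.zagzig _) hf
  · split_ifs at h with h1 hij
    · cases h
      subst h1
      exact WordEquiv.of_move_append (.reidemeister_one_cap _ _) hf
    · cases h
      rename_i b i j w
      rcases hij with rfl | rfl
      · have := Move.slide_cap (!b) j
        rw [Bool.not_not] at this
        refine WordEquiv.of_move_append_symm this ?_ hf
        intro k hl
        simp only [Fits, Layer.above, Event.inn, Event.out] at hl ⊢
        omega
      · exact WordEquiv.of_move_append (.slide_cap _ _) hf
  · split_ifs at h with h1 hij
    · cases h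
      subst h1
      exact WordEquiv.of_move_append (.reidemeister_one_cup _ _) hf
    · cases h
      rename_i i b j w
      rcases hij with rfl | rfl
      · exact WordEquiv.of_move_append (.slide_cup _ _) hf
      · have := Move.slide_cup (!b) i
        rw [Bool.not_not] at this
        refine WordEquiv.of_move_append_symm this ?_ hf
        intro k hl
        simp only [Fits, Layer.above, Event.inn, Event.out] at hl ⊢
        omega
  · rename_i a i b j w
    split_ifs at h with h1 h2 hij
    · cases h
      subst h1 h2
      exact WordEquiv.of_move_append (.reidemeister_two _ _) hf
    · split at h
      · rename_i c k w
        split_ifs at h with hk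
        obtain ⟨rfl, hk⟩ := hk
        cases h
        rcases hij with rfl | rfl
        · refine WordEquiv.of_move_append_symm (.reidemeister_three c b a j hk.symm) ?_ hf
          intro k hl
          simp only [Fits, Layer.above, Event.inn, Event.out] at hl ⊢
          omega
        · exact WordEquiv.of_move_append (.reidemeister_three a b c k hk) hf
      · cases h
  · cases h

/-- Apply a list of rewriting rules, each at some height. -/
def rewriteAll : List (ℕ × Rewrite) → List Layer → Option (List Layer)
  | [], w => some w
  | c :: cs, w => (c.2.apply (w.drop c.1)).bind fun v => rewriteAll cs (w.take c.1 ++ v)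

theorem rewriteAll_sound {n m : ℕ} {cs : List (ℕ × Rewrite)} {w w' : List Layer}
    (h : rewriteAll cs w = some w') (hf : Fits n w m) : WordEquiv n m w w' := by
  induction cs generalizing w with
  | nil => cases h; exact .refl _
  | cons c cs ih =>
    obtain ⟨v, hv, hw⟩ := Option.bind_eq_some_iff.1 h
    obtain ⟨k, h1, h2⟩ := fits_append.1 ((List.take_append_drop c.1 w).symm ▸ hf)
    obtain ⟨h3, h4⟩ := c.2.apply_sound hv h2
    have := h3.append_left h1
    rw [List.take_append_drop] at this
    exact this.trans (ih hw (h1.append h4))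

/-- The words `w` and `w'` are rewritten to the same word. -/
def Confluent (cs cs' : List (ℕ × Rewrite)) (n m : ℕ) (w w' : List Layer) : Prop :=
  Fits n w m ∧ Fits n w' m ∧ rewriteAll cs w ≠ none ∧ rewriteAll cs w = rewriteAll cs' w'

instance Confluent.decidable (cs cs' : List (ℕ × Rewrite)) (n m : ℕ) (w w' : List Layer) :
    Decidable (Confluent cs cs' n m w w') :=
  inferInstanceAs (Decidable (_ ∧ _ ∧ _ ∧ _))

/-- The lists `cs`, `cs'` are certificates: each entry is a height and a rule. Since the condition
is decidable, an isotopy of concrete words is reduced to evaluating two lists of moves that meet in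
a common word. -/
theorem Confluent.wordEquiv {cs cs' : List (ℕ × Rewrite)} {n m : ℕ} {w w' : List Layer}
    (h : Confluent cs cs' n m w w') : WordEquiv n m w w' := by
  obtain ⟨hw, hw', h, he⟩ := h
  obtain ⟨v, hv⟩ := Option.ne_none_iff_exists'.1 h
  exact (rewriteAll_sound hv hw).trans (rewriteAll_sound (he ▸ hv) hw').symm

/-- The blackboard parallel of a word. -/
def doubleWord (w : List Layer) : List Layer := w.flatMap Layer.double

/-! ### The doubles of the local moves -/

theorem double_zigzag :
    WordEquiv 2 2 (doubleWord [cup 1, cap 0])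
      (doubleWord []) :=
  Confluent.wordEquiv
    (cs := [(1, .up), (0, .simp), (0, .simp)])
    (cs' := [])
    (by decide)

theorem double_zagzig :
    WordEquiv 2 2 (doubleWord [cup 0, cap 1])
      (doubleWord []) :=
  Confluent.wordEquiv
    (cs := [(1, .down), (0, .simp), (0, .simp)])
    (cs' := [])
    (by decide)

theorem double_slide_cap (b : Bool) :
    WordEquiv 6 2 (doubleWord [cross b 0, cap 1])
      (doubleWord [cross (!b) 1, cap 0]) :=
  Confluent.wordEquiv
    (cs := [(1, .down), (3, .down), (2, .down), (1, .simp), (0, .down), (1, .simp)])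
    (cs' := [(3, .up), (2, .up), (4, .simp), (3, .up), (4, .simp)])
    (by revert b; decide)

theorem double_slide_cup (b : Bool) :
    WordEquiv 2 6 (doubleWord [cup 1, cross b 0])
      (doubleWord [cup 0, cross (!b) 1]) :=
  Confluent.wordEquiv
    (cs := [(1, .up), (0, .simp), (2, .up), (1, .up), (0, .simp), (3, .simp)])
    (cs' := [(1, .down), (2, .simp), (3, .down), (2, .down), (4, .down)])
    (by revert b; decide)

/-- The blackboard framing sees a kink: two parallel strands that run through it are isotopic to two
strands without the kink, twisted once around each other. This full twist is why the writhe enters.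
-/
theorem double_kink_cap (b : Bool) :
    WordEquiv 4 0 (doubleWord [cross b 0, cap 0])
      ([cross (!b) 0, cross (!b) 0] ++ doubleWord [cap 0]) :=
  Confluent.wordEquiv
    (cs := [(3, .simp), (2, .simp), (0, .simp), (2, .down), (3, .simp)])
    (cs' := [(1, .simp), (2, .down)])
    (by revert b; decide)

theorem double_kink_cup (b : Bool) :
    WordEquiv 0 4 (doubleWord [cup 0, cross b 0])
      (doubleWord [cup 0] ++ [cross (!b) 0, cross (!b) 0]) :=
  Confluent.wordEquiv
    (cs := [(1, .simp), (1, .simp), (0, .up), (2, .simp), (1, .simp)])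
    (cs' := [(1, .simp), (0, .up), (1, .simp), (2, .up), (1, .simp), (0, .up)])
    (by revert b; decide)

theorem double_reidemeister_two (b : Bool) :
    WordEquiv 4 4 (doubleWord [cross b 0, cross (!b) 0])
      (doubleWord []) :=
  Confluent.wordEquiv
    (cs := [(3, .simp), (1, .down), (2, .simp), (1, .simp), (0, .simp)])
    (cs' := [])
    (by revert b; decide)

/-- Every choice of one copy from each of the three strands gives one third Reidemeister move, eight
in all; four are made from either side. The two alternatives of the hypothesis of
`Move.reidemeister_three` are treated separately. -/
theorem double_reidemeister_three_left (a : Bool) (c : Bool) :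
    WordEquiv 6 6 (doubleWord [cross a 0, cross a 1, cross c 0])
      (doubleWord [cross c 1, cross a 0, cross a 1]) :=
  Confluent.wordEquiv
    (cs := [(3, .down), (7, .up), (6, .up), (4, .simp), (2, .simp), (1, .down), (2, .down), (4, .up),
      (6, .down), (8, .up), (7, .up), (6, .up), (5, .up), (8, .simp), (6, .simp), (10, .up)])
    (cs' := [(3, .up), (2, .up), (4, .up), (3, .up), (7, .down), (5, .simp), (4, .up), (3, .down), (1,
      .simp), (0, .up), (7, .simp), (6, .up), (5, .up), (3, .simp), (9, .down), (8, .down)])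
    (by revert a c; decide)

theorem double_reidemeister_three_right (a : Bool) (c : Bool) :
    WordEquiv 6 6 (doubleWord [cross a 0, cross c 1, cross c 0])
      (doubleWord [cross c 1, cross c 0, cross a 1]) :=
  Confluent.wordEquiv
    (cs := [(3, .down), (7, .up), (6, .up), (4, .simp), (2, .simp), (1, .down), (2, .down), (4, .up),
      (6, .down), (8, .up), (7, .up), (6, .up), (5, .up), (8, .simp), (6, .simp), (10, .up)])
    (cs' := [(3, .up), (2, .up), (4, .up), (3, .up), (7, .down), (5, .simp), (4, .up), (3, .down), (1,
      .simp), (0, .up), (7, .simp), (6, .up), (5, .up), (3, .simp), (9, .down), (8, .down)])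
    (by revert a c; decide)

/-! ### Crossings and clasps of two parallel strands pass the doubled events -/

theorem crossing_comp_double_cap (b : Bool) :
    WordEquiv 4 0 ([cross b 0] ++ doubleWord [cap 0])
      ([cross b 2] ++ doubleWord [cap 0]) :=
  Confluent.wordEquiv
    (cs := [(0, .simp), (1, .down)])
    (cs' := [(0, .simp)])
    (by revert b; decide)

theorem double_cup_comp_crossing (b : Bool) :
    WordEquiv 0 4 (doubleWord [cup 0] ++ [cross b 0])
      (doubleWord [cup 0] ++ [cross b 2]) :=
  Confluent.wordEquiv
    (cs := [(1, .simp), (0, .up)])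
    (cs' := [(1, .simp)])
    (by revert b; decide)

/-- Each of the two strands of the other pair passes the crossing by a third Reidemeister move,
which is allowed because it lies entirely above or entirely below. -/
theorem crossing_left_comp_double_crossing (a : Bool) (b : Bool) :
    WordEquiv 4 4 ([cross a 0] ++ doubleWord [cross b 0])
      (doubleWord [cross b 0] ++ [cross a 2]) :=
  Confluent.wordEquiv
    (cs := [(0, .simp)])
    (cs' := [(2, .simp)])
    (by revert a b; decide)

theorem crossing_right_comp_double_crossing (a : Bool) (b : Bool) :
    WordEquiv 4 4 ([cross a 2] ++ doubleWord [cross b 0])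
      (doubleWord [cross b 0] ++ [cross a 0]) :=
  Confluent.wordEquiv
    (cs := [(2, .down), (0, .simp)])
    (cs' := [(1, .down), (2, .simp)])
    (by revert a b; decide)

theorem clasp_comp_double_cap :
    WordEquiv 4 0 (negativeClasp 0 ++ doubleWord [cap 0])
      (negativeClasp 2 ++ doubleWord [cap 0]) :=
  Confluent.wordEquiv
    (cs := [(1, .down), (0, .simp), (3, .down), (2, .down), (1, .down), (0, .simp)])
    (cs' := [(0, .simp), (3, .up), (2, .up), (1, .up), (0, .simp), (1, .simp), (2, .up), (1, .simp)])
    (by decide)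

theorem double_cup_comp_clasp :
    WordEquiv 0 4 (doubleWord [cup 0] ++ negativeClasp 0)
      (doubleWord [cup 0] ++ negativeClasp 2) :=
  Confluent.wordEquiv
    (cs := [(1, .up), (2, .up), (3, .simp), (4, .up), (3, .simp), (1, .simp), (0, .up)])
    (cs' := [(1, .down), (2, .simp), (3, .down), (2, .down), (4, .down), (3, .simp), (1, .simp)])
    (by decide)

/-- The rules cannot create crossings, so both sides of the sliding are reached from a larger word:
the other pair of strands crosses all four strands of the open clasp, between its crossings and its
final maximum. Pulling the maximum down frees the clasp below. -/
theorem claspPeak_left_below (b : Bool) :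
    WordEquiv 4 4 
      ([cup 1, cross false 0, cross false 2, cross b 3, cross b 2, cross b 1, cross b 0, cross b
       4, cross b 3, cross b 2, cross b 1, cap 3])
      (negativeClasp 0 ++ doubleWord [cross b 0]) :=
  Confluent.wordEquiv
    (cs := [(10, .down), (9, .simp), (8, .simp), (7, .up), (6, .down), (5, .simp), (4, .simp)])
    (cs' := [(3, .down)])
    (by revert b; decide)

/-- From the same word, the minimum and the two crossings of the clasp are pulled up instead, so
that the clasp ends above the doubled crossing. -/
theorem claspPeak_left_above (b : Bool) :
    WordEquiv 4 4 
      ([cup 1, cross false 0, cross false 2, cross b 3, cross b 2, cross b 1, cross b 0, cross b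
       4, cross b 3, cross b 2, cross b 1, cap 3])
      (doubleWord [cross b 0] ++ negativeClasp 2) :=
  Confluent.wordEquiv
    (cs := [(1, .down), (0, .simp), (2, .down), (1, .down), (0, .simp), (3, .down), (1, .simp), (3,
      .simp), (5, .simp), (0, .up), (2, .up), (1, .up), (4, .down), (3, .down), (2, .simp), (5,
      .down), (3, .simp), (5, .simp), (7, .simp)])
    (cs' := [(3, .down), (5, .down), (4, .down), (3, .simp), (2, .down)])
    (by revert b; decide)

theorem clasp_left_comp_double_crossing (b : Bool) :
    WordEquiv 4 4 (negativeClasp 0 ++ doubleWord [cross b 0])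
      (doubleWord [cross b 0] ++ negativeClasp 2) :=
  (claspPeak_left_below b).symm.trans (claspPeak_left_above b)

/-- The mirror arrangement: the clasp starts on the right and the pair from the left crosses its
four strands. -/
theorem claspPeak_right_below (b : Bool) :
    WordEquiv 4 4 
      ([cup 3, cross false 2, cross false 4, cross b 1, cross b 2, cross b 3, cross b 4, cross b
       0, cross b 1, cross b 2, cross b 3, cap 1])
      (negativeClasp 2 ++ doubleWord [cross b 0]) :=
  Confluent.wordEquiv
    (cs := [(10, .up), (9, .simp), (8, .simp), (7, .down), (6, .up), (5, .simp), (4, .simp)])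
    (cs' := [(3, .up), (5, .down)])
    (by revert b; decide)

theorem claspPeak_right_above (b : Bool) :
    WordEquiv 4 4 
      ([cup 3, cross false 2, cross false 4, cross b 1, cross b 2, cross b 3, cross b 4, cross b
       0, cross b 1, cross b 2, cross b 3, cap 1])
      (doubleWord [cross b 0] ++ negativeClasp 0) :=
  Confluent.wordEquiv
    (cs := [(0, .simp), (2, .up), (1, .up), (0, .simp), (3, .up), (1, .simp), (3, .simp), (5, .simp),
      (0, .down), (2, .down), (1, .down), (4, .up), (3, .up), (2, .simp), (5, .up), (3, .simp),
      (5, .simp), (7, .simp)])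
    (cs' := [(1, .down), (3, .up), (4, .up), (3, .simp), (2, .up)])
    (by revert b; decide)

theorem clasp_right_comp_double_crossing (b : Bool) :
    WordEquiv 4 4 (negativeClasp 2 ++ doubleWord [cross b 0])
      (doubleWord [cross b 0] ++ negativeClasp 0) :=
  (claspPeak_right_below b).symm.trans (claspPeak_right_above b)

theorem clasp_comp_crossing_true :
    WordEquiv 2 2 ([cross true 0] ++ negativeClasp 0)
      (negativeClasp 0 ++ [cross true 0]) :=
  Confluent.wordEquiv
    (cs := [(1, .simp), (0, .up), (1, .simp), (3, .simp), (0, .simp), (2, .simp)])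
    (cs' := [(2, .simp), (3, .up), (1, .simp), (0, .simp)])
    (by decide)

/-! ### Doubles of words -/

theorem doubleWord_append (u v : List Layer) :
    doubleWord (u ++ v) = doubleWord u ++ doubleWord v := List.flatMap_append

theorem doubleWord_singleton (x : Layer) : doubleWord [x] = x.double := by
  simp [doubleWord]

theorem Layer.double_eq_shift (e : Event) (i : ℕ) :
    Layer.double ⟨e, i⟩ = shift (2 * i) (Layer.double ⟨e, 0⟩) := by
  cases e <;> simp [Layer.double, shift]

theorem doubleWord_shift (i : ℕ) (w : List Layer) :
    doubleWord (shift i w) = shift (2 * i) (doubleWord w) := by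
  induction w with
  | nil => rfl
  | cons x w ih =>
    have h : shift i (x :: w) = [⟨x.event, i + x.pos⟩] ++ shift i w := rfl
    have h' : x :: w = [x] ++ w := rfl
    obtain ⟨e, j⟩ := x
    rw [h, h', doubleWord_append, doubleWord_append, ih, shift_append, doubleWord_singleton,
      doubleWord_singleton, Layer.double_eq_shift, Layer.double_eq_shift e j, shift_shift, mul_add]

theorem Event.fits_double (e : Event) :
    Fits (2 * e.inn) (Layer.double ⟨e, 0⟩) (2 * e.out) := by
  cases e
  · decide
  · decide
  · rename_i b; revert b; decide

theorem fits_singleton {n m : ℕ} {x : Layer} :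
    Fits n [x] m ↔ ∃ d, n = x.pos + x.event.inn + d ∧ m = x.pos + x.event.out + d := by
  simp only [Fits, Layer.above]
  constructor
  · rintro ⟨h, rfl⟩
    exact ⟨n - (x.pos + x.event.inn), by omega, by omega⟩
  · rintro ⟨d, rfl, rfl⟩
    omega

theorem Fits.double {n m : ℕ} {w : List Layer} (h : Fits n w m) :
    Fits (2 * n) (doubleWord w) (2 * m) := by
  induction w generalizing n with
  | nil => cases h; rfl
  | cons x w ih =>
    have h' : x :: w = [x] ++ w := rfl
    obtain ⟨k, h1, h2⟩ := fits_append.1 (h' ▸ h)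
    obtain ⟨e, i⟩ := x
    rw [h', doubleWord_append, doubleWord_singleton, Layer.double_eq_shift]
    refine Fits.append ?_ (ih h2)
    obtain ⟨d, rfl, rfl⟩ := fits_singleton.1 h1
    convert (e.fits_double).shift (2 * i) (2 * d) using 1 <;> ring

/-! ### Words side by side -/

theorem WordEquiv.exchange_layer (x : Layer) (d t : ℕ) {B : List Layer} {b b' : ℕ}
    (hB : Fits b B b') :
    WordEquiv (x.pos + x.event.inn + d + b + t) (x.pos + x.event.out + d + b' + t)
      ([x] ++ KnotTheory.shift (x.pos + x.event.out + d) B)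
      (KnotTheory.shift (x.pos + x.event.inn + d) B ++ [x]) := by
  induction B generalizing b with
  | nil => exact .refl _
  | cons y B ih =>
    obtain ⟨f, j⟩ := y
    obtain ⟨e, i⟩ := x
    obtain ⟨s, rfl⟩ := Nat.exists_eq_add_of_le hB.1
    have h2 : Fits (j + f.out + s) B b' := by
      convert hB.2 using 1
      simp only [Layer.above]
      omega
    have h1 : WordEquiv (i + e.inn + d + (j + f.inn + s) + t) (i + e.out + d + (j + f.out + s) + t)
        [⟨e, i⟩, ⟨f, i + e.out + (d + j)⟩] [⟨f, i + e.inn + (d + j)⟩, ⟨e, i⟩] := by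
      refine .of_move (.exchange e f i (d + j)) ?_
      simp only [Fits, Layer.above]
      omega
    have h3 := h1.append_right (h2.shift (i + e.out + d) t)
    have h4 : Fits (i + e.inn + d + (j + f.inn + s) + t) [⟨f, i + e.inn + (d + j)⟩]
        (i + e.inn + d + (j + f.out + s) + t) := by
      simp only [Fits, Layer.above]
      omega
    have h5 := (ih h2).append_left h4
    refine .trans (.of_eq ?_) (h3.trans (.trans (.of_eq ?_) (h5.trans (.of_eq ?_)))) <;>
      simp [KnotTheory.shift, add_assoc]

/-- Words that lie side by side exchange their heights. -/
theorem WordEquiv.exchange (s d t : ℕ) {A B : List Layer} {a a' b b' : ℕ} (hA : Fits a A a')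
    (hB : Fits b B b') :
    WordEquiv (s + a + d + b + t) (s + a' + d + b' + t)
      (KnotTheory.shift s A ++ KnotTheory.shift (s + a' + d) B)
      (KnotTheory.shift (s + a + d) B ++ KnotTheory.shift s A) := by
  induction A generalizing a with
  | nil =>
    cases hA
    exact .of_eq (by simp [KnotTheory.shift])
  | cons x A ih =>
    obtain ⟨e, i⟩ := x
    obtain ⟨c, rfl⟩ := Nat.exists_eq_add_of_le hA.1
    have h2 : Fits (i + e.out + c) A a' := by
      convert hA.2 using 1
      simp only [Layer.above]
      omega
    have h1 : Fits (s + (i + e.inn + c) + d + b + t) [⟨e, s + i⟩]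
        (s + (i + e.out + c) + d + b + t) := by
      simp only [Fits, Layer.above]
      omega
    have h3 := (ih h2).append_left h1
    have h4 := (WordEquiv.exchange_layer ⟨e, s + i⟩ (c + d) t hB).append_right
      (v := KnotTheory.shift s A) (m' := s + a' + d + b' + t) (by
        convert h2.shift s (d + b' + t) using 1 <;> ring)
    rw [show s + i + e.inn + (c + d) = s + (i + e.inn + c) + d by ring,
      show s + i + e.out + (c + d) = s + (i + e.out + c) + d by ring] at h4
    refine .trans (.of_eq ?_) (h3.trans (.trans (.of_eq ?_) (h4.trans (.of_eq ?_)))) <;>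
      simp [KnotTheory.shift, add_assoc]

/-! ### Doubles of the moves -/

/-- The local moves other than the first Reidemeister move. -/
inductive FramedMove : List Layer → List Layer → Prop
  | exchange (e f : Event) (i d : ℕ) :
      FramedMove [⟨e, i⟩, ⟨f, i + e.out + d⟩] [⟨f, i + e.inn + d⟩, ⟨e, i⟩]
  | zigzag (i : ℕ) : FramedMove [cup (i + 1), cap i] []
  | zagzig (i : ℕ) : FramedMove [cup i, cap (i + 1)] []
  | slide_cap (b : Bool) (i : ℕ) :
      FramedMove [cross b i, cap (i + 1)] [cross (!b) (i + 1), cap i]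
  | slide_cup (b : Bool) (i : ℕ) :
      FramedMove [cup (i + 1), cross b i] [cup i, cross (!b) (i + 1)]
  | reidemeister_two (b : Bool) (i : ℕ) : FramedMove [cross b i, cross (!b) i] []
  | reidemeister_three (a b c : Bool) (i : ℕ) (h : b = a ∨ b = c) :
      FramedMove [cross a i, cross b (i + 1), cross c i] [cross c (i + 1), cross b i, cross a (i + 1)]

theorem WordEquiv.double_shift {l r : List Layer} {p q n m : ℕ} (i : ℕ)
    (h : WordEquiv (2 * p) (2 * q) (doubleWord l) (doubleWord r)) (hf : Fits p l q)
    (hn : Fits n (KnotTheory.shift i l) m) (hp : i + p ≤ n) :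
    WordEquiv (2 * n) (2 * m) (doubleWord (KnotTheory.shift i l))
      (doubleWord (KnotTheory.shift i r)) := by
  obtain ⟨t, rfl⟩ := Nat.exists_eq_add_of_le hp
  obtain rfl := hn.unique (hf.shift i t)
  rw [doubleWord_shift, doubleWord_shift]
  convert h.shift (2 * i) (2 * t) using 1 <;> ring

/-- These moves preserve the blackboard framing, so the parallel copy follows them. Each concrete
case is shifted to its position; the exchange of events is the exchange of two doubled tangles side
by side. -/
theorem FramedMove.double {l r : List Layer} {n m : ℕ} (h : FramedMove l r) (hf : Fits n l m) :
    WordEquiv (2 * n) (2 * m) (doubleWord l) (doubleWord r) := by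
  cases h with
  | exchange e f i d =>
    obtain ⟨k, h1, h2⟩ := fits_append.1 (show Fits n ([⟨e, i⟩] ++ [⟨f, i + e.out + d⟩]) m from hf)
    obtain ⟨c, rfl, rfl⟩ := fits_singleton.1 h1
    obtain ⟨c', hc, rfl⟩ := fits_singleton.1 h2
    simp only at hc ⊢
    obtain rfl : c = d + f.inn + c' := by omega
    have := WordEquiv.exchange (2 * i) (2 * d) (2 * c') e.fits_double f.fits_double
    simp only [← mul_add, ← Layer.double_eq_shift] at this
    convert this using 1
    · ring
    · simp [doubleWord]
    · simp [doubleWord]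
  | zigzag i =>
    exact double_zigzag.double_shift (p := 1) (q := 1) i (by decide) hf
      (by simp only [Fits, Layer.above, Event.inn, Event.out] at hf; omega)
  | zagzig i =>
    exact double_zagzig.double_shift (p := 1) (q := 1) i (by decide) hf
      (by simp only [Fits, Layer.above, Event.inn, Event.out] at hf; omega)
  | slide_cap b i =>
    exact (double_slide_cap b).double_shift (p := 3) (q := 1) i (by clear hf; revert b; decide) hf
      (by simp only [Fits, Layer.above, Event.inn, Event.out] at hf; omega)
  | slide_cup b i =>
    exact (double_slide_cup b).double_shift (p := 1) (q := 3) i (by clear hf; revert b; decide) hf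
      (by simp only [Fits, Layer.above, Event.inn, Event.out] at hf; omega)
  | reidemeister_two b i =>
    exact (double_reidemeister_two b).double_shift (p := 2) (q := 2) i (by clear hf; revert b; decide) hf
      (by simp only [Fits, Layer.above, Event.inn, Event.out] at hf; omega)
  | reidemeister_three a b c i h =>
    rcases h with rfl | rfl
    · exact (double_reidemeister_three_left b c).double_shift (p := 3) (q := 3) i
        (by clear hf; revert b c; decide) hf
        (by simp only [Fits, Layer.above, Event.inn, Event.out] at hf; omega)
    · exact (double_reidemeister_three_right a b).double_shift (p := 3) (q := 3) i
        (by clear hf; revert a b; decide) hf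
        (by simp only [Fits, Layer.above, Event.inn, Event.out] at hf; omega)

theorem FramedMove.move {l r : List Layer} (h : FramedMove l r) : Move l r := by
  cases h <;> constructor
  assumption

theorem Move.framed_or {l r : List Layer} (h : Move l r) : FramedMove l r ∨
    (∃ b i, l = [cross b i, cap i] ∧ r = [cap i]) ∨
    (∃ b i, l = [cup i, cross b i] ∧ r = [cup i]) := by
  cases h with
  | reidemeister_one_cap b i => exact .inr (.inl ⟨b, i, rfl, rfl⟩)
  | reidemeister_one_cup b i => exact .inr (.inr ⟨b, i, rfl, rfl⟩)
  | exchange e f i d => exact .inl (.exchange e f i d)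
  | zigzag i => exact .inl (.zigzag i)
  | zagzig i => exact .inl (.zagzig i)
  | slide_cap b i => exact .inl (.slide_cap b i)
  | slide_cup b i => exact .inl (.slide_cup b i)
  | reidemeister_two b i => exact .inl (.reidemeister_two b i)
  | reidemeister_three a b c i h => exact .inl (.reidemeister_three a b c i h)

/-! ### Tangles that slide along the double -/

/-- A tangle on two strands which slides along two parallel strands, past the doubles of all
events. -/
structure Slides (A : List Layer) : Prop where
  fits : Fits 2 A 2
  cup : WordEquiv 0 4 (doubleWord [cup 0] ++ A) (doubleWord [cup 0] ++ shift 2 A)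
  cap : WordEquiv 4 0 (A ++ doubleWord [cap 0]) (shift 2 A ++ doubleWord [cap 0])
  left (b : Bool) : WordEquiv 4 4 (A ++ doubleWord [cross b 0]) (doubleWord [cross b 0] ++ shift 2 A)
  right (b : Bool) :
    WordEquiv 4 4 (shift 2 A ++ doubleWord [cross b 0]) (doubleWord [cross b 0] ++ A)

theorem fits_double_cup : Fits 0 (doubleWord [KnotTheory.cup 0]) 4 := by decide
theorem fits_double_cap : Fits 4 (doubleWord [KnotTheory.cap 0]) 0 := by decide

namespace Slides

variable {A B : List Layer}

theorem fits_left (h : Slides A) : Fits 4 A 4 := by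
  simpa [shift_zero] using h.fits.shift 0 2

theorem fits_right (h : Slides A) : Fits 4 (shift 2 A) 4 := h.fits.shift 2 0

theorem comm_right (hA : Slides A) (hB : Slides B) :
    WordEquiv 4 4 (A ++ shift 2 B) (shift 2 B ++ A) := by
  simpa [shift_zero] using WordEquiv.exchange 0 0 0 hA.fits hB.fits

/-- At a minimum or maximum the tangles pass to the other leg one after the other and arrive in the
opposite order. This is why they have to commute; at crossings the order is kept. -/
theorem append (hA : Slides A) (hB : Slides B) (h : WordEquiv 2 2 (A ++ B) (B ++ A)) :
    Slides (A ++ B) where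
  fits := hA.fits.append hB.fits
  cup := by
    have h1 := hA.cup.append_right hB.fits_left
    have h2 := (hB.comm_right hA).append_left fits_double_cup
    have h3 := hB.cup.append_right hA.fits_right
    have h4 := (h.shift 2 0).append_left fits_double_cup
    simp only [shift_append, List.append_assoc] at h1 h2 h3 h4 ⊢
    exact h1.trans (h2.symm.trans (h3.trans h4.symm))
  cap := by
    have h1 := hB.cap.append_left hA.fits_left
    have h2 := (hA.comm_right hB).append_right fits_double_cap
    have h3 := hA.cap.append_left hB.fits_right
    have h4 := (h.shift 2 0).append_right fits_double_cap
    simp only [shift_append, List.append_assoc] at h1 h2 h3 h4 ⊢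
    exact h1.trans (h2.trans (h3.trans h4.symm))
  left b := by
    have h1 := (hB.left b).append_left hA.fits_left
    have h2 := (hA.left b).append_right hB.fits_right
    simp only [shift_append, List.append_assoc] at h1 h2 ⊢
    exact h1.trans h2
  right b := by
    have h1 := (hB.right b).append_left hA.fits_right
    have h2 := (hA.right b).append_right hB.fits_left
    simp only [shift_append, List.append_assoc] at h1 h2 ⊢
    exact h1.trans h2

theorem nil : Slides [] where
  fits := rfl
  cup := .refl _
  cap := .refl _
  left _ := .of_eq (by simp [shift])
  right _ := .of_eq (by simp [shift])

theorem crossing (b : Bool) : Slides [cross b 0] where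
  fits := by revert b; decide
  cup := double_cup_comp_crossing b
  cap := crossing_comp_double_cap b
  left := crossing_left_comp_double_crossing b
  right := crossing_right_comp_double_crossing b

theorem crossings (b : Bool) (n : ℕ) : Slides (List.replicate n (cross b 0)) := by
  induction n with
  | zero => exact nil
  | succ n ih =>
    refine (crossing b).append ih (.of_eq ?_)
    rw [List.singleton_append, ← List.replicate_succ, ← List.replicate_succ']

theorem clasp : Slides (negativeClasp 0) where
  fits := by decide
  cup := double_cup_comp_clasp
  cap := clasp_comp_double_cap
  left := clasp_left_comp_double_crossing
  right := clasp_right_comp_double_crossing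

/-- Sliding along a strand that runs through a layer from the bottom to the top, on the left of the
event. -/
theorem comp_left (hA : Slides A) {x : Layer} {n m j : ℕ} (hx : Fits n [x] m) (hj : j < x.pos) :
    WordEquiv (2 * n) (2 * m) (shift (2 * j) A ++ doubleWord [x])
      (doubleWord [x] ++ shift (2 * j) A) := by
  obtain ⟨e, i⟩ := x
  obtain ⟨t, rfl, rfl⟩ := fits_singleton.1 hx
  obtain ⟨d, rfl⟩ := Nat.exists_eq_add_of_le (show j + 1 ≤ _ from hj)
  have := WordEquiv.exchange (2 * j) (2 * d) (2 * t) hA.fits e.fits_double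
  rw [doubleWord_singleton, Layer.double_eq_shift]
  simp only
  convert this using 1
  · ring
  · ring
  · congr 2; ring
  · congr 2; ring

/-- Sliding along a strand that runs through a layer from the bottom to the top, on the right of the
event. -/
theorem comp_right (hA : Slides A) {x : Layer} {n m j : ℕ} (hx : Fits n [x] m)
    (hj : x.pos + x.event.inn + j < n) :
    WordEquiv (2 * n) (2 * m) (shift (2 * (x.pos + x.event.inn + j)) A ++ doubleWord [x])
      (doubleWord [x] ++ shift (2 * (x.pos + x.event.out + j)) A) := by
  obtain ⟨e, i⟩ := x
  obtain ⟨t, rfl, rfl⟩ := fits_singleton.1 hx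
  obtain ⟨d, rfl⟩ := Nat.exists_eq_add_of_le (show j + 1 ≤ _ from Nat.lt_of_add_lt_add_left hj)
  have := (WordEquiv.exchange (2 * i) (2 * j) (2 * d) e.fits_double hA.fits).symm
  rw [doubleWord_singleton, Layer.double_eq_shift]
  simp only
  convert this using 1
  · ring
  · ring
  · congr 2; ring
  · congr 2; ring

theorem comp_cup (hA : Slides A) {n m i : ℕ} (hx : Fits n [KnotTheory.cup i] m) :
    WordEquiv (2 * n) (2 * m) (doubleWord [KnotTheory.cup i] ++ shift (2 * i) A)
      (doubleWord [KnotTheory.cup i] ++ shift (2 * (i + 1)) A) := by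
  obtain ⟨t, rfl, rfl⟩ := fits_singleton.1 hx
  have := hA.cup.shift (2 * i) (2 * t)
  simp only [shift_append, shift_shift, ← doubleWord_shift] at this
  rw [show shift i [KnotTheory.cup 0] = [KnotTheory.cup i] from rfl] at this
  simp only [Event.inn, Event.out]
  convert this using 1 <;> ring_nf

theorem comp_cap (hA : Slides A) {n m i : ℕ} (hx : Fits n [KnotTheory.cap i] m) :
    WordEquiv (2 * n) (2 * m) (shift (2 * i) A ++ doubleWord [KnotTheory.cap i])
      (shift (2 * (i + 1)) A ++ doubleWord [KnotTheory.cap i]) := by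
  obtain ⟨t, rfl, rfl⟩ := fits_singleton.1 hx
  have := hA.cap.shift (2 * i) (2 * t)
  simp only [shift_append, shift_shift, ← doubleWord_shift] at this
  rw [show shift i [KnotTheory.cap 0] = [KnotTheory.cap i] from rfl] at this
  simp only [Event.inn, Event.out]
  convert this using 1 <;> ring_nf

theorem comp_cross_left (hA : Slides A) {b : Bool} {n m i : ℕ} (hx : Fits n [cross b i] m) :
    WordEquiv (2 * n) (2 * m) (shift (2 * i) A ++ doubleWord [cross b i])
      (doubleWord [cross b i] ++ shift (2 * (i + 1)) A) := by
  obtain ⟨t, rfl, rfl⟩ := fits_singleton.1 hx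
  have := (hA.left b).shift (2 * i) (2 * t)
  simp only [shift_append, shift_shift, ← doubleWord_shift] at this
  rw [show shift i [cross b 0] = [cross b i] from rfl] at this
  simp only [Event.inn, Event.out]
  convert this using 1 <;> ring_nf

theorem comp_cross_right (hA : Slides A) {b : Bool} {n m i : ℕ} (hx : Fits n [cross b i] m) :
    WordEquiv (2 * n) (2 * m) (shift (2 * (i + 1)) A ++ doubleWord [cross b i])
      (doubleWord [cross b i] ++ shift (2 * i) A) := by
  obtain ⟨t, rfl, rfl⟩ := fits_singleton.1 hx
  have := (hA.right b).shift (2 * i) (2 * t)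
  simp only [shift_append, shift_shift, ← doubleWord_shift] at this
  rw [show shift i [cross b 0] = [cross b i] from rfl] at this
  simp only [Event.inn, Event.out]
  convert this using 1 <;> ring_nf

end Slides

/-! ### The twisted clasp -/

/-- A pair of strands with `z` full twists. -/
def fullTwists : ℤ → List Layer
  | .ofNat n => List.replicate (2 * n) (cross true 0)
  | .negSucc n => List.replicate (2 * n + 2) (cross false 0)

/-- The framing of a kink. -/
def kinkSign (b : Bool) : ℤ := if b then -1 else 1

theorem fits_replicate_cross (b : Bool) (n : ℕ) : Fits 2 (List.replicate n (cross b 0)) 2 :=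
  (Slides.crossings b n).fits

theorem replicate_comp_cross_not (b : Bool) (n : ℕ) :
    WordEquiv 2 2 (List.replicate (n + 2) (cross b 0) ++ [cross (!b) 0, cross (!b) 0])
      (List.replicate n (cross b 0)) := by
  have h : WordEquiv 2 2 ([cross b 0, cross b 0] ++ [cross (!b) 0, cross (!b) 0]) [] :=
    Confluent.wordEquiv (cs := [(1, .simp), (0, .simp)]) (cs' := []) (by revert b; decide)
  have := h.append_left (fits_replicate_cross b n)
  rw [List.append_nil, ← List.append_assoc] at this
  rw [List.replicate_add]
  exact this

theorem fullTwists_comp_cross (z : ℤ) (b : Bool) :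
    WordEquiv 2 2 (fullTwists z ++ [cross (!b) 0, cross (!b) 0]) (fullTwists (z + kinkSign b)) := by
  rcases z with n | n <;> cases b
  · refine .of_eq ?_
    change List.replicate (2 * n) (cross true 0) ++ List.replicate 2 (cross true 0) =
      List.replicate (2 * (n + 1)) (cross true 0)
    rw [← List.replicate_add]
    rfl
  · rcases n with _ | n
    · exact .of_eq rfl
    · have h : Int.ofNat (n + 1) + kinkSign true = Int.ofNat n := by simp [kinkSign]
      rw [h]
      exact replicate_comp_cross_not true (2 * n)
  · rcases n with _ | n
    · exact replicate_comp_cross_not false 0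
    · have h : Int.negSucc (n + 1) + kinkSign false = Int.negSucc n := by
        simp [kinkSign, Int.negSucc_eq]
      rw [h]
      exact replicate_comp_cross_not false (2 * n + 2)
  · refine .of_eq ?_
    have h : Int.negSucc n + kinkSign true = Int.negSucc (n + 1) := by
      simp [kinkSign, Int.negSucc_eq]; ring
    rw [h]
    change List.replicate (2 * n + 2) (cross false 0) ++ List.replicate 2 (cross false 0) =
      List.replicate (2 * (n + 1) + 2) (cross false 0)
    rw [← List.replicate_add]
    rfl

theorem Slides.fullTwists (z : ℤ) : Slides (fullTwists z) := by
  cases z <;> exact Slides.crossings _ _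

/-- The crossings of two strands commute with the clasp. -/
theorem crossing_comp_clasp (b : Bool) :
    WordEquiv 2 2 ([cross b 0] ++ negativeClasp 0) (negativeClasp 0 ++ [cross b 0]) := by
  cases b
  -- The two crossings are inverse to each other by the second Reidemeister move, so commuting with
  -- one implies commuting with the other.
  · have h1 : WordEquiv 2 2 ([cross true 0] ++ [cross false 0]) [] := .of_move
      (.reidemeister_two true 0) (by decide)
    have h2 : WordEquiv 2 2 ([cross false 0] ++ [cross true 0]) [] := .of_move
      (.reidemeister_two false 0) (by decide)
    have hc := Slides.clasp.fits
    have h3 := (h1.append_left hc).append_left (Slides.crossing false).fits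
    have h4 := (clasp_comp_crossing_true.append_left (Slides.crossing false).fits).append_right
      (Slides.crossing false).fits
    have h5 := h2.append_right (hc.append (Slides.crossing false).fits)
    simp only [List.append_assoc, List.append_nil, List.nil_append] at h3 h4 h5
    exact h3.symm.trans (h4.symm.trans h5)
  · exact clasp_comp_crossing_true

theorem clasp_comp_crossings (b : Bool) (n : ℕ) :
    WordEquiv 2 2 (negativeClasp 0 ++ List.replicate n (cross b 0))
      (List.replicate n (cross b 0) ++ negativeClasp 0) := by
  induction n with
  | zero => exact .of_eq (by simp)
  | succ n ih =>
    have h1 := (crossing_comp_clasp b).append_right (fits_replicate_cross b n)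
    have h2 := ih.append_left (Slides.crossing b).fits
    rw [List.append_assoc, List.append_assoc] at h1
    rw [show List.replicate (n + 1) (cross b 0) = [cross b 0] ++ List.replicate n (cross b 0) from
      rfl, List.append_assoc]
    exact h1.symm.trans h2

/-- A clasp of two strands, followed by `z` full twists. -/
def twistedClasp (z : ℤ) : List Layer := negativeClasp 0 ++ fullTwists z

theorem Slides.twistedClasp (z : ℤ) : Slides (twistedClasp z) :=
  Slides.clasp.append (Slides.fullTwists z) (by cases z <;> exact clasp_comp_crossings _ _)

/-- The blackboard parallel of the word `u ++ v`, with a twisted clasp of the two copies of the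
strand `j` between `u` and `v`. -/
def claspedWord (u : List Layer) (j : ℕ) (z : ℤ) (v : List Layer) : List Layer :=
  doubleWord u ++ shift (2 * j) (twistedClasp z) ++ doubleWord v

theorem fits_shift_twistedClasp {n j : ℕ} (hj : j < n) (z : ℤ) :
    Fits (2 * n) (shift (2 * j) (twistedClasp z)) (2 * n) := by
  obtain ⟨d, rfl⟩ := Nat.exists_eq_add_of_le (show j + 1 ≤ _ from hj)
  convert (Slides.twistedClasp z).fits.shift (2 * j) (2 * d) using 1 <;> ring

theorem fits_claspedWord {u v : List Layer} {n j : ℕ} {z : ℤ} (hu : Fits 0 u n) (hv : Fits n v 0)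
    (hj : j < n) : Fits 0 (claspedWord u j z v) 0 :=
  (hu.double.append (fits_shift_twistedClasp hj z)).append hv.double

/-! ### Sliding the clasp along a diagram -/

theorem Fits.foldl_above {n m : ℕ} {w : List Layer} (h : Fits n w m) :
    w.foldl (fun n x => x.above n) n = m := by
  induction w generalizing n with
  | nil => exact h
  | cons x w ih => exact ih h.2

theorem LinkDiagram.fits (D : LinkDiagram) : Fits 0 D.word 0 := closesFrom_iff_fits.1 D.closes

theorem LinkDiagram.fits_take_drop (D : LinkDiagram) (k : ℕ) :
    Fits 0 (D.word.take k) (D.width k) ∧ Fits (D.width k) (D.word.drop k) 0 := by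
  obtain ⟨n, h1, h2⟩ := fits_append.1 ((List.take_append_drop k D.word).symm ▸ D.fits)
  obtain rfl : D.width k = n := h1.foldl_above
  exact ⟨h1, h2⟩

theorem LinkDiagram.width_length {D : LinkDiagram} {u v : List Layer} {n : ℕ}
    (hD : D.word = u ++ v) (hu : Fits 0 u n) : D.width u.length = n := by
  rw [LinkDiagram.width, hD, List.take_left]
  exact hu.foldl_above

theorem LinkDiagram.isPoint_length {D : LinkDiagram} {u v : List Layer} {n j : ℕ}
    (hD : D.word = u ++ v) (hu : Fits 0 u n) (hj : j < n) : D.IsPoint (u.length, j) := by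
  refine ⟨by simp [hD], ?_⟩
  rw [LinkDiagram.width_length hD hu]
  exact hj

/-- The blackboard parallel of a diagram with a twisted clasp of the two copies at a point. -/
def LinkDiagram.clasped (D : LinkDiagram) (p : ℕ × ℕ) (z : ℤ) : List Layer :=
  claspedWord (D.word.take p.1) p.2 z (D.word.drop p.1)

theorem LinkDiagram.clasped_length {D : LinkDiagram} {u v : List Layer} (hD : D.word = u ++ v)
    (j : ℕ) (z : ℤ) : D.clasped (u.length, j) z = claspedWord u j z v := by
  simp [LinkDiagram.clasped, hD]

theorem LinkDiagram.fits_clasped {D : LinkDiagram} {p : ℕ × ℕ} (hp : D.IsPoint p) (z : ℤ) :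
    Fits 0 (D.clasped p z) 0 :=
  fits_claspedWord (D.fits_take_drop p.1).1 (D.fits_take_drop p.1).2 hp.2

theorem LinkDiagram.take_succ_drop {D : LinkDiagram} {k : ℕ} {x : Layer}
    (h : D.word[k]? = some x) :
    D.word.take (k + 1) = D.word.take k ++ [x] ∧ D.word.drop k = [x] ++ D.word.drop (k + 1) := by
  obtain ⟨hk, rfl⟩ := List.getElem?_eq_some_iff.1 h
  exact ⟨(List.take_append_getElem hk).symm, (List.drop_eq_getElem_cons hk)⟩

theorem LinkDiagram.fits_layer {D : LinkDiagram} {k : ℕ} {x : Layer}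
    (h : D.word[k]? = some x) : Fits (D.width k) [x] (D.width (k + 1)) := by
  obtain ⟨h1, h2⟩ := LinkDiagram.take_succ_drop h
  obtain ⟨n, h3, h4⟩ := fits_append.1 (h1 ▸ (D.fits_take_drop (k + 1)).1)
  rwa [h3.unique (D.fits_take_drop k).1] at h4

/-- An arc inside a layer either passes the event at a distance, turns at a minimum or maximum, or
runs through a crossing; these are the ways in which a tangle that `Slides` can move. -/
theorem LinkDiagram.clasped_joined {D : LinkDiagram} {p q : D.Point}
    (h : D.Joined (fun _ => none) p q) (z : ℤ) :
    WordEquiv 0 0 (D.clasped p.1 z) (D.clasped q.1 z) := by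
  obtain ⟨k, x, hx, h⟩ := h
  have hf := LinkDiagram.fits_layer hx
  obtain ⟨h1, h2⟩ := LinkDiagram.take_succ_drop hx
  have hu := (D.fits_take_drop k).1.double
  have hv := (D.fits_take_drop (k + 1)).2.double
  have hA := Slides.twistedClasp z
  obtain ⟨p, hp⟩ := p
  obtain ⟨q, hq⟩ := q
  simp only at h
  have through : ∀ i j, WordEquiv (2 * D.width k) (2 * D.width (k + 1))
      (shift (2 * i) (twistedClasp z) ++ doubleWord [x])
      (doubleWord [x] ++ shift (2 * j) (twistedClasp z)) →
      WordEquiv 0 0 (D.clasped (k, i) z) (D.clasped (k + 1, j) z) := by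
    intro i j h
    have := h.congr hu hv
    simpa only [LinkDiagram.clasped, claspedWord, h1, h2, doubleWord_append, List.append_assoc,
        add_zero, mul_zero]
        using this
  rcases h with ⟨j, hj, rfl, rfl⟩ | ⟨j, rfl, rfl⟩ | ⟨a, ha, hpa, hqa⟩
  · exact through _ _ (hA.comp_left hf hj)
  · exact through _ _ (hA.comp_right hf hp.2)
  · obtain ⟨e, i⟩ := x
    cases e with
    | cup =>
      simp only [Event.arcs, List.mem_singleton] at ha
      subst ha hpa hqa
      have := (hA.comp_cup hf).congr hu hv
      simpa only [LinkDiagram.clasped, claspedWord, h1, h2, doubleWord_append, List.append_assoc,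
        add_zero, mul_zero]
        using this
    | cap =>
      simp only [Event.arcs, List.mem_singleton] at ha
      subst ha hpa hqa
      have := (hA.comp_cap hf).congr hu hv
      simpa only [LinkDiagram.clasped, claspedWord, h1, h2, doubleWord_append, List.append_assoc,
        add_zero, mul_zero]
        using this
    | cross b =>
      simp only [Event.arcs, List.mem_cons, List.not_mem_nil, or_false] at ha
      rcases ha with rfl | rfl <;> subst hpa hqa
      · exact through _ _ (hA.comp_cross_left hf)
      · exact through _ _ (hA.comp_cross_right hf)

/-- With a single component any two points are connected by a chain of arcs, along which the clasp
travels. -/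
theorem LinkDiagram.IsKnot.clasped_wordEquiv {D : LinkDiagram} (hD : D.IsKnot) (p q : D.Point)
    (z : ℤ) : WordEquiv 0 0 (D.clasped p.1 z) (D.clasped q.1 z) := by
  have h : Relation.EqvGen (D.Joined (fun _ => none)) p q :=
    Quot.eqvGen_exact ((hD.unique (y₁ := Quot.mk _ p) (y₂ := Quot.mk _ q)) trivial trivial)
  induction h with
  | rel _ _ h => exact LinkDiagram.clasped_joined h z
  | refl => exact .refl _
  | symm _ _ _ ih => exact ih.symm
  | trans _ _ _ _ _ ih ih' => exact ih.trans ih'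

/-! ### The clasped double under the moves -/

/-- The move from `l` to `r` lowers the writhe by `d`. -/
def MoveFraming (l r : List Layer) (d : ℤ) : Prop :=
  (FramedMove l r ∧ d = 0) ∨
    (∃ b i, l = [cross b i, cap i] ∧ r = [cap i] ∧ d = kinkSign b) ∨
    (∃ b i, l = [cup i, cross b i] ∧ r = [cup i] ∧ d = kinkSign b)

theorem Move.exists_framing {l r : List Layer} (h : Move l r) : ∃ d, MoveFraming l r d := by
  rcases h.framed_or with h | ⟨b, i, hl, hr⟩ | ⟨b, i, hl, hr⟩
  · exact ⟨_, .inl ⟨h, rfl⟩⟩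
  · exact ⟨_, .inr (.inl ⟨b, i, hl, hr, rfl⟩)⟩
  · exact ⟨_, .inr (.inr ⟨b, i, hl, hr, rfl⟩)⟩

theorem MoveFraming.move {l r : List Layer} {d : ℤ} (h : MoveFraming l r d) : Move l r := by
  rcases h with ⟨h, _⟩ | ⟨b, i, rfl, rfl, _⟩ | ⟨b, i, rfl, rfl, _⟩
  · exact h.move
  · exact .reidemeister_one_cap b i
  · exact .reidemeister_one_cup b i

/-- Provides a strand at the bottom or the top of the move, unaffected by it, where the clasp can be
parked. -/
theorem FramedMove.pos_or_pos {l r : List Layer} {n m : ℕ} (h : FramedMove l r)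
    (hl : Fits n l m) : 0 < n ∨ 0 < m := by
  cases h with
  | exchange e f i d =>
    cases e <;> cases f <;>
      simp only [Fits, Layer.above, Event.inn, Event.out] at hl <;> omega
  | _ => simp only [Fits, Layer.above, Event.inn, Event.out] at hl; omega

theorem crossing_comp_crossings (a b : Bool) (n : ℕ) :
    WordEquiv 2 2 ([cross a 0] ++ List.replicate n (cross b 0))
      (List.replicate n (cross b 0) ++ [cross a 0]) := by
  induction n with
  | zero => exact .refl _
  | succ n ih =>
    have h : WordEquiv 2 2 ([cross a 0] ++ [cross b 0]) ([cross b 0] ++ [cross a 0]) := by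
      by_cases hab : b = !a
      · refine Confluent.wordEquiv (cs := [(0, .simp)]) (cs' := [(0, .simp)]) ?_
        subst hab
        clear ih
        revert a
        decide
      · obtain rfl : b = a := by simpa using hab
        exact .refl _
    have h1 := h.append_right (fits_replicate_cross b n)
    have h2 := ih.append_left (Slides.crossing b).fits
    rw [List.append_assoc, List.append_assoc] at h1
    rw [List.replicate_succ]
    simpa using h1.trans h2

theorem crossing_comp_twistedClasp (a : Bool) (z : ℤ) :
    WordEquiv 2 2 ([cross a 0] ++ twistedClasp z) (twistedClasp z ++ [cross a 0]) := by
  have h1 := (crossing_comp_clasp a).append_right (Slides.fullTwists z).fits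
  have h2 : WordEquiv 2 2 ([cross a 0] ++ fullTwists z) (fullTwists z ++ [cross a 0]) := by
    cases z <;> exact crossing_comp_crossings _ _ _
  have h3 := h2.append_left Slides.clasp.fits
  rw [List.append_assoc, List.append_assoc] at h1
  rw [twistedClasp, List.append_assoc]
  exact h1.trans h3

theorem twistedClasp_comp_twist (z : ℤ) (b : Bool) :
    WordEquiv 2 2 (twistedClasp z ++ [cross (!b) 0, cross (!b) 0])
      (twistedClasp (z + kinkSign b)) := by
  have := (fullTwists_comp_cross z b).append_left Slides.clasp.fits
  rwa [← List.append_assoc] at this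

theorem twist_comp_twistedClasp (z : ℤ) (b : Bool) :
    WordEquiv 2 2 ([cross (!b) 0, cross (!b) 0] ++ twistedClasp z)
      (twistedClasp (z + kinkSign b)) := by
  have h1 := (crossing_comp_twistedClasp (!b) z).append_left (Slides.crossing (!b)).fits
  have h2 := (crossing_comp_twistedClasp (!b) z).append_right (Slides.crossing (!b)).fits
  refine .trans ?_ (twistedClasp_comp_twist z b)
  simp only [List.append_assoc, List.singleton_append] at h1 h2 ⊢
  exact h1.trans h2

/-- The clasp is parked on the leg of the kink, so that the full twist made by the doubled kink
appears next to it and is absorbed in `z`. -/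
theorem twistedClasp_comp_kink (z : ℤ) (b : Bool) {n m i : ℕ} (hf : Fits n [cap i] m) :
    WordEquiv (2 * n) (2 * m)
      (shift (2 * i) (twistedClasp z) ++ doubleWord [cross b i, cap i])
      (shift (2 * i) (twistedClasp (z + kinkSign b)) ++ doubleWord [cap i]) := by
  obtain ⟨t, rfl, rfl⟩ := fits_singleton.1 hf
  have h1 := (double_kink_cap b).append_left (Slides.twistedClasp z).fits_left
  have h2 := (by simpa [shift_zero] using (twistedClasp_comp_twist z b).shift 0 2 :
    WordEquiv 4 4 _ _).append_right fits_double_cap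
  rw [← List.append_assoc] at h1
  rw [List.append_assoc] at h2
  rw [← List.append_assoc] at h2
  have h3 := (h1.trans h2).shift (2 * i) (2 * t)
  simp only [shift_append, ← doubleWord_shift] at h3
  rw [show shift i [cap 0] = [cap i] from rfl,
    show shift i [cross b 0, cap 0] = [cross b i, cap i] from rfl] at h3
  simp only [Event.inn, Event.out]
  convert h3 using 1 <;> ring

theorem kink_comp_twistedClasp (z : ℤ) (b : Bool) {n m i : ℕ} (hf : Fits n [cup i] m) :
    WordEquiv (2 * n) (2 * m)
      (doubleWord [cup i, cross b i] ++ shift (2 * i) (twistedClasp z))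
      (doubleWord [cup i] ++ shift (2 * i) (twistedClasp (z + kinkSign b))) := by
  obtain ⟨t, rfl, rfl⟩ := fits_singleton.1 hf
  have h1 := (double_kink_cup b).append_right (Slides.twistedClasp z).fits_left
  have h2 := (by simpa [shift_zero] using (twist_comp_twistedClasp z b).shift 0 2 :
    WordEquiv 4 4 _ _).append_left fits_double_cup
  rw [List.append_assoc] at h1
  have h3 := (h1.trans h2).shift (2 * i) (2 * t)
  simp only [shift_append, ← doubleWord_shift] at h3
  rw [show shift i [cup 0] = [cup i] from rfl,
    show shift i [cup 0, cross b 0] = [cup i, cross b i] from rfl] at h3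
  simp only [Event.inn, Event.out]
  convert h3 using 1 <;> ring

/-- The clasp is placed at the lower or the upper boundary of the replaced subword, at a point that
both diagrams share. Other positions are reached later by sliding. -/
theorem exists_clasped_wordEquiv_of_move {D E : LinkDiagram} {u v l r : List Layer} {d : ℤ}
    (h : MoveFraming l r d) (hD : D.word = u ++ l ++ v) (hE : E.word = u ++ r ++ v) :
    ∃ (p : D.Point) (q : E.Point),
      ∀ z, WordEquiv 0 0 (D.clasped p.1 z) (E.clasped q.1 (z + d)) := by
  obtain ⟨n, hun, hn⟩ := fits_append.1 (show Fits 0 (u ++ (l ++ v)) 0 by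
    rw [← List.append_assoc, ← hD]; exact D.fits)
  obtain ⟨m, hl, hv⟩ := fits_append.1 hn
  have hr := h.move.fits hl
  have hD' : D.word = u ++ (l ++ v) := by rw [hD, List.append_assoc]
  have hE' : E.word = u ++ (r ++ v) := by rw [hE, List.append_assoc]
  have below : ∀ j < n, (∀ z, WordEquiv (2 * n) (2 * m)
      (shift (2 * j) (twistedClasp z) ++ doubleWord l)
      (shift (2 * j) (twistedClasp (z + d)) ++ doubleWord r)) →
      ∃ (p : D.Point) (q : E.Point),
        ∀ z, WordEquiv 0 0 (D.clasped p.1 z) (E.clasped q.1 (z + d)) := by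
    intro j hj h
    refine ⟨⟨_, D.isPoint_length hD' hun hj⟩, ⟨_, E.isPoint_length hE' hun hj⟩, fun z => ?_⟩
    simp only
    rw [D.clasped_length hD', E.clasped_length hE']
    simpa [claspedWord, doubleWord_append] using (h z).congr hun.double hv.double
  have above : ∀ j < m, (∀ z, WordEquiv (2 * n) (2 * m)
      (doubleWord l ++ shift (2 * j) (twistedClasp z))
      (doubleWord r ++ shift (2 * j) (twistedClasp (z + d)))) →
      ∃ (p : D.Point) (q : E.Point),
        ∀ z, WordEquiv 0 0 (D.clasped p.1 z) (E.clasped q.1 (z + d)) := by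
    intro j hj h
    refine ⟨⟨_, D.isPoint_length hD (hun.append hl) hj⟩,
      ⟨_, E.isPoint_length hE (hun.append hr) hj⟩, fun z => ?_⟩
    simp only
    rw [D.clasped_length hD, E.clasped_length hE]
    simpa [claspedWord, doubleWord_append] using (h z).congr hun.double hv.double
  rcases h with ⟨h, rfl⟩ | ⟨b, i, rfl, rfl, rfl⟩ | ⟨b, i, rfl, rfl, rfl⟩
  · rcases h.pos_or_pos hl with hn | hm
    · refine below 0 hn fun z => ?_
      rw [add_zero]
      exact (h.double hl).append_left (fits_shift_twistedClasp hn z)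
    · refine above 0 hm fun z => ?_
      rw [add_zero]
      exact (h.double hl).append_right (fits_shift_twistedClasp hm z)
  · exact below i (by have := hr.1; simp only [Event.inn] at this; omega)
      fun z => twistedClasp_comp_kink z b hr
  · refine above i ?_ fun z => kink_comp_twistedClasp z b hr
    simp only [Fits, Layer.above, Event.inn, Event.out] at hr
    omega

/-! ### Labelings of the strands -/

/-- The label of an end of a layer, where `f` and `g` are the labels of the strands below and above
it. -/
def Layer.endLabel {S : Type*} (x : Layer) (f g : ℕ → S) (e : ℕ × ℕ) : S :=
  if e.1 = 0 then f (x.pos + e.2) else g (x.pos + e.2)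

/-- The labels `f` of the strands below a layer and the labels `g` of the strands above it are
compatible: a label is kept along the arcs that run through the layer, and it changes by `τ` along
the arcs that turn back. -/
def Layer.Rel {S : Type*} (τ : S → S) (ρ : Option Resolution) (x : Layer) (f g : ℕ → S) : Prop :=
  (∀ j < x.pos, g j = f j) ∧
    (∀ j, g (x.pos + x.event.out + j) = f (x.pos + x.event.inn + j)) ∧
    ∀ a ∈ x.event.arcs ρ,
      x.endLabel f g a.2 = (if a.1.1 = a.2.1 then τ else id) (x.endLabel f g a.1)

/-- Two new strands `i`, `i + 1` with the labels `a`, `τ a`. -/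
def insertPair {S : Type*} (τ : S → S) (i : ℕ) (a : S) (f : ℕ → S) (j : ℕ) : S :=
  if j < i then f j else if j = i then a else if j = i + 1 then τ a else f (j - 2)

/-- The labels after the strands `i`, `i + 1` are exchanged. -/
def swapPair {S : Type*} (i : ℕ) (f : ℕ → S) (j : ℕ) : S :=
  if j = i then f (i + 1) else if j = i + 1 then f i else f j

section

variable {S : Type*} {τ : S → S} {ρ : Option Resolution} {f g : ℕ → S} {i : ℕ} {b : Bool}

theorem eq_insertPair_iff :
    (∃ a, g = insertPair τ i a f) ↔
      (∀ j < i, g j = f j) ∧ (∀ j, g (i + 2 + j) = f (i + j)) ∧ g (i + 1) = τ (g i) := by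
  constructor
  · rintro ⟨a, rfl⟩
    refine ⟨fun j hj => by simp [insertPair, hj], fun j => ?_, by simp [insertPair]⟩
    simp only [insertPair]
    split_ifs <;> first | omega | (congr 1; omega)
  · rintro ⟨h1, h2, h3⟩
    refine ⟨g i, funext fun j => ?_⟩
    simp only [insertPair]
    split_ifs with hj hj' hj''
    · exact h1 j hj
    · rw [hj']
    · rw [hj'', h3]
    · have := h2 (j - i - 2)
      rwa [show i + 2 + (j - i - 2) = j by omega, show i + (j - i - 2) = j - 2 by omega] at this

theorem rel_cup : Layer.Rel τ ρ (cup i) f g ↔ ∃ a, g = insertPair τ i a f := by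
  rw [eq_insertPair_iff]
  simp [Layer.Rel, Event.arcs, Layer.endLabel, Event.inn, Event.out]

theorem rel_cap : Layer.Rel τ ρ (cap i) f g ↔ ∃ a, f = insertPair τ i a g := by
  rw [eq_insertPair_iff]
  simp only [Layer.Rel, Event.arcs, Layer.endLabel, Event.inn, Event.out, List.mem_singleton,
    forall_eq, if_true, add_zero]
  exact and_congr ⟨fun h j hj => (h j hj).symm, fun h j hj => (h j hj).symm⟩
    (and_congr ⟨fun h j => (h j).symm, fun h j => (h j).symm⟩ Iff.rfl)

theorem rel_cross : Layer.Rel τ none (cross b i) f g ↔ g = swapPair i f := by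
  simp only [Layer.Rel, Event.arcs, Layer.endLabel, Event.inn, Event.out, List.mem_cons,
    List.not_mem_nil, or_false, forall_eq_or_imp, forall_eq]
  simp only [if_true, one_ne_zero, zero_ne_one, if_false, id, add_zero]
  constructor
  · rintro ⟨h1, h2, h3, h4⟩
    funext j
    simp only [swapPair]
    split_ifs with hj hj'
    · rw [hj, h4]
    · rw [hj', h3]
    · rcases lt_or_ge j i with h | h
      · exact h1 j h
      · have := h2 (j - i - 2)
        rwa [show i + 2 + (j - i - 2) = j by omega] at this
  · rintro rfl
    refine ⟨fun j hj => ?_, fun j => ?_, ?_, ?_⟩ <;> simp only [swapPair] <;>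
      split_ifs <;> first | omega | rfl

/-- The strand end `c` belongs to the event `e`. -/
def Event.HasEnd (e : Event) (c : ℕ × ℕ) : Prop := c.1 = 0 ∧ c.2 < e.inn ∨ c.1 = 1 ∧ c.2 < e.out

theorem Event.arcs_valid {e : Event} {a : (ℕ × ℕ) × (ℕ × ℕ)} (h : a ∈ e.arcs ρ) :
    e.HasEnd a.1 ∧ e.HasEnd a.2 := by
  revert h
  rcases e with _ | _ | b
  · rcases ρ with _ | _ | _ <;> simp +contextual [Event.arcs, Event.HasEnd, Event.out]
  · rcases ρ with _ | _ | _ <;> simp +contextual [Event.arcs, Event.HasEnd, Event.inn]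
  · rcases ρ with _ | _ | _ <;> cases b <;>
      simp only [Event.arcs, verticalArcs, horizontalArcs, List.mem_cons, List.not_mem_nil,
        or_false] <;> rintro (rfl | rfl) <;> simp [Event.HasEnd, Event.inn, Event.out]

theorem Layer.endLabel_congr {e : Event} {p p' : ℕ} {f' g' : ℕ → S} {c : ℕ × ℕ}
    (hc : e.HasEnd c)
    (hf : ∀ j < e.inn, f (p + j) = f' (p' + j)) (hg : ∀ j < e.out, g (p + j) = g' (p' + j)) :
    Layer.endLabel ⟨e, p⟩ f g c = Layer.endLabel ⟨e, p'⟩ f' g' c := by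
  simp only [Layer.endLabel]
  rcases hc with ⟨h0, hc⟩ | ⟨h1, hc⟩
  · rw [if_pos h0, if_pos h0]
    exact hf _ hc
  · rw [if_neg (by omega), if_neg (by omega)]
    exact hg _ hc

/-- The labels of the strands between two layers that lie side by side, when the lower one of them
is moved up. -/
theorem Layer.Rel.exchange {e e' : Event} {d : ℕ} {h : ℕ → S}
    (h1 : Layer.Rel τ ρ ⟨e, i⟩ f h) (h2 : Layer.Rel τ ρ ⟨e', i + e.out + d⟩ h g) :
    ∃ h', Layer.Rel τ ρ ⟨e', i + e.inn + d⟩ f h' ∧ Layer.Rel τ ρ ⟨e, i⟩ h' g := by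
  obtain ⟨h11, h12, h13⟩ := h1
  obtain ⟨h21, h22, h23⟩ := h2
  simp only at h11 h12 h13 h21 h22 h23
  have hA : ∀ j, h (i + e.out + d + j) = f (i + e.inn + d + j) := fun j => by
    have := h12 (d + j)
    rwa [← add_assoc, ← add_assoc] at this
  have hB1 : ∀ j < i + e.inn + d, (if j < i + e.inn + d then f j else
      g (i + e.out + d + (j - (i + e.inn + d)))) = f j := fun j hj => if_pos hj
  have hB2 : ∀ j, (if i + e.inn + d + j < i + e.inn + d then f (i + e.inn + d + j) else
      g (i + e.out + d + (i + e.inn + d + j - (i + e.inn + d)))) = g (i + e.out + d + j) := by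
    intro j
    rw [if_neg (by omega)]
    congr 1
    omega
  -- Now the right event comes first: to its left the labels are still those of `f`, and from its
  -- position on they are those of `g`, with the indices corrected for the change of width by `e`.
  generalize hh' : (fun j => if j < i + e.inn + d then f j else
      g (i + e.out + d + (j - (i + e.inn + d)))) = h'
  have hC1 : ∀ j < i + e.inn + d, h' j = f j := by rw [← hh']; exact hB1
  have hC2 : ∀ j, h' (i + e.inn + d + j) = g (i + e.out + d + j) := by rw [← hh']; exact hB2
  refine ⟨h', ⟨hC1, fun j => ?_, fun a (ha : a ∈ Event.arcs ρ _) => ?_⟩, ⟨fun j hj => ?_, fun j => ?_, fun a (ha : a ∈ Event.arcs ρ _) => ?_⟩⟩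
  · simp only
    rw [add_assoc (i + e.inn + d), hC2, ← add_assoc, h22, add_assoc (i + e.out + d), hA,
      add_assoc (i + e.inn + d)]
  · have hv := Event.arcs_valid ha
    rw [Layer.endLabel_congr hv.1 (fun j _ => (hA j).symm) (fun j _ => hC2 j),
      Layer.endLabel_congr hv.2 (fun j _ => (hA j).symm) (fun j _ => hC2 j)]
    exact h23 a ha
  · simp only at hj ⊢
    rw [h21 j (by omega), h11 j hj, hC1 j (by omega)]
  · simp only
    rcases lt_or_ge j d with hj | hj
    · rw [h21 _ (by omega), h12, hC1 _ (by omega)]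
    · obtain ⟨k, rfl⟩ := Nat.exists_eq_add_of_le hj
      rw [← add_assoc, ← add_assoc, hC2]
  · have hv := Event.arcs_valid ha
    rw [Layer.endLabel_congr hv.1 (fun j (hj : j < e.inn) => hC1 _ (by omega))
        (fun j (hj : j < e.out) => h21 _ (by omega)),
      Layer.endLabel_congr hv.2 (fun j (hj : j < e.inn) => hC1 _ (by omega))
        (fun j (hj : j < e.out) => h21 _ (by omega))]
    exact h13 a ha

/-- The labels of the strands between two layers that lie side by side, when the lower one of them
is moved up. -/
theorem Layer.Rel.exchange_symm {e e' : Event} {d : ℕ} {h' : ℕ → S}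
    (h1 : Layer.Rel τ ρ ⟨e', i + e.inn + d⟩ f h') (h2 : Layer.Rel τ ρ ⟨e, i⟩ h' g) :
    ∃ h, Layer.Rel τ ρ ⟨e, i⟩ f h ∧ Layer.Rel τ ρ ⟨e', i + e.out + d⟩ h g := by
  obtain ⟨h11, h12, h13⟩ := h1
  obtain ⟨h21, h22, h23⟩ := h2
  simp only at h11 h12 h13 h21 h22 h23
  generalize hh : (fun j => if j < i + e.out + d then g j else
      f (i + e.inn + d + (j - (i + e.out + d)))) = h
  have hC1 : ∀ j < i + e.out + d, h j = g j := by
    rw [← hh]; exact fun j hj => if_pos hj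
  have hC2 : ∀ j, h (i + e.out + d + j) = f (i + e.inn + d + j) := by
    intro j
    rw [← hh]
    simp only
    rw [if_neg (by omega)]
    congr 1
    omega
  have hA : ∀ j, g (i + e.out + d + j) = h' (i + e.inn + d + j) := fun j => by
    have := h22 (d + j)
    rwa [← add_assoc, ← add_assoc] at this
  refine ⟨h, ⟨fun j hj => ?_, fun j => ?_, fun a (ha : a ∈ Event.arcs ρ _) => ?_⟩, ⟨fun j hj => (hC1 j hj).symm,
    fun j => ?_, fun a (ha : a ∈ Event.arcs ρ _) => ?_⟩⟩
  · simp only at hj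
    rw [hC1 j (by omega), h21 j hj, h11 j (by omega)]
  · simp only
    rcases lt_or_ge j d with hj | hj
    · rw [hC1 _ (by omega), h22, h11 _ (by omega)]
    · obtain ⟨k, rfl⟩ := Nat.exists_eq_add_of_le hj
      rw [← add_assoc, ← add_assoc, hC2]
  · have hv := Event.arcs_valid ha
    rw [Layer.endLabel_congr hv.1 (fun j (hj : j < e.inn) => (h11 _ (by omega)).symm)
        (fun j (hj : j < e.out) => hC1 _ (by omega)),
      Layer.endLabel_congr hv.2 (fun j (hj : j < e.inn) => (h11 _ (by omega)).symm)
        (fun j (hj : j < e.out) => hC1 _ (by omega))]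
    exact h23 a ha
  · simp only
    rw [add_assoc (i + e.out + d), hA, ← add_assoc, h12, add_assoc (i + e.out + d), hC2, add_assoc]
  · have hv := Event.arcs_valid ha
    rw [Layer.endLabel_congr hv.1 (fun j _ => hC2 j) (fun j _ => hA j),
      Layer.endLabel_congr hv.2 (fun j _ => hC2 j) (fun j _ => hA j)]
    exact h13 a ha

end

/-! ### Runs -/

/-- A rule for the labels of a diagram: `τ` is the change of a label at the turning points of a
strand, and a crossing has a weight, so that the sum of the weights changes under the first
Reidemeister move only. -/
structure LabelRule (S : Type*) where
  τ : S → S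
  τ_τ : ∀ a, τ (τ a) = a
  weight : Bool → S → S → ℤ
  scale : ℤ
  weight_kink : ∀ b a, weight b a (τ a) = scale * kinkSign b
  weight_slide_left : ∀ b x y, weight b x y = weight (!b) y (τ x)
  weight_slide_right : ∀ b x y, weight b x y = weight (!b) (τ y) x
  weight_not : ∀ b x y, weight b x y + weight (!b) y x = 0

/-- The weight of a layer. -/
def Layer.weight {S : Type*} (w : Bool → S → S → ℤ) (x : Layer) (f : ℕ → S) : ℤ :=
  match x.event with
  | .cross b => w b (f x.pos) (f (x.pos + 1))
  | _ => 0

/-- The strands of a word have a labeling of total weight `z` whose labels are `f` at the bottom and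
`g` at the top. -/
def Run {S : Type*} (L : LabelRule S) : List Layer → (ℕ → S) → (ℕ → S) → ℤ → Prop
  | [], f, g, z => f = g ∧ z = 0
  | x :: w, f, g, z => ∃ h, x.Rel L.τ none f h ∧ Run L w h g (z - x.weight L.weight f)

section

variable {S : Type*} {L : LabelRule S} {f g : ℕ → S} {z : ℤ}

theorem run_append {u v : List Layer} :
    Run L (u ++ v) f g z ↔ ∃ h y, Run L u f h y ∧ Run L v h g (z - y) := by
  induction u generalizing f z with
  | nil =>
    constructor
    · exact fun h => ⟨f, 0, ⟨rfl, rfl⟩, by simpa using h⟩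
    · rintro ⟨h, y, ⟨rfl, rfl⟩, h⟩
      simpa using h
  | cons x u ih =>
    simp only [List.cons_append, Run, ih]
    constructor
    · rintro ⟨h, h1, h', y, h2, h3⟩
      exact ⟨h', y + x.weight L.weight f, ⟨h, h1, by simpa using h2⟩,
        by rwa [show z - (y + x.weight L.weight f) = z - x.weight L.weight f - y by ring]⟩
    · rintro ⟨h', y, ⟨h, h1, h2⟩, h3⟩
      exact ⟨h, h1, h', _, h2, by
        rwa [show z - x.weight L.weight f - (y - x.weight L.weight f) = z - y by ring]⟩

theorem insertPair_of_lt {τ : S → S} {i j : ℕ} {a : S} (h : j < i) : insertPair τ i a f j = f j := by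
  simp [insertPair, h]

theorem insertPair_self {τ : S → S} {i : ℕ} {a : S} : insertPair τ i a f i = a := by
  simp [insertPair]

theorem insertPair_succ {τ : S → S} {i : ℕ} {a : S} : insertPair τ i a f (i + 1) = τ a := by
  simp [insertPair]

theorem insertPair_add {τ : S → S} {i j : ℕ} {a : S} (h : i ≤ j) :
    insertPair τ i a f (j + 2) = f j := by
  simp only [insertPair]
  split_ifs <;> first | omega | rfl

theorem swapPair_swapPair {i : ℕ} : swapPair i (swapPair i f) = f := by
  funext j
  grind [swapPair]

/-- The combinatorics of a zigzag: the label of strand `i` is changed by `τ` at each of the two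
turns and comes back to itself, since `τ` is an involution. -/
theorem insertPair_succ_eq_iff {i : ℕ} {a b : S} :
    insertPair L.τ (i + 1) a f = insertPair L.τ i b g ↔ f = g ∧ a = L.τ b ∧ b = f i := by
  have := L.τ_τ
  constructor
  · intro h
    have h' := fun j => congrFun h j
    refine ⟨funext fun j => ?_, ?_, ?_⟩
    · rcases lt_trichotomy j i with hj | rfl | hj
      · grind [insertPair, h' j]
      · grind [insertPair, h' j, h' (j + 1), h' (j + 2)]
      · grind [insertPair, h' (j + 2)]
    · grind [insertPair, h' (i + 1)]
    · grind [insertPair, h' i]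
  · rintro ⟨rfl, rfl, rfl⟩
    funext j
    grind [insertPair]

theorem swapPair_insertPair_succ {i : ℕ} {a : S} :
    swapPair (i + 1) (swapPair i (insertPair L.τ (i + 1) a f)) = insertPair L.τ i a f := by
  funext j
  grind [swapPair, insertPair]

theorem swapPair_insertPair {i : ℕ} {a : S} :
    swapPair i (insertPair L.τ i a f) = insertPair L.τ i (L.τ a) f := by
  have := L.τ_τ a
  funext j
  grind [swapPair, insertPair]

theorem swapPair_braid {i : ℕ} : swapPair i (swapPair (i + 1) (swapPair i f)) =
    swapPair (i + 1) (swapPair i (swapPair (i + 1) f)) := by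
  funext j
  grind [swapPair]

theorem swapPair_eq_iff {i : ℕ} : swapPair i f = g ↔ f = swapPair i g :=
  ⟨fun h => by rw [← h, swapPair_swapPair], fun h => by rw [h, swapPair_swapPair]⟩

theorem run_zigzag {i : ℕ} : Run L [cup (i + 1), cap i] f g z ↔ Run L [] f g z := by
  simp only [Run, rel_cup, rel_cap, Layer.weight, sub_zero]
  constructor
  · rintro ⟨h, ⟨a, rfl⟩, h', ⟨b, hb⟩, rfl, rfl⟩
    exact ⟨(insertPair_succ_eq_iff.1 hb).1, rfl⟩
  · rintro ⟨rfl, rfl⟩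
    exact ⟨_, ⟨_, rfl⟩, f, ⟨f i, insertPair_succ_eq_iff.2 ⟨rfl, rfl, rfl⟩⟩, rfl, rfl⟩

theorem run_zagzig {i : ℕ} : Run L [cup i, cap (i + 1)] f g z ↔ Run L [] f g z := by
  simp only [Run, rel_cup, rel_cap, Layer.weight, sub_zero]
  constructor
  · rintro ⟨h, ⟨a, rfl⟩, h', ⟨b, hb⟩, rfl, rfl⟩
    exact ⟨(insertPair_succ_eq_iff.1 hb.symm).1.symm, rfl⟩
  · rintro ⟨rfl, rfl⟩
    exact ⟨_, ⟨_, rfl⟩, f, ⟨_, (insertPair_succ_eq_iff.2 ⟨rfl, rfl, rfl⟩).symm⟩, rfl, rfl⟩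

theorem run_slide_cap {b : Bool} {i : ℕ} :
    Run L [cross b i, cap (i + 1)] f g z ↔ Run L [cross (!b) (i + 1), cap i] f g z := by
  simp only [Run, rel_cross, rel_cap, exists_eq_left, Layer.weight, sub_zero]
  constructor
  · rintro ⟨h, ⟨a, ha⟩, rfl, hz⟩
    obtain rfl := swapPair_eq_iff.1 ha
    refine ⟨h, ⟨a, swapPair_insertPair_succ⟩, rfl, ?_⟩
    rw [L.weight_slide_left] at hz
    rw [← hz]
    congr 2; grind [swapPair, insertPair]
  · rintro ⟨h, ⟨a, ha⟩, rfl, hz⟩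
    rw [← swapPair_insertPair_succ (L := L)] at ha
    obtain rfl : f = _ := (swapPair_eq_iff.1 ha).trans swapPair_swapPair
    refine ⟨h, ⟨a, swapPair_swapPair⟩, rfl, ?_⟩
    rw [L.weight_slide_left, ← hz]
    congr 2; grind [swapPair, insertPair]

theorem run_slide_cup {b : Bool} {i : ℕ} :
    Run L [cup (i + 1), cross b i] f g z ↔ Run L [cup i, cross (!b) (i + 1)] f g z := by
  simp only [Run, rel_cross, rel_cup, exists_eq_left, Layer.weight, sub_zero]
  constructor
  · rintro ⟨h, ⟨a, rfl⟩, rfl, hz⟩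
    refine ⟨_, ⟨a, rfl⟩, ?_, ?_⟩
    · rw [← swapPair_insertPair_succ (L := L) (i := i), swapPair_swapPair]
    · rw [L.weight_slide_right] at hz
      rw [← hz]
      congr 2 <;> grind [swapPair, insertPair]
  · rintro ⟨h, ⟨a, rfl⟩, rfl, hz⟩
    refine ⟨_, ⟨a, rfl⟩, ?_, ?_⟩
    · rw [← swapPair_insertPair_succ (L := L) (i := i), swapPair_swapPair]
    · rw [L.weight_slide_right, ← hz]
      congr 2 <;> grind [swapPair, insertPair]

theorem run_kink_cap {b : Bool} {i : ℕ} :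
    Run L [cross b i, cap i] f g z ↔ Run L [cap i] f g (z - L.scale * kinkSign b) := by
  simp only [Run, rel_cross, rel_cap, exists_eq_left, Layer.weight, sub_zero]
  constructor
  · rintro ⟨h, ⟨a, ha⟩, rfl, hz⟩
    obtain rfl := swapPair_eq_iff.1 ha
    rw [swapPair_insertPair, insertPair_self, insertPair_succ, L.weight_kink] at hz
    exact ⟨h, ⟨_, swapPair_insertPair⟩, rfl, hz⟩
  · rintro ⟨h, ⟨a, rfl⟩, rfl, hz⟩
    refine ⟨h, ⟨_, swapPair_insertPair⟩, rfl, ?_⟩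
    rwa [insertPair_self, insertPair_succ, L.weight_kink]

theorem run_kink_cup {b : Bool} {i : ℕ} :
    Run L [cup i, cross b i] f g z ↔ Run L [cup i] f g (z - L.scale * kinkSign b) := by
  simp only [Run, rel_cross, rel_cup, exists_eq_left, Layer.weight, sub_zero]
  constructor
  · rintro ⟨h, ⟨a, rfl⟩, rfl, hz⟩
    rw [insertPair_self, insertPair_succ, L.weight_kink] at hz
    exact ⟨_, ⟨_, rfl⟩, swapPair_insertPair.symm, hz⟩
  · rintro ⟨h, ⟨a, rfl⟩, rfl, hz⟩
    refine ⟨_, ⟨L.τ a, rfl⟩, ?_, ?_⟩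
    · rw [swapPair_insertPair, L.τ_τ]
    · rwa [insertPair_self, insertPair_succ, L.weight_kink]

theorem run_reidemeister_two {b : Bool} {i : ℕ} :
    Run L [cross b i, cross (!b) i] f g z ↔ Run L [] f g z := by
  simp only [Run, rel_cross, exists_eq_left, Layer.weight, swapPair_swapPair]
  have : z - L.weight b (f i) (f (i + 1)) -
      L.weight (!b) (swapPair i f i) (swapPair i f (i + 1)) = z := by
    have := L.weight_not b (f i) (f (i + 1))
    have h1 : swapPair i f i = f (i + 1) := by simp [swapPair]
    have h2 : swapPair i f (i + 1) = f i := by simp [swapPair]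
    rw [h1, h2]
    linarith
  rw [this]

theorem run_reidemeister_three {a b c : Bool} {i : ℕ} :
    Run L [cross a i, cross b (i + 1), cross c i] f g z ↔
      Run L [cross c (i + 1), cross b i, cross a (i + 1)] f g z := by
  simp only [Run, rel_cross, exists_eq_left, Layer.weight, swapPair_braid]
  refine and_congr_right fun _ => Eq.congr_left ?_
  have h1 : swapPair i f (i + 1) = f i := by grind [swapPair]
  have h2 : swapPair i f (i + 1 + 1) = f (i + 2) := by grind [swapPair]
  have h3 : swapPair (i + 1) f i = f i := by grind [swapPair]
  have h4 : swapPair (i + 1) f (i + 1) = f (i + 2) := by grind [swapPair]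
  have h5 : swapPair (i + 1) (swapPair i f) i = f (i + 1) := by grind [swapPair]
  have h6 : swapPair (i + 1) (swapPair i f) (i + 1) = f (i + 2) := by grind [swapPair]
  have h7 : swapPair i (swapPair (i + 1) f) (i + 1) = f i := by grind [swapPair]
  have h8 : swapPair i (swapPair (i + 1) f) (i + 1 + 1) = f (i + 1) := by grind [swapPair]
  rw [h1, h2, h3, h4, h5, h6, h7, h8]
  ring

theorem Layer.weight_congr {w : Bool → S → S → ℤ} {e : Event} {p p' : ℕ}
    (h : ∀ j < e.inn, f (p + j) = g (p' + j)) :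
    Layer.weight w ⟨e, p⟩ f = Layer.weight w ⟨e, p'⟩ g := by
  cases e with
  | cross b =>
    have h0 := h 0 (by simp [Event.inn])
    have h1 := h 1 (by simp [Event.inn])
    simp only [add_zero] at h0
    simp only [Layer.weight, h0, h1]
  | _ => rfl

theorem run_exchange {e e' : Event} {i d : ℕ} :
    Run L [⟨e, i⟩, ⟨e', i + e.out + d⟩] f g z ↔ Run L [⟨e', i + e.inn + d⟩, ⟨e, i⟩] f g z := by
  have key : ∀ h h', Layer.Rel L.τ none ⟨e, i⟩ f h → Layer.Rel L.τ none ⟨e', i + e.inn + d⟩ f h' →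
      Layer.Rel L.τ none ⟨e, i⟩ h' g →
      z - Layer.weight L.weight ⟨e, i⟩ f - Layer.weight L.weight ⟨e', i + e.out + d⟩ h =
        z - Layer.weight L.weight ⟨e', i + e.inn + d⟩ f - Layer.weight L.weight ⟨e, i⟩ h' := by
    intro h h' h1 h2 h3
    rw [Layer.weight_congr (f := h) (g := f) (p' := i + e.inn + d) fun j _ => ?_,
      Layer.weight_congr (f := h') (g := f) (p' := i) fun j (hj : j < e.inn) => ?_]
    · ring
    · exact h2.1 _ (by simp only; omega)
    · have := h1.2.1 (d + j)
      simp only at this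
      rwa [← add_assoc, ← add_assoc] at this
  simp only [Run]
  constructor
  · rintro ⟨h, h1, h', h2, rfl, hz⟩
    obtain ⟨h'', h3, h4⟩ := h1.exchange h2
    exact ⟨h'', h3, _, h4, rfl, key _ _ h1 h3 h4 ▸ hz⟩
  · rintro ⟨h, h1, h', h2, rfl, hz⟩
    obtain ⟨h'', h3, h4⟩ := h1.exchange_symm h2
    exact ⟨h'', h3, _, h4, rfl, (key _ _ h3 h1 h2).trans hz⟩

/-- The labels at the two ends of a local move determine each other in the same way before and after
the move. -/
theorem MoveFraming.run_iff {l r : List Layer} {d : ℤ} (h : MoveFraming l r d) :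
    Run L l f g z ↔ Run L r f g (z - L.scale * d) := by
  rcases h with ⟨h, rfl⟩ | ⟨b, i, rfl, rfl, rfl⟩ | ⟨b, i, rfl, rfl, rfl⟩
  · rw [mul_zero, sub_zero]
    cases h with
    | exchange => exact run_exchange
    | zigzag => exact run_zigzag
    | zagzig => exact run_zagzig
    | slide_cap => exact run_slide_cap
    | slide_cup => exact run_slide_cup
    | reidemeister_two => exact run_reidemeister_two
    | reidemeister_three => exact run_reidemeister_three
  · exact run_kink_cap
  · exact run_kink_cup

end

/-! ### Labelings of diagrams -/

/-- The labels `F k j` of the strands `j` at the levels `k` are compatible in all layers. -/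
def IsLabeling {S : Type*} (τ : S → S) (ρ : Option Resolution) (w : List Layer) (F : ℕ → ℕ → S) :
    Prop :=
  ∀ (k : ℕ) (x : Layer), w[k]? = some x → x.Rel τ ρ (F k) (F (k + 1))

/-- The labels `F` up to the level `n`, followed by the labels `G`. -/
def glue {S : Type*} (n : ℕ) (F G : ℕ → ℕ → S) (k : ℕ) : ℕ → S :=
  if k ≤ n then F k else G (k - n)

section

variable {S : Type*} {τ : S → S} {ρ : Option Resolution} {u v : List Layer} {F G : ℕ → ℕ → S}

theorem glue_of_le {n k : ℕ} (h : k ≤ n) : glue n F G k = F k := if_pos h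

theorem glue_add {n : ℕ} (h : F n = G 0) (k : ℕ) : glue n F G (n + k) = G k := by
  rcases Nat.eq_zero_or_pos k with rfl | hk
  · rw [add_zero, glue_of_le le_rfl, h]
  · rw [glue, if_neg (by omega), Nat.add_sub_cancel_left]

theorem IsLabeling.append (hF : IsLabeling τ ρ u F) (hG : IsLabeling τ ρ v G)
    (h : F u.length = G 0) : IsLabeling τ ρ (u ++ v) (glue u.length F G) := by
  intro k x hx
  rcases lt_or_ge k u.length with hk | hk
  · rw [List.getElem?_append_left hk] at hx
    rw [glue_of_le hk.le, glue_of_le hk]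
    exact hF k x hx
  · rw [List.getElem?_append_right hk] at hx
    obtain ⟨c, rfl⟩ := Nat.exists_eq_add_of_le hk
    rw [Nat.add_sub_cancel_left] at hx
    rw [glue_add h, add_assoc, glue_add h]
    exact hG c x hx

theorem isLabeling_append_iff : IsLabeling τ ρ (u ++ v) F ↔
    IsLabeling τ ρ u F ∧ IsLabeling τ ρ v (fun k => F (u.length + k)) := by
  constructor
  · intro h
    refine ⟨fun k x hx => h k x ?_, fun k x hx => h (u.length + k) x ?_⟩
    · obtain ⟨hk, -⟩ := List.getElem?_eq_some_iff.1 hx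
      rwa [List.getElem?_append_left hk]
    · rwa [List.getElem?_append_right (by omega), Nat.add_sub_cancel_left]
  · rintro ⟨h1, h2⟩ k x hx
    rcases lt_or_ge k u.length with hk | hk
    · rw [List.getElem?_append_left hk] at hx
      exact h1 k x hx
    · rw [List.getElem?_append_right hk] at hx
      obtain ⟨c, rfl⟩ := Nat.exists_eq_add_of_le hk
      rw [Nat.add_sub_cancel_left] at hx
      exact h2 c x hx

theorem isLabeling_cons_iff {x : Layer} : IsLabeling τ ρ (x :: v) F ↔
    x.Rel τ ρ (F 0) (F 1) ∧ IsLabeling τ ρ v (fun k => F (k + 1)) := by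
  constructor
  · exact fun h => ⟨h 0 x rfl, fun k y hy => h (k + 1) y hy⟩
  · rintro ⟨h1, h2⟩ k y hy
    cases k with
    | zero =>
      obtain rfl : x = y := by simpa using hy
      exact h1
    | succ k => exact h2 k y hy

theorem isLabeling_nil : IsLabeling τ ρ [] F := fun k x hx => by simp at hx

theorem run_iff_exists_isLabeling {L : LabelRule S} {w : List Layer} {f g : ℕ → S} {z : ℤ} :
    Run L w f g z ↔ ∃ F, F 0 = f ∧ F w.length = g ∧ IsLabeling L.τ none w F ∧
      z = ∑ k : Fin w.length, (w.get k).weight L.weight (F k) := by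
  induction w generalizing f z with
  | nil =>
    constructor
    · rintro ⟨rfl, rfl⟩
      exact ⟨fun _ => f, rfl, rfl, isLabeling_nil, by simp⟩
    · rintro ⟨F, rfl, rfl, -, rfl⟩
      exact ⟨rfl, by simp⟩
  | cons x w ih =>
    simp only [Run, ih]
    constructor
    · rintro ⟨h, hx, F, hF, hg, hl, hz⟩
      refine ⟨fun k => Nat.casesOn k f F, rfl, hg, isLabeling_cons_iff.2 ⟨?_, hl⟩, ?_⟩
      · change x.Rel L.τ none f (F 0)
        rwa [hF]
      · rw [sub_eq_iff_eq_add'] at hz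
        rw [hz]
        refine Eq.symm ?_
        exact Fin.sum_univ_succ (n := w.length) _
    · rintro ⟨F, rfl, rfl, hl, rfl⟩
      rw [isLabeling_cons_iff] at hl
      refine ⟨_, hl.1, fun k => F (k + 1), rfl, rfl, hl.2, ?_⟩
      rw [sub_eq_iff_eq_add']
      exact Fin.sum_univ_succ (n := w.length) _

end

namespace LinkDiagram

variable {S : Type*} {τ : S → S} {ρ : Option Resolution} {D E : LinkDiagram}

theorem apply_joined {F : ℕ → ℕ → S} (hF : IsLabeling τ ρ D.word F) {p q : D.Point}
    (h : D.Joined (fun _ => ρ) p q) :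
    F q.1.1 q.1.2 = (if p.1.1 = q.1.1 then τ else id) (F p.1.1 p.1.2) := by
  obtain ⟨k, x, hx, h⟩ := h
  obtain ⟨h1, h2, h3⟩ := hF k x hx
  rcases h with ⟨j, hj, hp, hq⟩ | ⟨j, hp, hq⟩ | ⟨a, ha, hp, hq⟩
  · rw [hp, hq]
    simpa using h1 j hj
  · rw [hp, hq]
    simpa using h2 j
  · have h4 := h3 a ha
    have key : ∀ c : ℕ × ℕ, x.event.HasEnd c →
        x.endLabel (F k) (F (k + 1)) c = F (k + c.1) (x.pos + c.2) := by
      rintro ⟨c, j⟩ (⟨hc, -⟩ | ⟨hc, -⟩) <;> simp only at hc <;> subst hc <;> simp [Layer.endLabel]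
    rw [key _ (Event.arcs_valid ha).1, key _ (Event.arcs_valid ha).2] at h4
    rw [hp, hq]
    simpa using h4

/-- Labels in `Layer.Rel` are functions on all of `ℕ`, so the labels of the actual points are
completed by a constant `c` beyond the width. The shift of indices at a layer is the change of the
width, so the default region is respected. -/
theorem isLabeling_extend (F : ℕ × ℕ → S) (c : S)
    (hF : ∀ p q : D.Point, D.Joined (fun _ => ρ) p q →
      F q.1 = (if p.1.1 = q.1.1 then τ else id) (F p.1)) :
    IsLabeling τ ρ D.word (fun k j => if j < D.width k then F (k, j) else c) := by
  intro k x hx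
  obtain ⟨d, hd, hd'⟩ := fits_singleton.1 (fits_layer hx)
  have hk : k + 1 ≤ D.word.length := (List.getElem?_eq_some_iff.1 hx).1
  refine ⟨fun j hj => ?_, fun j => ?_, fun a ha => ?_⟩
  · have h1 : j < D.width k := by omega
    have h2 : j < D.width (k + 1) := by omega
    simp only
    rw [if_pos h1, if_pos h2]
    simpa using hF ⟨(k, j), by omega, h1⟩ ⟨(k + 1, j), hk, h2⟩
      ⟨k, x, hx, .inl ⟨j, hj, rfl, rfl⟩⟩
  · simp only
    by_cases hj : j < d
    · have h1 : x.pos + x.event.inn + j < D.width k := by omega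
      have h2 : x.pos + x.event.out + j < D.width (k + 1) := by omega
      rw [if_pos h1, if_pos h2]
      simpa using hF ⟨(k, _), by omega, h1⟩ ⟨(k + 1, _), hk, h2⟩
        ⟨k, x, hx, .inr (.inl ⟨j, rfl, rfl⟩)⟩
    · rw [if_neg (by omega), if_neg (by omega)]
  · have key : ∀ e : ℕ × ℕ, x.event.HasEnd e → D.IsPoint (k + e.1, x.pos + e.2) ∧
        x.endLabel (fun j => if j < D.width k then F (k, j) else c)
          (fun j => if j < D.width (k + 1) then F (k + 1, j) else c) e =
          F (k + e.1, x.pos + e.2) := by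
      rintro ⟨e, j⟩ (⟨he, hj⟩ | ⟨he, hj⟩) <;> simp only at he hj <;> subst he
      · have : x.pos + j < D.width k := by omega
        exact ⟨⟨by simp only; omega, this⟩, by simp [Layer.endLabel, this]⟩
      · have : x.pos + j < D.width (k + 1) := by omega
        exact ⟨⟨hk, this⟩, by simp [Layer.endLabel, this]⟩
    obtain ⟨h1, h2⟩ := key _ (Event.arcs_valid ha).1
    obtain ⟨h3, h4⟩ := key _ (Event.arcs_valid ha).2
    rw [h2, h4, hF ⟨_, h1⟩ ⟨_, h3⟩ ⟨k, x, hx, .inr (.inr ⟨a, ha, rfl, rfl⟩)⟩]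
    simp

/-! ### Knots -/

theorem IsKnot.exists_point (hD : D.IsKnot) : Nonempty D.Point := by
  obtain ⟨c, -⟩ := hD.exists
  exact ⟨(Quot.exists_rep c).choose⟩

theorem IsKnot.label_eq (hD : D.IsKnot) {F : ℕ → ℕ → S} (hF : IsLabeling id none D.word F)
    {p q : ℕ × ℕ} (hp : D.IsPoint p) (hq : D.IsPoint q) : F p.1 p.2 = F q.1 q.2 := by
  let φ : D.Circle (fun _ => none) → S := Quot.lift (fun p => F p.1.1 p.1.2) fun p q h => by
    simpa using (apply_joined hF h).symm
  exact congrArg φ ((hD.unique (y₁ := Quot.mk _ ⟨p, hp⟩) (y₂ := Quot.mk _ ⟨q, hq⟩)) trivial trivial)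

/-- The test label is the proposition that a point lies on a given component. The Boolean marks the
indices that are actual strands, as opposed to padding beyond the width. -/
theorem isKnot_of_label_eq (h : Nonempty D.Point)
    (hF : ∀ F : ℕ → ℕ → Prop × Bool, IsLabeling id none D.word F →
      (∀ k j, (F k j).2 = true ↔ j < D.width k) →
      ∀ p q, D.IsPoint p → D.IsPoint q → F p.1 p.2 = F q.1 q.2) : D.IsKnot := by
  obtain ⟨p⟩ := h
  refine ⟨Quot.mk _ p, trivial, fun c _ => ?_⟩
  obtain ⟨q, rfl⟩ := Quot.exists_rep c
  let φ : ℕ × ℕ → Prop × Bool := fun s =>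
    (∃ h : D.IsPoint s, (Quot.mk _ ⟨s, h⟩ : D.Circle (fun _ => none)) = Quot.mk _ p, true)
  have hφ : ∀ p q : D.Point, D.Joined (fun _ => none) p q →
      φ q.1 = (if p.1.1 = q.1.1 then id else id) (φ p.1) := by
    intro s t hst
    have h : (Quot.mk _ s : D.Circle (fun _ => none)) = Quot.mk _ t := Quot.sound hst
    simp only [φ, ite_self, id, s.2, t.2, exists_true_left, Subtype.coe_eta, h]
  have := hF _ (isLabeling_extend φ (False, false) hφ) (fun k j => by
    by_cases hj : j < D.width k <;> simp [hj, φ]) p.1 q.1 p.2 q.2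
  simp only [p.2.2, q.2.2, if_true, φ, p.2, q.2, exists_true_left, Prod.mk.eta, Subtype.coe_eta,
    Prod.mk.injEq, and_true] at this
  exact this.mp trivial

end LinkDiagram

/-! ### Components when a subword is replaced -/

/-- A rule for labels that are constant along the strands. -/
def constRule (S : Type*) : LabelRule S where
  τ := id
  τ_τ _ := rfl
  weight _ _ _ := 0
  scale := 0
  weight_kink _ _ := by simp
  weight_slide_left _ _ _ := rfl
  weight_slide_right _ _ _ := rfl
  weight_not _ _ _ := by simp

theorem run_constRule_iff {S : Type*} {w : List Layer} {f g : ℕ → S} :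
    Run (constRule S) w f g 0 ↔ ∃ F, F 0 = f ∧ F w.length = g ∧ IsLabeling id none w F := by
  rw [run_iff_exists_isLabeling]
  have : ∀ F : ℕ → ℕ → S,
      ∑ k : Fin w.length, (w.get k).weight (constRule S).weight (F k) = 0 := by
    refine fun F => Finset.sum_eq_zero fun k _ => ?_
    simp only [Layer.weight, constRule]
    split <;> rfl
  simp only [this, and_true]
  rfl

/-- In the word `w`, every strand reaches the bottom or the top. -/
def NoClosedStrand (w : List Layer) : Prop :=
  ∀ (S : Type) (F : ℕ → ℕ → S), IsLabeling id none w F → ∀ k ≤ w.length, ∀ j,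
    ∃ i, F k j = F 0 i ∨ F k j = F w.length i

/-- A labeling of `D` is turned into one of `E` by relabeling only the replaced part, with the same
boundary labels. Every label in `D` also occurs in `E`, because no strand of `l` is closed, and in
the knot `E` all labels are equal. -/
theorem LinkDiagram.isKnot_of_replace {D E : LinkDiagram} {u v l r : List Layer} {n m : ℕ}
    (hD : D.word = u ++ l ++ v) (hE : E.word = u ++ r ++ v) (hu : Fits 0 u n) (hl : Fits n l m)
    (hr : Fits n r m) (hp : Nonempty D.Point)
    (hlr : ∀ f g : ℕ → Prop × Bool, Run (constRule _) l f g 0 → Run (constRule _) r f g 0)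
    (hc : NoClosedStrand l) (hK : E.IsKnot) : D.IsKnot := by
  refine isKnot_of_label_eq hp fun F hF hF2 => ?_
  rw [hD, isLabeling_append_iff, isLabeling_append_iff] at hF
  obtain ⟨⟨hFu, hFl⟩, hFv⟩ := hF
  obtain ⟨G, hG0, hG1, hG⟩ := run_constRule_iff.1 (hlr _ _ (run_constRule_iff.2 ⟨_, rfl, rfl, hFl⟩))
  have h0 : F u.length = G 0 := by rw [hG0, add_zero]
  have hlen : ∀ w : List Layer, (u ++ w).length = u.length + w.length := fun w => by simp
  have h1 : glue u.length F G (u ++ r).length = F ((u ++ l).length + 0) := by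
    rw [hlen, hlen, glue_add h0, hG1, add_zero]
  have hH := (hFu.append hG h0).append hFv h1
  rw [← hE] at hH
  set H := glue (u ++ r).length (glue u.length F G) fun k => F ((u ++ l).length + k) with hHdef
  have below : ∀ k ≤ u.length, ∀ j < D.width k, ∃ q, E.IsPoint q ∧ F k j = H q.1 q.2 := by
    intro k hk j hj
    refine ⟨(k, j), ⟨?_, ?_⟩, ?_⟩
    · rw [hE]; simp only [List.length_append]; omega
    · rw [LinkDiagram.width, hD, List.append_assoc, List.take_append_of_le_length hk] at hj
      rwa [LinkDiagram.width, hE, List.append_assoc, List.take_append_of_le_length hk]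
    · simp only [hHdef]
      rw [glue_of_le (by simp; omega), glue_of_le hk]
  have above : ∀ k ≤ v.length, ∀ j < D.width ((u ++ l).length + k),
      ∃ q, E.IsPoint q ∧ F ((u ++ l).length + k) j = H q.1 q.2 := by
    intro k hk j hj
    refine ⟨((u ++ r).length + k, j), ⟨?_, ?_⟩, ?_⟩
    · rw [hE, List.length_append (bs := v)]; simp only; omega
    · rw [LinkDiagram.width, hD, List.take_length_add_append, List.foldl_append,
        (hu.append hl).foldl_above] at hj
      rwa [LinkDiagram.width, hE, List.take_length_add_append, List.foldl_append,
        (hu.append hr).foldl_above]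
    · simp only [hHdef]
      rw [glue_add h1]
  have all : ∀ p, D.IsPoint p → ∃ q, E.IsPoint q ∧ F p.1 p.2 = H q.1 q.2 := by
    rintro ⟨k, j⟩ ⟨hk, hj⟩
    simp only at hk hj ⊢
    rw [hD] at hk
    simp only [List.length_append] at hk
    rcases le_or_gt k u.length with h | h
    · exact below k h j hj
    rcases le_or_gt (u ++ l).length k with h' | h'
    · obtain ⟨c, rfl⟩ := Nat.exists_eq_add_of_le h'
      exact above c (by simp only [List.length_append] at hk; omega) j hj
    obtain ⟨c, rfl⟩ := Nat.exists_eq_add_of_le h.le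
    -- The strand end found by `hc` could be padding; its Boolean component agrees with that of the
    -- given point, so it is an actual strand.
    obtain ⟨i, hi | hi⟩ := hc _ _ hFl c (by simp only [List.length_append] at h'; omega) j
    · simp only [add_zero] at hi
      rw [hi]
      exact below _ le_rfl i ((hF2 _ _).1 (hi ▸ (hF2 _ _).2 hj))
    · simp only [← hlen] at hi
      rw [hi]
      exact above 0 (Nat.zero_le _) i ((hF2 _ _).1 (hi ▸ (hF2 _ _).2 hj))
  intro p q hp hq
  obtain ⟨p', hp', h2⟩ := all p hp
  obtain ⟨q', hq', h3⟩ := all q hq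
  rw [h2, h3]
  exact hK.label_eq hH hp' hq'

/-! ### Invariance of knots and of the writhe -/

section

variable {S : Type*} {f g : ℕ → S} {i j : ℕ} {b : Bool}

theorem exists_eq_of_rel {x : Layer} (h : x.Rel id none f g) :
    (∃ k, g j = f k) ∨ ∃ i, x = cup i ∧ (j = i ∨ j = i + 1) := by
  obtain ⟨e, i⟩ := x
  cases e with
  | cup =>
    obtain ⟨a, rfl⟩ := rel_cup.1 h
    by_cases hj : j = i ∨ j = i + 1
    · exact .inr ⟨i, rfl, hj⟩
    · rcases lt_or_ge j i with h | h
      · exact .inl ⟨j, insertPair_of_lt h⟩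
      · exact .inl ⟨j - 2, by grind [insertPair]⟩
  | cap =>
    obtain ⟨a, rfl⟩ := rel_cap.1 h
    rcases lt_or_ge j i with h | h
    · exact .inl ⟨j, (insertPair_of_lt h).symm⟩
    · exact .inl ⟨j + 2, (insertPair_add h).symm⟩
  | cross b =>
    obtain rfl := rel_cross.1 h
    refine .inl ?_
    simp only [swapPair]
    split_ifs <;> exact ⟨_, rfl⟩

theorem exists_eq_of_rel_symm {x : Layer} (h : x.Rel id none f g) :
    (∃ k, f j = g k) ∨ ∃ i, x = cap i ∧ (j = i ∨ j = i + 1) := by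
  obtain ⟨e, i⟩ := x
  cases e with
  | cap =>
    obtain ⟨a, rfl⟩ := rel_cap.1 h
    by_cases hj : j = i ∨ j = i + 1
    · exact .inr ⟨i, rfl, hj⟩
    · rcases lt_or_ge j i with h | h
      · exact .inl ⟨j, insertPair_of_lt h⟩
      · exact .inl ⟨j - 2, by grind [insertPair]⟩
  | cup =>
    obtain ⟨a, rfl⟩ := rel_cup.1 h
    rcases lt_or_ge j i with h | h
    · exact .inl ⟨j, (insertPair_of_lt h).symm⟩
    · exact .inl ⟨j + 2, (insertPair_add h).symm⟩
  | cross b =>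
    rw [rel_cross, eq_comm, swapPair_eq_iff] at h
    rw [h]
    refine .inl ?_
    simp only [swapPair]
    split_ifs <;> exact ⟨_, rfl⟩

end

theorem noClosedStrand_nil : NoClosedStrand [] := fun S F _ k hk j =>
  ⟨j, .inl (by rw [Nat.le_zero.1 hk])⟩

theorem noClosedStrand_singleton (x : Layer) : NoClosedStrand [x] := by
  intro S F _ k hk j
  obtain rfl | rfl : k = 0 ∨ k = 1 := by simp only [List.length_singleton] at hk; omega
  · exact ⟨j, .inl rfl⟩
  · exact ⟨j, .inr rfl⟩

/-- Two layers close a circle only as a minimum capped off at its own position. With overlapping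
positions one end of the minimum escapes to the top. -/
theorem noClosedStrand_pair {x y : Layer} (h : ∀ i, x = cup i → y ≠ cap i) :
    NoClosedStrand [x, y] := by
  intro S F hF k hk j
  obtain rfl | rfl | rfl : k = 0 ∨ k = 1 ∨ k = 2 := by
    simp only [List.length_cons, List.length_nil] at hk; omega
  · exact ⟨j, .inl rfl⟩
  · have h1 := hF 0 x rfl
    have h2 := hF 1 y rfl
    rw [zero_add] at h1
    obtain ⟨c, hc⟩ | ⟨i, rfl, hi⟩ := exists_eq_of_rel (j := j) h1
    · exact ⟨c, .inl hc⟩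
    obtain ⟨c, hc⟩ | ⟨i', rfl, hi'⟩ := exists_eq_of_rel_symm (j := j) h2
    · exact ⟨c, .inr hc⟩
    have hne : i ≠ i' := fun hii => h i rfl (hii ▸ rfl)
    obtain ⟨a, ha⟩ := rel_cup.1 h1
    obtain ⟨a', ha'⟩ := rel_cap.1 h2
    have h3 : F 1 i = F 1 (i + 1) := by rw [ha, insertPair_self, insertPair_succ]; rfl
    rcases hi with rfl | rfl
    · obtain rfl : j = i' + 1 := by omega
      exact ⟨i', .inr (by rw [h3, ha']; exact insertPair_add le_rfl)⟩
    · obtain rfl : i' = i + 1 := by omega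
      exact ⟨i, .inr (by rw [← h3, ha']; exact insertPair_of_lt (Nat.lt_succ_self i))⟩
  · exact ⟨j, .inr rfl⟩

theorem noClosedStrand_crossings (a b c : Bool) (i j k : ℕ) :
    NoClosedStrand [cross a i, cross b j, cross c k] := by
  intro S F hF s hs t
  have h1 := fun t => (exists_eq_of_rel (j := t) (hF 0 _ rfl)).resolve_right (by simp)
  have h2 := fun t => (exists_eq_of_rel (j := t) (hF 1 _ rfl)).resolve_right (by simp)
  obtain rfl | rfl | rfl | rfl : s = 0 ∨ s = 1 ∨ s = 2 ∨ s = 3 := by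
    simp only [List.length_cons, List.length_nil] at hs; omega
  · exact ⟨t, .inl rfl⟩
  · obtain ⟨c, hc⟩ := h1 t
    exact ⟨c, .inl hc⟩
  · obtain ⟨c, hc⟩ := h2 t
    obtain ⟨d, hd⟩ := h1 c
    exact ⟨d, .inl (hc.trans hd)⟩
  · exact ⟨t, .inr rfl⟩

theorem Move.noClosedStrand {l r : List Layer} (h : Move l r) :
    NoClosedStrand l ∧ NoClosedStrand r := by
  cases h with
  | exchange e f i d =>
    constructor <;> refine noClosedStrand_pair ?_ <;> rintro i h1 h2 <;>
      simp only [cup, cap, Layer.mk.injEq] at h1 h2 <;> obtain ⟨rfl, rfl⟩ := h1 <;>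
      obtain ⟨rfl, h2⟩ := h2 <;> simp only [Event.inn, Event.out] at h2 <;> omega
  | zigzag i => exact ⟨noClosedStrand_pair (by simp), noClosedStrand_nil⟩
  | zagzig i => exact ⟨noClosedStrand_pair (by simp), noClosedStrand_nil⟩
  | slide_cap b i => exact ⟨noClosedStrand_pair (by simp), noClosedStrand_pair (by simp)⟩
  | slide_cup b i => exact ⟨noClosedStrand_pair (by simp), noClosedStrand_pair (by simp)⟩
  | reidemeister_one_cap b i => exact ⟨noClosedStrand_pair (by simp), noClosedStrand_singleton _⟩
  | reidemeister_one_cup b i => exact ⟨noClosedStrand_pair (by simp), noClosedStrand_singleton _⟩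
  | reidemeister_two b i => exact ⟨noClosedStrand_pair (by simp), noClosedStrand_nil⟩
  | reidemeister_three a b c i h => exact
    ⟨noClosedStrand_crossings _ _ _ _ _ _, noClosedStrand_crossings _ _ _ _ _ _⟩

theorem isKnot_iff_of_move {D E : LinkDiagram} {u v l r : List Layer} {d : ℤ}
    (h : MoveFraming l r d) (hD : D.word = u ++ l ++ v) (hE : E.word = u ++ r ++ v) :
    D.IsKnot ↔ E.IsKnot := by
  obtain ⟨p, q, -⟩ := exists_clasped_wordEquiv_of_move h hD hE
  obtain ⟨n, hun, hn⟩ := fits_append.1 (show Fits 0 (u ++ (l ++ v)) 0 by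
    rw [← List.append_assoc, ← hD]; exact D.fits)
  obtain ⟨m, hl, -⟩ := fits_append.1 hn
  have hr := h.move.fits hl
  have hiff : ∀ f g : ℕ → Prop × Bool,
      Run (constRule _) l f g 0 ↔ Run (constRule _) r f g 0 := fun f g => by
    rw [h.run_iff]
    simp [constRule]
  exact ⟨LinkDiagram.isKnot_of_replace hE hD hun hr hl ⟨q⟩ (fun f g => (hiff f g).2)
      h.move.noClosedStrand.2,
    LinkDiagram.isKnot_of_replace hD hE hun hl hr ⟨p⟩ (fun f g => (hiff f g).1)
      h.move.noClosedStrand.1⟩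

/-! ### Orientations and the writhe -/

/-- The rule for orientations. -/
def orientationRule : LabelRule Bool where
  τ := not
  τ_τ := Bool.not_not
  weight := crossingSign
  scale := 1
  weight_kink := by decide
  weight_slide_left := by decide
  weight_slide_right := by decide
  weight_not := by decide

theorem layerSign_eq_weight {o : ℕ × ℕ → Bool} {k : ℕ} {x : Layer} {f : ℕ → Bool}
    (h : ∀ j < x.event.inn, f (x.pos + j) = o (k, x.pos + j)) :
    layerSign o k x = x.weight crossingSign f := by
  obtain ⟨e, i⟩ := x
  cases e with
  | cross b =>
    have h0 := h 0 (by simp [Event.inn])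
    have h1 := h 1 (by simp [Event.inn])
    simp only [add_zero] at h0
    simp only [Layer.weight, layerSign, h0, h1]
  | _ => rfl

theorem LinkDiagram.hasWrithe_iff_run {D : LinkDiagram} {w : ℤ} :
    D.HasWrithe w ↔ ∃ f g, Run orientationRule D.word f g w := by
  simp only [run_iff_exists_isLabeling]
  constructor
  · rintro ⟨o, ho, rfl⟩
    have h := isLabeling_extend (D := D) (ρ := none) (τ := not) o true fun p q hpq => by
      have := ho p q hpq
      split_ifs with h
      · simp only [h, ne_eq, not_true, iff_false] at this
        cases ho : o q.1 <;> cases ho' : o p.1 <;> simp_all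
      · exact (this.2 h).symm
    refine ⟨_, _, _, rfl, rfl, h, Finset.sum_congr rfl fun k _ => layerSign_eq_weight ?_⟩
    intro j hj
    have hk := D.fits_layer (List.getElem?_eq_getElem k.2)
    have := hk.1
    rw [if_pos]
    change _ + D.word[k.1].event.inn ≤ _ at this
    simp only [List.get_eq_getElem] at hj ⊢
    omega
  · rintro ⟨_, _, F, -, -, hF, rfl⟩
    refine ⟨fun p => F p.1 p.2, fun p q hpq => ?_, ?_⟩
    · have := apply_joined hF hpq
      simp only [this]
      change _ = (if _ then not else id) _ ↔ _
      split_ifs with h <;> simp [h]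
    · exact Finset.sum_congr rfl fun k _ => (layerSign_eq_weight fun _ _ => rfl).symm

theorem hasWrithe_iff_of_move {D E : LinkDiagram} {u v l r : List Layer} {d : ℤ}
    (h : MoveFraming l r d) (hD : D.word = u ++ l ++ v) (hE : E.word = u ++ r ++ v) (w : ℤ) :
    D.HasWrithe w ↔ E.HasWrithe (w - d) := by
  rw [LinkDiagram.hasWrithe_iff_run, LinkDiagram.hasWrithe_iff_run, hD, hE]
  refine exists_congr fun f => exists_congr fun g => ?_
  simp only [run_append]
  constructor
  · rintro ⟨s, y, ⟨t, y', h1, h2⟩, h3⟩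
    refine ⟨s, y - d, ⟨t, y', h1, ?_⟩, by rwa [show w - d - (y - d) = w - y by ring]⟩
    rw [h.run_iff] at h2
    convert h2 using 1
    simp only [orientationRule]
    ring
  · rintro ⟨s, y, ⟨t, y', h1, h2⟩, h3⟩
    refine ⟨s, y + d, ⟨t, y', h1, ?_⟩, by rwa [show w - (y + d) = w - d - y by ring]⟩
    rw [h.run_iff]
    convert h2 using 1
    simp only [orientationRule]
    ring

/-- The `xor` of two orientations is constant along strands, hence constant on a knot: they agree
everywhere or are opposite everywhere. The sign of a crossing does not change when both directions
are reversed. -/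
theorem LinkDiagram.IsKnot.writhe_unique {D : LinkDiagram} (hD : D.IsKnot) {w w' : ℤ}
    (h : D.HasWrithe w) (h' : D.HasWrithe w') : w = w' := by
  rw [hasWrithe_iff_run] at h h'
  simp only [run_iff_exists_isLabeling] at h h'
  obtain ⟨_, _, F, -, -, hF, rfl⟩ := h
  obtain ⟨_, _, F', -, -, hF', rfl⟩ := h'
  have hx := isLabeling_extend (D := D) (ρ := none) (τ := id)
      (fun p => xor (F p.1 p.2) (F' p.1 p.2)) true fun p q hpq => by
    simp only [apply_joined hF hpq, apply_joined hF' hpq]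
    split_ifs <;> simp [orientationRule]
  refine Finset.sum_congr rfl fun k _ => ?_
  have hk := (D.fits_layer (List.getElem?_eq_getElem k.2)).1
  obtain ⟨⟨e, i⟩, hx'⟩ : ∃ x, x = D.word.get k := ⟨_, rfl⟩
  change (D.word.get k).pos + (D.word.get k).event.inn ≤ D.width k at hk
  rw [← hx'] at hk ⊢
  cases e with
  | cross b =>
    simp only [Event.inn] at hk
    have h1 := hD.label_eq hx (p := (k, i)) (q := (k, i + 1)) ⟨k.2.le, by simp only; omega⟩
      ⟨k.2.le, by simp only; omega⟩
    simp only at h1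
    rw [if_pos (by omega), if_pos (by omega)] at h1
    simp only [Layer.weight, orientationRule]
    revert h1
    cases F k i <;> cases F k (i + 1) <;> cases F' k i <;> cases F' k (i + 1) <;> cases b <;> decide
  | _ => rfl

/-- Equivalent diagrams have equivalent twisted doubles, where the number of full twists makes up for
the difference of the writhes. -/
theorem LinkDiagram.Equivalent.clasped {D E : LinkDiagram} (h : D.Equivalent E) :
    (D.IsKnot ↔ E.IsKnot) ∧ ∃ d : ℤ, (∀ w, D.HasWrithe w ↔ E.HasWrithe (w - d)) ∧
      (D.IsKnot → ∀ (p : D.Point) (q : E.Point) (z : ℤ),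
        WordEquiv 0 0 (D.clasped p.1 z) (E.clasped q.1 (z + d))) := by
  induction h with
  | rel D E h =>
    obtain ⟨u, v, l, r, h, hD, hE⟩ := h
    obtain ⟨d, h⟩ := h.exists_framing
    have hiff := isKnot_iff_of_move h hD hE
    obtain ⟨p, q, hpq⟩ := exists_clasped_wordEquiv_of_move h hD hE
    refine ⟨hiff, d, hasWrithe_iff_of_move h hD hE, fun hK p' q' z => ?_⟩
    exact (hK.clasped_wordEquiv p' p z).trans
      ((hpq z).trans ((hiff.1 hK).clasped_wordEquiv q q' _))
  | refl D =>
    exact ⟨Iff.rfl, 0, by simp, fun hK p q z => by simpa using hK.clasped_wordEquiv p q z⟩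
  | symm D E _ ih =>
    obtain ⟨h1, d, h2, h3⟩ := ih
    refine ⟨h1.symm, -d, fun w => by rw [h2]; simp, fun hK p q z => ?_⟩
    simpa [sub_eq_add_neg] using (h3 (h1.2 hK) q p (z - d)).symm
  | trans D E F _ _ ih ih' =>
    obtain ⟨h1, d, h2, h3⟩ := ih
    obtain ⟨h1', d', h2', h3'⟩ := ih'
    refine ⟨h1.trans h1', d + d', fun w => by rw [h2, h2', sub_sub], fun hK p q z => ?_⟩
    -- The middle diagram is a knot diagram, so it offers a point for the clasp on the way.
    obtain ⟨s⟩ := (h1.1 hK).exists_point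
    rw [← add_assoc]
    exact (h3 hK p s z).trans (h3' (h1.1 hK) s q _)

/-! ### Adequate labelings -/

/-- The labels are constant along the arcs of the `B`-resolution of a layer, and they differ at the
two ends of the segment of a crossing. -/
def Layer.AdequateRel {S : Type*} (x : Layer) (f g : ℕ → S) : Prop :=
  x.Rel id (some .B) f g ∧ ∀ b i, x = cross b i → f i ≠ g (i + 1)

/-- The state circles of the all-`B` state of a word have labels such that the ends of the segments
have different labels. -/
def AdequateRun {S : Type*} : List Layer → (ℕ → S) → (ℕ → S) → Prop
  | [], f, g => f = g
  | x :: w, f, g => ∃ h, x.AdequateRel f h ∧ AdequateRun w h g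

section

variable {S : Type*} {f g : ℕ → S} {i : ℕ}

theorem AdequateRun.append {u v : List Layer} {h : ℕ → S} (hu : AdequateRun u f h)
    (hv : AdequateRun v h g) : AdequateRun (u ++ v) f g := by
  induction u generalizing f with
  | nil => cases hu; exact hv
  | cons x u ih =>
    obtain ⟨s, h1, h2⟩ := hu
    exact ⟨s, h1, ih h2⟩

theorem adequateRun_append {u v : List Layer} :
    AdequateRun (u ++ v) f g ↔ ∃ h, AdequateRun u f h ∧ AdequateRun v h g := by
  constructor
  · intro h
    induction u generalizing f with
    | nil => exact ⟨f, rfl, h⟩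
    | cons x u ih =>
      obtain ⟨s, h1, h2⟩ := h
      obtain ⟨t, h3, h4⟩ := ih h2
      exact ⟨t, ⟨s, h1, h3⟩, h4⟩
  · rintro ⟨h, hu, hv⟩
    exact hu.append hv

/-- Applied to `some`, this frees the label `none` for a new state circle. -/
theorem AdequateRun.map {S' : Type*} {φ : S → S'} (hφ : Function.Injective φ) {w : List Layer}
    (h : AdequateRun w f g) : AdequateRun w (φ ∘ f) (φ ∘ g) := by
  induction w generalizing f with
  | nil => cases h; rfl
  | cons x w ih =>
    obtain ⟨s, ⟨⟨h1, h2, h3⟩, h4⟩, h5⟩ := h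
    refine ⟨φ ∘ s, ⟨⟨fun j hj => congrArg φ (h1 j hj), fun j => congrArg φ (h2 j), fun a ha => ?_⟩,
      fun b i hx => hφ.ne (h4 b i hx)⟩, ih h5⟩
    have key : ∀ c, x.endLabel (φ ∘ f) (φ ∘ s) c = φ (x.endLabel f s c) := fun c => by
      simp only [Layer.endLabel]
      split_ifs <;> rfl
    have h6 := h3 a ha
    rw [ite_self] at h6 ⊢
    rw [key, key, h6]
    rfl

theorem adequateRun_iff_exists_isLabeling {w : List Layer} :
    AdequateRun w f g ↔ ∃ F, F 0 = f ∧ F w.length = g ∧ IsLabeling id (some .B) w F ∧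
      ∀ k b i, w[k]? = some (cross b i) → F k i ≠ F (k + 1) (i + 1) := by
  induction w generalizing f with
  | nil =>
    constructor
    · rintro rfl
      exact ⟨fun _ => f, rfl, rfl, isLabeling_nil, by simp⟩
    · rintro ⟨F, rfl, rfl, -⟩
      rfl
  | cons x w ih =>
    simp only [AdequateRun, ih]
    constructor
    · rintro ⟨h, ⟨hx, hx'⟩, F, hF, hg, hl, hs⟩
      refine ⟨fun k => Nat.casesOn k f F, rfl, hg, isLabeling_cons_iff.2 ⟨?_, hl⟩, ?_⟩
      · change x.Rel id _ f (F 0)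
        rwa [hF]
      · rintro (_ | k) b i hk
        · change f i ≠ F 0 (i + 1)
          rw [hF]
          exact hx' b i (by simpa using hk)
        · exact hs k b i hk
    · rintro ⟨F, rfl, rfl, hl, hs⟩
      rw [isLabeling_cons_iff] at hl
      exact ⟨_, ⟨hl.1, fun b i hx => hs 0 b i (by simp [hx])⟩, fun k => F (k + 1), rfl, rfl, hl.2,
        fun k b i hk => hs (k + 1) b i hk⟩

end

/-- If there is no loop, the state circles themselves serve as labels. Conversely, a loop would
force equal labels at the two ends of a segment. This makes adequacy a layer-by-layer condition. -/
theorem LinkDiagram.bAdequate_iff {D : LinkDiagram} :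
    D.BAdequate ↔ ∃ (S : Type) (f g : ℕ → S), AdequateRun D.word f g := by
  simp only [adequateRun_iff_exists_isLabeling]
  constructor
  · intro h
    let φ : ℕ × ℕ → Option (D.StateCircle fun _ => .B) := fun p =>
      open Classical in if hp : D.IsPoint p then some (Quot.mk _ ⟨p, hp⟩) else none
    have hφ : ∀ p : D.Point, φ p.1 = some (Quot.mk _ p) := fun p => dif_pos p.2
    refine ⟨_, _, _, _, rfl, rfl, isLabeling_extend (D := D) φ none fun p q hpq => ?_, ?_⟩
    · rw [ite_self, hφ, hφ]
      exact congrArg some (Quot.sound hpq).symm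
    · intro k b i hk heq
      obtain ⟨d, hd, hd'⟩ := fits_singleton.1 (D.fits_layer hk)
      have hlen : k + 1 ≤ D.word.length := (List.getElem?_eq_some_iff.1 hk).1
      simp only [Event.inn, Event.out] at hd hd'
      rw [if_pos (by omega), if_pos (by omega)] at heq
      have h1 : D.IsPoint (k, i) := ⟨by simp only; omega, by simp only; omega⟩
      have h2 : D.IsPoint (k + 1, i + 1) := ⟨hlen, by simp only; omega⟩
      rw [hφ ⟨_, h1⟩, hφ ⟨_, h2⟩, Option.some.injEq] at heq
      exact h k (Quot.mk _ ⟨_, h1⟩) ⟨b, i, ⟨_, h1⟩, ⟨_, h2⟩, hk, rfl, rfl, .inl ⟨rfl, heq⟩⟩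
  · rintro ⟨S, -, -, F, -, -, hF, hs⟩ k c ⟨b, i, p, q, hk, hp, hq, h⟩
    have hpq : (Quot.mk _ p : D.StateCircle fun _ => .B) = Quot.mk _ q := by
      rcases h with ⟨h1, h2⟩ | ⟨h1, h2⟩
      · exact h1.symm.trans h2
      · exact h2.symm.trans h1
    refine hs k b i hk ?_
    have := congrArg (Quot.lift (fun p : D.Point => F p.1.1 p.1.2) fun p q h => by
      simpa using (apply_joined hF h).symm) hpq
    simpa [hp, hq] using this

section

variable {S : Type*} {f g : ℕ → S} {i : ℕ}

/-- The labels of the strands `i`, `i + 1` are replaced by `a`. -/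
def setPair (i : ℕ) (a : S) (f : ℕ → S) (j : ℕ) : S := if j = i ∨ j = i + 1 then a else f j

theorem adequateRel_cup (a : S) : (cup i).AdequateRel f (insertPair id i a f) :=
  ⟨rel_cup.2 ⟨a, rfl⟩, by simp⟩

theorem adequateRel_cap (a : S) : (cap i).AdequateRel (insertPair id i a f) f :=
  ⟨rel_cap.2 ⟨a, rfl⟩, by simp⟩

theorem adequateRel_cross_false : (cross false i).AdequateRel f g ↔ g = f ∧ f i ≠ f (i + 1) := by
  simp only [Layer.AdequateRel, Layer.Rel, Event.arcs, verticalArcs, Layer.endLabel, Event.inn,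
    Event.out, List.mem_cons, List.not_mem_nil, or_false, forall_eq_or_imp, forall_eq, ite_self, id,
    one_ne_zero, if_true, if_false, add_zero]
  constructor
  · rintro ⟨⟨h1, h2, h3, h4⟩, h5⟩
    obtain rfl : g = f := by
      funext j
      rcases lt_or_ge j i with h | h
      · exact h1 j h
      obtain ⟨c, rfl⟩ := Nat.exists_eq_add_of_le h
      rcases c with _ | _ | c
      · exact h3
      · exact h4
      · have := h2 c
        rwa [show i + 2 + c = i + (c + 1 + 1) by ring] at this
    exact ⟨rfl, h5 _ _ rfl⟩
  · rintro ⟨rfl, h⟩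
    exact ⟨⟨fun _ _ => rfl, fun _ => rfl, rfl, rfl⟩, by rintro b _ ⟨rfl, rfl⟩; exact h⟩

theorem adequateRel_cross_true : (cross true i).AdequateRel f g ↔
    f (i + 1) = f i ∧ g = setPair i (g i) f ∧ f i ≠ g i := by
  simp only [Layer.AdequateRel, Layer.Rel, Event.arcs, horizontalArcs, Layer.endLabel, Event.inn,
    Event.out, List.mem_cons, List.not_mem_nil, or_false, forall_eq_or_imp, forall_eq, ite_self, id,
    one_ne_zero, if_true, if_false, add_zero]
  constructor
  · rintro ⟨⟨h1, h2, h3, h4⟩, h5⟩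
    refine ⟨h3, funext fun j => ?_, h4 ▸ h5 _ _ rfl⟩
    simp only [setPair]
    split_ifs with h
    · rcases h with rfl | rfl
      · rfl
      · exact h4
    · rcases lt_or_ge j i with h' | h'
      · exact h1 j h'
      · obtain ⟨c, rfl⟩ := Nat.exists_eq_add_of_le (show i + 2 ≤ j by omega)
        exact h2 c
  · rintro ⟨h1, h2, h3⟩
    have h4 : g (i + 1) = g i := by
      rw [h2]
      simp [setPair]
    refine ⟨⟨fun j hj => ?_, fun j => ?_, h1, h4⟩, by rintro b _ ⟨rfl, rfl⟩; rwa [h4]⟩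
    · rw [h2, setPair, if_neg (by omega)]
    · rw [h2, setPair, if_neg (by omega)]

theorem adequateRel_setPair {a : S} (h : f (i + 1) = f i) (ha : f i ≠ a) :
    (cross true i).AdequateRel f (setPair i a f) := by
  have : setPair i a f i = a := by simp [setPair]
  exact adequateRel_cross_true.2 ⟨h, by rw [this], by rwa [this]⟩

/-- The clasp adds a state circle. -/
theorem adequateRun_negativeClasp (f : ℕ → S) (i : ℕ) :
    AdequateRun (negativeClasp i) (some ∘ f) (some ∘ f) := by
  -- The vertical resolutions close the minimum and the maximum of the clasp to a circle, labeled
  -- `none`; its two neighbours carry labels `some _`.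
  refine ⟨_, adequateRel_cup none, _, adequateRel_cross_false.2 ⟨rfl, ?_⟩, _,
    adequateRel_cross_false.2 ⟨rfl, ?_⟩, _, adequateRel_cap none, rfl⟩
  · simp [insertPair]
  · simp [insertPair]

/-- A negative kink adds a state circle. -/
theorem adequateRun_kink (f : ℕ → S) (j : ℕ) :
    AdequateRun [cup (j + 1), cross true (j + 1), cap j] (some ∘ f) (some ∘ f) := by
  -- The horizontal resolution closes the minimum below to a circle labeled `none`; the arc above
  -- the crossing continues the old strand `j` and takes its label.
  refine ⟨_, adequateRel_cup none, _, adequateRel_setPair (a := some (f j)) ?_ ?_, _,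
    ?_, rfl⟩
  · simp [insertPair]
  · simp [insertPair]
  · convert adequateRel_cap (i := j) (f := some ∘ f) (some (f j)) using 1
    funext k
    grind [setPair, insertPair]

/-! ### The state circles of the blackboard parallel -/

/-- The labels of the two parallel copies of strands with the labels `f`. The two copies of a state
circle are told apart by their position, which alternates from a strand to the next one. -/
def doubleLabel (f : ℕ → S) (n : ℕ) : S × ℕ := (f (n / 2), (n + n / 2) % 2)

theorem doubleLabel_even (f : ℕ → S) (j : ℕ) : doubleLabel f (2 * j) = (f j, j % 2) := by
  simp only [doubleLabel, Prod.mk.injEq]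
  exact ⟨by congr 1; omega, by omega⟩

theorem doubleLabel_odd (f : ℕ → S) (j : ℕ) : doubleLabel f (2 * j + 1) = (f j, (j + 1) % 2) := by
  simp only [doubleLabel, Prod.mk.injEq]
  exact ⟨by congr 1; omega, by omega⟩

/-- The parity of the number of strands to the left is a checkerboard colouring of the regions, and
the second component records on which colour a copy lies. With this convention the outer pair of
ends at a turn matches, and so does the inner pair. -/
theorem doubleLabel_insertPair (a : S) : doubleLabel (insertPair id i a f) =
    insertPair id (2 * i + 1) (a, (i + 1) % 2) (insertPair id (2 * i) (a, i % 2) (doubleLabel f)) := by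
  funext n
  obtain ⟨j, rfl | rfl⟩ := n.even_or_odd'
  · rw [doubleLabel_even]
    rcases lt_or_ge j i with h | h
    · rw [insertPair_of_lt h, insertPair_of_lt (by omega), insertPair_of_lt (by omega),
        doubleLabel_even]
    obtain ⟨c, rfl⟩ := Nat.exists_eq_add_of_le h
    rcases c with _ | _ | c
    · simp [insertPair]
    · rw [zero_add, insertPair_succ, show 2 * (i + 1) = 2 * i + 1 + 1 by ring, insertPair_succ]
      rfl
    · rw [show i + (c + 1 + 1) = i + c + 2 by ring, insertPair_add (by omega),
        show 2 * (i + c + 2) = 2 * (i + c) + 2 + 2 by ring, insertPair_add (by omega),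
        insertPair_add (by omega), doubleLabel_even]
      simp
  · rw [doubleLabel_odd]
    rcases lt_or_ge j i with h | h
    · rw [insertPair_of_lt h, insertPair_of_lt (by omega), insertPair_of_lt (by omega),
        doubleLabel_odd]
    obtain ⟨c, rfl⟩ := Nat.exists_eq_add_of_le h
    rcases c with _ | _ | c
    · simp [insertPair]
    · rw [zero_add, insertPair_succ, show 2 * (i + 1) + 1 = 2 * i + 1 + 2 by ring,
        insertPair_add le_rfl, insertPair_succ]
      simp only [id, Prod.mk.injEq, true_and]
      omega
    · rw [show i + (c + 1 + 1) = i + c + 2 by ring, insertPair_add (by omega),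
        show 2 * (i + c + 2) + 1 = 2 * (i + c) + 1 + 2 + 2 by ring, insertPair_add (by omega),
        insertPair_add (by omega), doubleLabel_odd]
      simp only [Prod.mk.injEq, true_and]
      omega

/-- The two copies of a circle differ in the second component, and copies of circles that were
adjacent differ in the first; each of the four new crossings is of one of these kinds. -/
theorem Layer.AdequateRel.double {x : Layer} (h : x.AdequateRel f g) :
    AdequateRun x.double (doubleLabel f) (doubleLabel g) := by
  obtain ⟨e, i⟩ := x
  cases e with
  | cup =>
    obtain ⟨a, rfl⟩ := rel_cup.1 h.1
    exact ⟨_, adequateRel_cup _, _, adequateRel_cup _, (doubleLabel_insertPair a).symm⟩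
  | cap =>
    obtain ⟨a, rfl⟩ := rel_cap.1 h.1
    rw [doubleLabel_insertPair a]
    exact ⟨_, adequateRel_cap _, _, adequateRel_cap _, rfl⟩
  | cross b =>
    have e0 := fun f : ℕ → S => doubleLabel_even f i
    have e1 := fun f : ℕ → S => doubleLabel_odd f i
    have e2 := fun f : ℕ → S => doubleLabel_even f (i + 1)
    have e3 := fun f : ℕ → S => doubleLabel_odd f (i + 1)
    rw [mul_add, mul_one] at e2
    have e3 : ∀ f : ℕ → S, doubleLabel f (2 * i + 2 + 1) = (f (i + 1), (i + 1 + 1) % 2) := e3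
    have hne : i % 2 ≠ (i + 1) % 2 := by omega
    have heq : (i + 1 + 1) % 2 = i % 2 := by omega
    rw [heq] at e3
    cases b with
    | false =>
      obtain ⟨rfl, h⟩ := adequateRel_cross_false.1 h
      refine ⟨_, adequateRel_cross_false.2 ⟨rfl, ?_⟩, _, adequateRel_cross_false.2 ⟨rfl, ?_⟩, _,
        adequateRel_cross_false.2 ⟨rfl, ?_⟩, _, adequateRel_cross_false.2 ⟨rfl, ?_⟩, rfl⟩
      · rw [e1, show 2 * i + 1 + 1 = 2 * i + 2 from rfl, e2]
        simp [h]
      · rw [e0, e1]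
        simp [hne]
      · rw [e2, e3]
        simp [hne.symm]
      · rw [e1, show 2 * i + 1 + 1 = 2 * i + 2 from rfl, e2]
        simp [h]
    | true =>
      obtain ⟨h1, h2, h3⟩ := adequateRel_cross_true.1 h
      have h4 : g (i + 1) = g i := by
        rw [h2]
        simp [setPair]
      -- From bottom to top, the arcs in the middle belong to the inner copy of the lower circle,
      -- its outer copy, the outer copy of the upper circle, and its inner copy. Inner ends have
      -- parity `(i + 1) % 2`, outer ends `i % 2`.
      refine ⟨_, adequateRel_setPair (a := (f i, i % 2)) ?_ ?_, _,
        adequateRel_setPair (a := (g i, i % 2)) ?_ ?_, _,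
        adequateRel_setPair (a := (g i, i % 2)) ?_ ?_, _,
        (?_ : Layer.AdequateRel (cross true (2 * i + 1)) _ (doubleLabel g)), rfl⟩
      · rw [e1, show 2 * i + 1 + 1 = 2 * i + 2 from rfl, e2, h1]
      · rw [e1]
        simp [hne.symm]
      · simp [setPair, e0]
      · simp [setPair, e0, h3]
      · simp only [setPair, e3, h1]
        grind
      · simp [setPair, h3]
      · convert adequateRel_setPair (i := 2 * i + 1) (a := (g i, (i + 1) % 2)) ?_ ?_ using 1
        · funext n
          by_cases hn : n < 2 * i ∨ 2 * i + 4 ≤ n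
          · have h5 : doubleLabel g n = doubleLabel f n := by
              simp only [doubleLabel]
              rw [h2, setPair, if_neg (by omega)]
            simp only [setPair]
            rw [if_neg (by omega), if_neg (by omega), if_neg (by omega), if_neg (by omega), h5]
          · obtain rfl | rfl | rfl | rfl :
                n = 2 * i ∨ n = 2 * i + 1 ∨ n = 2 * i + 2 ∨ n = 2 * i + 2 + 1 := by omega
            · simp only [setPair, e0]
              grind
            · simp [setPair, e1]
            · simp [setPair, e2, h4]
            · simp [setPair, e3, h4]
        · simp [setPair]
        · simp [setPair, hne]

theorem AdequateRun.double {w : List Layer} (h : AdequateRun w f g) :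
    AdequateRun (doubleWord w) (doubleLabel f) (doubleLabel g) := by
  induction w generalizing f with
  | nil => cases h; rfl
  | cons x w ih =>
    obtain ⟨s, h1, h2⟩ := h
    exact h1.double.append (ih h2)

end

/-- The blackboard parallel of a `B`-adequate diagram with a negative clasp is `B`-adequate. -/
theorem LinkDiagram.BAdequate.claspedParallel {D E : LinkDiagram} {p : D.Point} (hD : D.BAdequate)
    (h : D.IsNegativeClaspedParallel E p) : E.BAdequate := by
  rw [bAdequate_iff] at hD ⊢
  obtain ⟨S, f, g, hD⟩ := hD
  rw [← List.take_append_drop p.1.1 D.word, adequateRun_append] at hD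
  obtain ⟨s, hu, hv⟩ := hD
  refine ⟨_, _, _, h ▸ ((hu.double.map (Option.some_injective _)).append
    (adequateRun_negativeClasp _ _)).append (hv.double.map (Option.some_injective _))⟩

/-- A `B`-adequate diagram with an additional negative kink is `B`-adequate. -/
theorem LinkDiagram.BAdequate.kink {D E : LinkDiagram} {u v : List Layer} {j : ℕ}
    (hD : D.BAdequate) (h : D.word = u ++ v)
    (h' : E.word = u ++ [cup (j + 1), cross true (j + 1), cap j] ++ v) : E.BAdequate := by
  rw [bAdequate_iff] at hD ⊢
  obtain ⟨S, f, g, hD⟩ := hD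
  rw [h, adequateRun_append] at hD
  obtain ⟨s, hu, hv⟩ := hD
  exact ⟨_, _, _, h' ▸ ((hu.map (Option.some_injective _)).append
    (adequateRun_kink _ _)).append (hv.map (Option.some_injective _))⟩

/-! ### The clasped parallel of a knot diagram is a knot diagram -/

section

variable {S : Type*} {f g : ℕ → S} {i : ℕ}

/-- The unordered pairs of the labels of two parallel strands. -/
def pairLabel (f : ℕ → S) (j : ℕ) : Sym2 S := s(f (2 * j), f (2 * j + 1))

/-- The left and right copies trade places at a turn, which is why the pairs have to be unordered.
-/
theorem pairLabel_insertPair (a b : S) :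
    pairLabel (insertPair id (2 * i + 1) b (insertPair id (2 * i) a f)) =
      insertPair id i s(a, b) (pairLabel f) := by
  funext j
  simp only [pairLabel]
  rcases lt_or_ge j i with h | h
  · rw [insertPair_of_lt h, insertPair_of_lt (by omega), insertPair_of_lt (by omega),
      insertPair_of_lt (by omega), insertPair_of_lt (by omega)]
    rfl
  obtain ⟨c, rfl⟩ := Nat.exists_eq_add_of_le h
  rcases c with _ | _ | c
  · simp [insertPair]
  · rw [zero_add, insertPair_succ, show 2 * (i + 1) = 2 * i + 1 + 1 by ring, insertPair_succ,
      show 2 * i + 1 + 1 + 1 = 2 * i + 1 + 2 by ring, insertPair_add le_rfl, insertPair_succ]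
    exact Sym2.eq_swap
  · rw [show i + (c + 1 + 1) = i + c + 2 by ring, insertPair_add (by omega),
      show 2 * (i + c + 2) + 1 = 2 * (i + c) + 1 + 2 + 2 by ring, insertPair_add (by omega),
      insertPair_add (by omega), show 2 * (i + c + 2) = 2 * (i + c) + 2 + 2 by ring,
      insertPair_add (by omega), insertPair_add (by omega)]
    rfl

theorem pairLabel_swapPair : pairLabel (swapPair (2 * i + 1) (swapPair (2 * i + 2)
    (swapPair (2 * i) (swapPair (2 * i + 1) f)))) = swapPair i (pairLabel f) := by
  funext j
  simp only [pairLabel, swapPair]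
  rcases lt_trichotomy j i with h | rfl | h
  · grind
  · grind
  · rcases eq_or_ne j (i + 1) with rfl | h'
    · grind
    · grind

theorem rel_pairLabel {x : Layer} {F : ℕ → ℕ → S} (h : IsLabeling id none x.double F) :
    x.Rel id none (pairLabel (F 0)) (pairLabel (F x.double.length)) := by
  obtain ⟨e, i⟩ := x
  cases e with
  | cup =>
    obtain ⟨a, ha⟩ := rel_cup.1 (h 0 _ rfl)
    obtain ⟨b, hb⟩ := rel_cup.1 (h 1 _ rfl)
    refine rel_cup.2 ⟨s(a, b), ?_⟩
    rw [← pairLabel_insertPair, ← ha, ← hb]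
    rfl
  | cap =>
    obtain ⟨b, hb⟩ := rel_cap.1 (h 0 _ rfl)
    obtain ⟨a, ha⟩ := rel_cap.1 (h 1 _ rfl)
    refine rel_cap.2 ⟨s(a, b), ?_⟩
    rw [zero_add] at hb
    rw [hb, ha, pairLabel_insertPair]
    rfl
  | cross b =>
    have h0 := rel_cross.1 (h 0 _ rfl)
    have h1 := rel_cross.1 (h 1 _ rfl)
    have h2 := rel_cross.1 (h 2 _ rfl)
    have h3 := rel_cross.1 (h 3 _ rfl)
    rw [zero_add] at h0
    rw [h0] at h1
    rw [h1] at h2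
    rw [h2] at h3
    refine rel_cross.2 ?_
    rw [← pairLabel_swapPair, ← h3]
    rfl

end

/-- Without minima every strand can be followed down to the bottom. -/
theorem noClosedStrand_of_forall_ne_cup {w : List Layer} (h : ∀ i, cup i ∉ w) :
    NoClosedStrand w := by
  intro S F hF k
  induction k with
  | zero => exact fun _ j => ⟨j, .inl rfl⟩
  | succ k ih =>
    intro hk j
    have h1 := hF k _ (List.getElem?_eq_getElem hk)
    obtain ⟨c, hc⟩ | ⟨i, hi, -⟩ := exists_eq_of_rel (j := j) h1
    · rw [hc]
      exact ih (by omega) c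
    · exact absurd (hi ▸ List.getElem_mem hk) (h i)

theorem noClosedStrand_double (x : Layer) : NoClosedStrand x.double := by
  obtain ⟨e, i⟩ := x
  cases e with
  | cup => exact noClosedStrand_pair (by simp)
  | cap => exact noClosedStrand_of_forall_ne_cup (by simp [Layer.double])
  | cross b => exact noClosedStrand_of_forall_ne_cup (by simp [Layer.double])

/-- The clasp consists of two turning strands: one joins the two lower ends, with label `a`, and the
other joins the two upper ends, with label `b`. All labels inside occur at the ends. -/
theorem negativeClasp_labels {S : Type*} {F : ℕ → ℕ → S} {i : ℕ}
    (h : IsLabeling id none (negativeClasp i) F) :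
    ∃ a b, F 0 i = a ∧ F 0 (i + 1) = a ∧ F 4 i = b ∧ F 4 (i + 1) = b ∧
      (∀ j, j ≠ i → j ≠ i + 1 → F 4 j = F 0 j) ∧
      ∀ k ≤ 4, ∀ j, (∃ c, F k j = F 0 c) ∨ ∃ c, F k j = F 4 c := by
  obtain ⟨b, h0⟩ := rel_cup.1 (h 0 _ rfl)
  have h1 := rel_cross.1 (h 1 _ rfl)
  have h2 := rel_cross.1 (h 2 _ rfl)
  obtain ⟨a, h3⟩ := rel_cap.1 (h 3 _ rfl)
  simp only [zero_add, Nat.reduceAdd] at h0 h1 h2 h3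
  have hF3 : F 3 = swapPair (i + 2) (swapPair i (insertPair id (i + 1) b (F 0))) := by
    rw [h2, h1, h0]
  rw [hF3] at h3
  have h4 := fun j => congrFun h3 j
  have e0 : F 4 i = b := by
    have := h4 i
    rw [insertPair_of_lt (Nat.lt_succ_self i)] at this
    rw [← this]
    grind [swapPair, insertPair]
  have e1 : F 0 i = a := by
    have := h4 (i + 1)
    rw [insertPair_self] at this
    rw [← this]
    grind [swapPair, insertPair]
  have e2 : F 0 (i + 1) = a := by
    have := h4 (i + 2)
    rw [insertPair_succ, id] at this
    rw [← this]
    grind [swapPair, insertPair]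
  have e3 : F 4 (i + 1) = b := by
    have := h4 (i + 1 + 2)
    rw [insertPair_add le_rfl] at this
    rw [← this]
    grind [swapPair, insertPair]
  have key : ∀ j, (∃ c, F 1 j = F 0 c) ∨ ∃ c, F 1 j = F 4 c := by
    intro j
    obtain ⟨c, hc⟩ | ⟨i', hi', hj⟩ := exists_eq_of_rel (j := j) (h 0 _ rfl)
    · exact .inl ⟨c, hc⟩
    · refine .inr ⟨i, ?_⟩
      rw [h0, e0]
      simp only [cup, Layer.mk.injEq, true_and] at hi'
      subst hi'
      rcases hj with rfl | rfl
      · exact insertPair_self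
      · exact insertPair_succ
  have key2 : ∀ j, ∃ c, F 2 j = F 1 c := fun j =>
    (exists_eq_of_rel (h 1 _ rfl)).resolve_right (by simp)
  have key3 : ∀ j, ∃ c, F 3 j = F 2 c := fun j =>
    (exists_eq_of_rel (h 2 _ rfl)).resolve_right (by simp)
  refine ⟨a, b, e1, e2, e0, e3, fun j hj hj' => ?_, fun k hk j => ?_⟩
  · rcases lt_or_ge j i with hlt | hge
    · have := h4 j
      rw [insertPair_of_lt (by omega)] at this
      rw [← this]
      grind [swapPair, insertPair]
    · have := h4 (j + 2)
      rw [insertPair_add (by omega)] at this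
      rw [← this]
      grind [swapPair, insertPair]
  · obtain rfl | rfl | rfl | rfl | rfl : k = 0 ∨ k = 1 ∨ k = 2 ∨ k = 3 ∨ k = 4 := by omega
    · exact .inl ⟨j, rfl⟩
    · exact key j
    · obtain ⟨c, hc⟩ := key2 j
      rw [hc]
      exact key c
    · obtain ⟨d, hd⟩ := key3 j
      obtain ⟨c, hc⟩ := key2 d
      rw [hd, hc]
      exact key c
    · exact .inr ⟨j, rfl⟩

/-- The height in the parallel of the level `k` of the word `w`. -/
def doubleLevel (w : List Layer) (k : ℕ) : ℕ := (doubleWord (w.take k)).length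

theorem doubleWord_cons (x : Layer) (w : List Layer) :
    doubleWord (x :: w) = x.double ++ doubleWord w := rfl

theorem doubleLevel_cons_succ (x : Layer) (w : List Layer) (k : ℕ) :
    doubleLevel (x :: w) (k + 1) = x.double.length + doubleLevel w k := by
  simp [doubleLevel, doubleWord_cons]

theorem doubleLevel_zero (w : List Layer) : doubleLevel w 0 = 0 := by
  simp [doubleLevel, doubleWord]

theorem doubleLevel_length (w : List Layer) : doubleLevel w w.length = (doubleWord w).length := by
  simp [doubleLevel]

theorem isLabeling_pairLabel {S : Type*} {w : List Layer} {F : ℕ → ℕ → S}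
    (h : IsLabeling id none (doubleWord w) F) :
    IsLabeling id none w fun k => pairLabel (F (doubleLevel w k)) := by
  induction w generalizing F with
  | nil => exact isLabeling_nil
  | cons x w ih =>
    rw [doubleWord_cons, isLabeling_append_iff] at h
    rw [isLabeling_cons_iff]
    have h1 := rel_pairLabel h.1
    have h2 := ih h.2
    simp only [doubleLevel_cons_succ]
    refine ⟨?_, h2⟩
    rw [doubleLevel_zero, doubleLevel_zero]
    exact h1

/-- A property of the labels which holds at the levels that come from `w` holds at all levels of the
parallel of `w`. -/
theorem forall_label_doubleWord {S : Type} {w : List Layer} {F : ℕ → ℕ → S}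
    (h : IsLabeling id none (doubleWord w) F) {Q : S → Prop}
    (hQ : ∀ k ≤ w.length, ∀ j, Q (F (doubleLevel w k) j)) :
    ∀ k ≤ (doubleWord w).length, ∀ j, Q (F k j) := by
  induction w generalizing F with
  | nil =>
    intro k hk j
    obtain rfl : k = 0 := by simpa [doubleWord] using hk
    simpa [doubleLevel_zero] using hQ 0 le_rfl j
  | cons x w ih =>
    rw [doubleWord_cons, isLabeling_append_iff] at h
    have hQ' := ih h.2 fun k hk j => by
      have := hQ (k + 1) (by simpa using hk) j
      rwa [doubleLevel_cons_succ] at this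
    have h0 := hQ 0 (Nat.zero_le _)
    rw [doubleLevel_zero] at h0
    intro k hk j
    rw [doubleWord_cons, List.length_append] at hk
    rcases le_or_gt k x.double.length with hk' | hk'
    · obtain ⟨i, hi | hi⟩ := noClosedStrand_double x S F h.1 k hk' j
      · rw [hi]
        exact h0 i
      · rw [hi]
        exact hQ' 0 (Nat.zero_le _) i
    · obtain ⟨c, rfl⟩ := Nat.exists_eq_add_of_le hk'.le
      exact hQ' c (by omega) j

/-! ### Flux -/

section

variable {S : Type*} {τ : S → S} {φ : S → ℤ}

theorem sum_insertPair (hφ : ∀ a, φ (τ a) = -φ a) (f : ℕ → S) (i t : ℕ) (a : S) :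
    ∑ j ∈ Finset.range (i + 2 + t), φ (insertPair τ i a f j) =
      ∑ j ∈ Finset.range (i + t), φ (f j) := by
  rw [Finset.sum_range_add, Finset.sum_range_add, Finset.sum_range_add]
  have h1 : ∑ j ∈ Finset.range i, φ (insertPair τ i a f j) = ∑ j ∈ Finset.range i, φ (f j) :=
    Finset.sum_congr rfl fun j hj => by rw [insertPair_of_lt (Finset.mem_range.1 hj)]
  have h2 : ∀ j, insertPair τ i a f (i + 2 + j) = f (i + j) := fun j => by
    rw [show i + 2 + j = i + j + 2 by ring, insertPair_add (by omega)]
  simp only [h1, h2, Finset.sum_range_succ, Finset.sum_range_zero, add_zero, insertPair_self,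
    insertPair_succ, hφ]
  ring

/-- A conservation law: the two ends of a turn contribute opposite amounts, and a crossing only
permutes the summands. -/
theorem Layer.Rel.flux (hφ : ∀ a, φ (τ a) = -φ a) {x : Layer} {f g : ℕ → S} {n m : ℕ}
    (h : x.Rel τ none f g) (hx : Fits n [x] m) :
    ∑ j ∈ Finset.range n, φ (f j) = ∑ j ∈ Finset.range m, φ (g j) := by
  obtain ⟨e, i⟩ := x
  obtain ⟨t, rfl, rfl⟩ := fits_singleton.1 hx
  cases e with
  | cup =>
    obtain ⟨a, rfl⟩ := rel_cup.1 h
    exact (sum_insertPair hφ f i t a).symm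
  | cap =>
    obtain ⟨a, rfl⟩ := rel_cap.1 h
    exact sum_insertPair hφ g i t a
  | cross b =>
    obtain rfl := rel_cross.1 h
    simp only [Event.inn, Event.out]
    rw [Finset.sum_range_add, Finset.sum_range_add, Finset.sum_range_add, Finset.sum_range_add]
    have h1 : ∑ j ∈ Finset.range i, φ (swapPair i f j) = ∑ j ∈ Finset.range i, φ (f j) :=
      Finset.sum_congr rfl fun j hj => by
        have := Finset.mem_range.1 hj
        rw [swapPair, if_neg (by omega), if_neg (by omega)]
    have h2 : ∀ j, swapPair i f (i + 2 + j) = f (i + 2 + j) := fun j => by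
      rw [swapPair, if_neg (by omega), if_neg (by omega)]
    simp only [h1, h2, Finset.sum_range_succ, Finset.sum_range_zero, add_zero]
    simp only [swapPair, if_true, Nat.add_eq_left, one_ne_zero, if_false]
    ring

theorem IsLabeling.flux (hφ : ∀ a, φ (τ a) = -φ a) {w : List Layer} {F : ℕ → ℕ → S} {n m : ℕ}
    (h : IsLabeling τ none w F) (hw : Fits n w m) :
    ∑ j ∈ Finset.range n, φ (F 0 j) = ∑ j ∈ Finset.range m, φ (F w.length j) := by
  induction w generalizing n F with
  | nil => cases hw; rfl
  | cons x w ih =>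
    rw [isLabeling_cons_iff] at h
    obtain ⟨k, h1, h2⟩ := fits_append.1 (show Fits n ([x] ++ w) m from hw)
    exact (h.1.flux hφ h1).trans (ih h.2 h2)

theorem IsLabeling.prod {S' : Type*} {τ' : S' → S'} {ρ : Option Resolution} {w : List Layer}
    {F : ℕ → ℕ → S} {F' : ℕ → ℕ → S'} (h : IsLabeling τ ρ w F) (h' : IsLabeling τ' ρ w F') :
    IsLabeling (Prod.map τ τ') ρ w fun k j => (F k j, F' k j) := by
  intro k x hx
  obtain ⟨h1, h2, h3⟩ := h k x hx
  obtain ⟨h1', h2', h3'⟩ := h' k x hx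
  refine ⟨fun j hj => Prod.ext (h1 j hj) (h1' j hj), fun j => Prod.ext (h2 j) (h2' j),
    fun a ha => ?_⟩
  have key : ∀ c, x.endLabel (fun j => (F k j, F' k j)) (fun j => (F (k + 1) j, F' (k + 1) j)) c =
      (x.endLabel (F k) (F (k + 1)) c, x.endLabel (F' k) (F' (k + 1)) c) := fun c => by
    simp only [Layer.endLabel]
    split_ifs <;> rfl
  rw [key, key, h3 a ha, h3' a ha]
  split_ifs <;> rfl

end

open Classical in
/-- A label that changes at one point of an oriented diagram, and is constant along the strands
elsewhere, is constant at that point, too. -/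
theorem label_eq_of_cut {S : Type*} {u v : List Layer} {n i : ℕ} {F G : ℕ → ℕ → S}
    {o : ℕ → ℕ → Bool} (hu : Fits 0 u n) (hv : Fits n v 0) (hF : IsLabeling id none u F)
    (hG : IsLabeling id none v G) (ho : IsLabeling not none (u ++ v) o)
    (h : ∀ j, j ≠ i → G 0 j = F u.length j) (hi : i < n) : G 0 i = F u.length i := by
  rw [isLabeling_append_iff] at ho
  -- Counts with direction the strands that carry the label found just below the cut; reversing a
  -- strand changes the sign.
  let φ : S × Bool → ℤ := fun a => if a.1 = F u.length i then (if a.2 then 1 else -1) else 0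
  have hφ : ∀ a, φ (Prod.map id not a) = -φ a := by
    rintro ⟨a, b⟩
    cases b <;> simp only [φ, Prod.map, id] <;> split_ifs <;> simp_all
  have h1 := (hF.prod ho.1).flux hφ hu
  have h2 := (hG.prod ho.2).flux hφ hv
  simp only [Finset.range_zero, Finset.sum_empty, add_zero] at h1 h2
  have h3 := Finset.sum_erase_add (Finset.range n) (fun j => φ (F u.length j, o u.length j))
    (Finset.mem_range.2 hi)
  have h4 := Finset.sum_erase_add (Finset.range n) (fun j => φ (G 0 j, o u.length j))
    (Finset.mem_range.2 hi)
  have h5 : ∑ j ∈ (Finset.range n).erase i, φ (G 0 j, o u.length j) =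
      ∑ j ∈ (Finset.range n).erase i, φ (F u.length j, o u.length j) :=
    Finset.sum_congr rfl fun j hj => by rw [h j (Finset.ne_of_mem_erase hj)]
  -- Both total fluxes at the cut vanish, since no strand leaves the diagram, and all other strands
  -- contribute equally. The right side is `±1`, so the label above the cut must be the counted one.
  have h6 : φ (G 0 i, o u.length i) = φ (F u.length i, o u.length i) := by linarith
  by_contra hne
  simp only [φ, if_neg hne, if_true] at h6
  split_ifs at h6; omega

/-- Pairs of labels of parallel strands form a labeling of `D` cut open at the clasp. There the pair
is `s(a, a)` below and `s(b, b)` above; the flux argument, which uses the orientation contained in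
the writhe, closes the cut. Since `D` is a knot, every pair is `s(a, a)`. -/
theorem LinkDiagram.IsNegativeClaspedParallel.isKnot {D E : LinkDiagram} {p : D.Point} {w : ℤ}
    (h : D.IsNegativeClaspedParallel E p) (hD : D.IsKnot) (hw : D.HasWrithe w) : E.IsKnot := by
  obtain ⟨⟨k₀, i⟩, hk₀, hi⟩ := p
  obtain ⟨hu, hv⟩ := D.fits_take_drop k₀
  simp only [IsNegativeClaspedParallel] at h hk₀ hi
  generalize hn : D.width k₀ = n at hu hv hi
  have huv : D.word = D.word.take k₀ ++ D.word.drop k₀ := (List.take_append_drop _ _).symm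
  generalize D.word.take k₀ = u at h hu huv
  generalize D.word.drop k₀ = v at h hv huv
  change E.word = doubleWord u ++ negativeClasp (2 * i) ++ doubleWord v at h
  have hc : Fits (2 * n) (negativeClasp (2 * i)) (2 * n) := by
    simp only [negativeClasp, Fits, Layer.above, Event.inn, Event.out]
    omega
  have h' : E.word = doubleWord u ++ (negativeClasp (2 * i) ++ doubleWord v) := by
    rw [h, List.append_assoc]
  refine isKnot_of_label_eq ⟨⟨_, E.isPoint_length h' hu.double (show 0 < 2 * n by omega)⟩⟩ ?_
  intro F hF hF2
  rw [h, isLabeling_append_iff, isLabeling_append_iff] at hF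
  obtain ⟨⟨hFu, hFc⟩, hFv⟩ := hF
  obtain ⟨a, b, ha, ha', hb, hb', hab, hFc'⟩ := negativeClasp_labels hFc
  simp only [add_zero] at ha ha' hab hFc'
  have hlen : (doubleWord u ++ negativeClasp (2 * i)).length = (doubleWord u).length + 4 := by
    simp [negativeClasp]
  simp only [hlen] at hFv
  have hGu := isLabeling_pairLabel hFu
  have hGv := isLabeling_pairLabel hFv
  obtain ⟨o, ho⟩ : ∃ o, IsLabeling not none D.word o := by
    obtain ⟨f, g, hr⟩ := hasWrithe_iff_run.1 hw
    obtain ⟨o, -, -, ho, -⟩ := run_iff_exists_isLabeling.1 hr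
    exact ⟨o, ho⟩
  have hi0 : pairLabel (F (doubleWord u).length) i = s(a, a) := by simp only [pairLabel, ha, ha']
  have hne : ∀ j, j ≠ i → pairLabel (F ((doubleWord u).length + 4 + doubleLevel v 0)) j =
      pairLabel (F (doubleLevel u u.length)) j := by
    intro j hj
    rw [doubleLevel_zero, doubleLevel_length]
    simp only [pairLabel, add_zero]
    rw [hab _ (by omega) (by omega), hab _ (by omega) (by omega)]
  have hcut := label_eq_of_cut hu hv hGu hGv (huv ▸ ho) hne hi
  have hjoin : pairLabel (F (doubleLevel u u.length)) =
      pairLabel (F ((doubleWord u).length + 4 + doubleLevel v 0)) := by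
    funext j
    by_cases hj : j = i
    · rw [hj, hcut]
    · rw [hne j hj]
  have hG := hGu.append hGv hjoin
  rw [← huv] at hG
  have hconst : ∀ q, D.IsPoint q → glue u.length (fun k => pairLabel (F (doubleLevel u k)))
      (fun k => pairLabel (F ((doubleWord u).length + 4 + doubleLevel v k))) q.1 q.2 =
      s(a, a) := by
    intro q hq
    rw [hD.label_eq hG hq (D.isPoint_length huv hu hi), glue_of_le le_rfl, doubleLevel_length, hi0]
  -- The labels are wanted only at actual strands; padding is the second alternative. In this form
  -- the property holds for all indices and can be carried to the levels inside doubled layers and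
  -- inside the clasp.
  let Q : Prop × Bool → Prop := fun c => c = a ∨ c.2 = false
  have level : ∀ k l (G : ℕ → Prop × Bool), k ≤ D.word.length →
      (∀ j, (G j).2 = true ↔ j < E.width l) → E.width l = 2 * D.width k →
      (∀ j, D.IsPoint (k, j) → pairLabel G j = s(a, a)) → ∀ j, Q (G j) := by
    intro k l G hk hG hl hG' j
    by_cases hj : j < E.width l
    · left
      have := hG' (j / 2) ⟨hk, by simp only; omega⟩
      simp only [pairLabel, Sym2.eq_iff, or_self] at this
      obtain hj2 | hj2 : j = 2 * (j / 2) ∨ j = 2 * (j / 2) + 1 := by omega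
      · rw [hj2]; exact this.1
      · rw [hj2]; exact this.2
    · right
      rw [← hG] at hj
      simpa using hj
  have hQu : ∀ k ≤ u.length, ∀ j, Q (F (doubleLevel u k) j) := by
    intro k hk
    refine level k _ _ (by rw [huv]; simp; omega) (hF2 _) ?_ fun j hj => ?_
    · have hfit := (D.fits_take_drop k).1
      have htake : D.word.take k = u.take k := by
        rw [huv, List.take_append_of_le_length hk]
      rw [htake] at hfit
      refine E.width_length (u := doubleWord (u.take k))
        (v := doubleWord (u.drop k) ++ (negativeClasp (2 * i) ++ doubleWord v)) ?_ hfit.double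
      rw [h', ← List.append_assoc (doubleWord (u.take k)), ← doubleWord_append, List.take_append_drop]
    · have := hconst _ hj
      rwa [glue_of_le hk] at this
  have hQv : ∀ k ≤ v.length, ∀ j, Q (F ((doubleWord u).length + 4 + doubleLevel v k) j) := by
    intro k hk
    refine level (u.length + k) _ _ (by rw [huv]; simp; omega) (hF2 _) ?_ fun j hj => ?_
    · have hfit := (D.fits_take_drop (u.length + k)).1
      have htake : D.word.take (u.length + k) = u ++ v.take k := by
        rw [huv, List.take_length_add_append]
      rw [htake] at hfit
      obtain ⟨n', h1, h2⟩ := fits_append.1 hfit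
      obtain rfl := h1.unique hu
      have := E.width_length (u := doubleWord u ++ negativeClasp (2 * i) ++ doubleWord (v.take k))
        (v := doubleWord (v.drop k)) (by
          rw [h, List.append_assoc _ (doubleWord _) (doubleWord _), ← doubleWord_append,
            List.take_append_drop]) ((hu.double.append hc).append h2.double)
      rwa [List.length_append, hlen] at this
    · have := hconst _ hj
      rwa [glue_add hjoin] at this
  have hQu' := forall_label_doubleWord hFu hQu
  have hQv' := forall_label_doubleWord hFv hQv
  have hQ : ∀ k ≤ E.word.length, ∀ j, Q (F k j) := by
    intro k hk j
    rw [h, List.length_append, hlen] at hk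
    rcases le_or_gt k (doubleWord u).length with hk' | hk'
    · exact hQu' k hk' j
    obtain ⟨c, rfl⟩ := Nat.exists_eq_add_of_le hk'.le
    rcases le_or_gt c 4 with hc' | hc'
    · obtain ⟨d, hd⟩ | ⟨d, hd⟩ := hFc' c hc' j
      · rw [hd]
        exact hQu' _ le_rfl d
      · rw [hd]
        exact hQv' 0 (Nat.zero_le _) d
    · obtain ⟨e, rfl⟩ := Nat.exists_eq_add_of_le hc'.le
      rw [← add_assoc]
      exact hQv' e (by omega) j
  have hpt : ∀ q, E.IsPoint q → F q.1 q.2 = a := fun q hq =>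
    (hQ q.1 hq.1 q.2).resolve_right (by simp [(hF2 q.1 q.2).2 hq.2])
  intro p q hp hq
  rw [hpt p hp, hpt q hq]

/-! ### Whitehead doubles -/

/-- A diagram with a negative kink at a point. -/
def LinkDiagram.addKink (D : LinkDiagram) (p : D.Point) : LinkDiagram where
  word := D.word.take p.1.1 ++ [cup (p.1.2 + 1), cross true (p.1.2 + 1), cap p.1.2] ++
    D.word.drop p.1.1
  closes := by
    obtain ⟨hu, hv⟩ := D.fits_take_drop p.1.1
    refine closesFrom_iff_fits.2 ((hu.append ?_).append hv)
    have := p.2.2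
    simp only [Fits, Layer.above, Event.inn, Event.out]
    omega

theorem LinkDiagram.equivalent_addKink (D : LinkDiagram) (p : D.Point) :
    (D.addKink p).Equivalent D ∧ ∀ w, D.HasWrithe w → (D.addKink p).HasWrithe (w - 1) := by
  obtain ⟨hu, hv⟩ := D.fits_take_drop p.1.1
  have hp := p.2.2
  -- The strand is bent to a zigzag, which keeps the writhe; the kink sits on the minimum of the
  -- zigzag.
  let E : LinkDiagram := ⟨D.word.take p.1.1 ++ [cup (p.1.2 + 1), cap p.1.2] ++ D.word.drop p.1.1, by
    refine closesFrom_iff_fits.2 ((hu.append ?_).append hv)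
    simp only [Fits, Layer.above, Event.inn, Event.out]
    omega⟩
  have h1 : MoveFraming [cup (p.1.2 + 1), cross true (p.1.2 + 1)] [cup (p.1.2 + 1)]
      (kinkSign true) := .inr (.inr ⟨_, _, rfl, rfl, rfl⟩)
  have h2 : MoveFraming [cup (p.1.2 + 1), cap p.1.2] [] 0 := .inl ⟨.zigzag _, rfl⟩
  have hK : (D.addKink p).word = D.word.take p.1.1 ++
      [cup (p.1.2 + 1), cross true (p.1.2 + 1)] ++ (cap p.1.2 :: D.word.drop p.1.1) := by
    simp [addKink]
  have hE : E.word = D.word.take p.1.1 ++ [cup (p.1.2 + 1)] ++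
      (cap p.1.2 :: D.word.drop p.1.1) := by
    simp [E]
  have hE' : E.word = D.word.take p.1.1 ++ [cup (p.1.2 + 1), cap p.1.2] ++ D.word.drop p.1.1 := rfl
  have hD : D.word = D.word.take p.1.1 ++ [] ++ D.word.drop p.1.1 := by simp
  refine ⟨.trans _ E _ (.rel _ _ ⟨_, _, _, _, h1.move, hK, hE⟩)
    (.rel _ _ ⟨_, _, _, _, h2.move, hE', hD⟩), fun w hw => ?_⟩
  rw [hasWrithe_iff_of_move h1 hK hE, hasWrithe_iff_of_move h2 hE' hD]
  simpa [kinkSign] using hw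

/-- A `B`-adequate knot diagram of non-negative writhe is equivalent to a `B`-adequate diagram of
writhe `0`. -/
theorem LinkDiagram.BAdequate.exists_writhe_zero (n : ℕ) {D : LinkDiagram} (hK : D.IsKnot)
    (hD : D.BAdequate) (hw : D.HasWrithe n) :
    ∃ E : LinkDiagram, E.Equivalent D ∧ E.IsKnot ∧ E.BAdequate ∧ E.HasWrithe 0 := by
  induction n generalizing D with
  | zero => exact ⟨D, .refl _, hK, hD, hw⟩
  | succ n ih =>
    obtain ⟨p⟩ := hK.exists_point
    obtain ⟨h1, h2⟩ := D.equivalent_addKink p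
    have hK' := h1.clasped.1.2 hK
    have hw' := h2 _ hw
    rw [Nat.cast_succ, add_sub_cancel_right] at hw'
    obtain ⟨E, hE, h⟩ := ih hK' (hD.kink (List.take_append_drop p.1.1 D.word).symm rfl) hw'
    exact ⟨E, .trans _ _ _ hE h1, h⟩

theorem LinkDiagram.isNegativeClaspedParallel_iff {D E : LinkDiagram} {p : D.Point} :
    D.IsNegativeClaspedParallel E p ↔ E.word = D.clasped p.1 0 := by
  have h : shift (2 * p.1.2) (twistedClasp 0) = negativeClasp (2 * p.1.2) := by
    change shift _ (negativeClasp 0 ++ []) = _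
    simp [negativeClasp, shift]
  rw [clasped, claspedWord, h]
  rfl

end KnotTheory

/-! ### The proposition -/

open KnotTheory in
theorem mainTheorem9 (K : KnotTheory.Knot)
    (hK : ∃ (D : KnotTheory.LinkDiagram) (w : ℤ),
      K.HasDiagram D ∧ D.BAdequate ∧ D.HasWrithe w ∧ 0 ≤ w) :
    (∃ W : KnotTheory.Knot, W.IsUntwistedNegativeWhiteheadDouble K) ∧
      ∀ W : KnotTheory.Knot, W.IsUntwistedNegativeWhiteheadDouble K → W.BAdequate := by
  obtain ⟨D₁, w, ⟨hD₁, rfl⟩, hadq, hw, hw0⟩ := hK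
  lift w to ℕ using hw0
  obtain ⟨D, hequiv, hD, hadq, hw⟩ := hadq.exists_writhe_zero w hD₁ hw
  obtain ⟨p⟩ := hD.exists_point
  -- The diagram has writhe `0`, so no compensating twists are inserted. This one diagram proves
  -- existence and also serves as the adequate diagram of every `W`.
  let E : LinkDiagram := ⟨D.clasped p.1 0, closesFrom_iff_fits.2 (D.fits_clasped p.2 0)⟩
  have hE : D.IsNegativeClaspedParallel E p := LinkDiagram.isNegativeClaspedParallel_iff.2 rfl
  have hEK := hE.isKnot hD hw
  refine ⟨⟨Quotient.mk knotSetoid ⟨E, hEK⟩, D, E, p, ⟨hD, ?_⟩, hw, hE, hEK, rfl⟩, ?_⟩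
  · exact Quotient.sound (Relation.EqvGen.symm _ _ hequiv)
  · rintro W ⟨D', E', p', ⟨hD', hDD'⟩, hw', hE', hE'K, rfl⟩
    refine ⟨E, ⟨hEK, ?_⟩, hadq.claspedParallel hE⟩
    have h1 : D₁.Equivalent D' := Quotient.exact hDD'
    have h2 : D'.Equivalent D := .symm _ _ (.trans _ _ _ hequiv h1)
    obtain ⟨-, d, h3, h4⟩ := h2.clasped
    -- Both diagrams have writhe `0`, so no full twists appear when one clasped parallel is carried
    -- to the other.
    have hd : 0 - d = 0 := hD.writhe_unique ((h3 0).1 hw') hw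
    obtain rfl : d = 0 := by simpa using hd
    have h5 := h4 hD' p' p 0
    rw [add_zero] at h5
    have h6 := LinkDiagram.isNegativeClaspedParallel_iff.1 hE'
    obtain ⟨word, closes⟩ := E'
    simp only at h6
    subst h6
    exact Quotient.sound (h5.equivalent closes E.closes)
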